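/- **Setting.** Let $[n]=\{1,\dots,n\}$, and write $w\in S_n$ in one-line notation $w_1\cdots w_n$, with $w[k]=\{w_1,\dots,w_k\}$, $s_i=(i\ i{+}1)$, $(ws_i)_k=w_{s_i(k)}$, and $\ell(w)$ the number of inversions. For $a,b\in[n]$ let $[a,b)_c=\{a,\dots,b-1\}$ if $a\le b$ and $[a,b)_c=\{a,\dots,n\}\cup\{1,\dots,b-1\}$ if $a>b$. For $r\in[n]$ let $<_r$ be the order $r<_r r+1<_r\cdots<_r n<_r 1<_r\cdots<_r r-1$; for $A,B\subseteq[n]$ of the same size put $A\le_r B$ if the increasing enumerations of $A$ and $B$ with respect to $<_r$ satisfy this inequality entrywise. Let $\mathbf a=(a_1,\dots,a_n)\in[n]^n$ and put $a_{n+1}:=1$. Write $u\le_{\mathbf a}v$ if $u[k]\le_{a_k}v[k]$ for all $k\in[n]$, and $u\lesssim_{\mathbf a}v$ if moreover $|u[k]\cap[a_k,a_{k+1})_c|=|v[k]\cap[a_k,a_{k+1})_c|$ for all $k\in[n]$. **Tilted reduced words.** A jump of $\mathbf a$ is a $j\in[n]$ with $a_j\ne a_{j+1}$. If $\mathbf a$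 has jumps, let $j$ be the smallest one; $\mathrm{flat}(\mathbf a)$ is obtained from $\mathbf a$ by replacing its first $j$ entries by $a_{j+1}$, and $w\in S_n$ is $\mathbf a$-flattenable if for some $0\le p\le j$ we have $w_i\in[a_1,a_{j+1})_c$ for $i\le p$ and $w_i\in[a_{j+1},a_1)_c$ for $p<i\le j$. An $\mathbf a$-tilted word for $w$ is a sequence of simple transpositions and bars, defined recursively on the number of jumps: if $\mathbf a$ has no jumps it is any sequence of simple transpositions with product $w$ (and no bars); otherwise it consists of a $\mathrm{flat}(\mathbf a)$-tilted word for some $\mathbf a$-flattenable $w'$, followed by a bar, followed by simple transpositions $s_i$ with $i$ not a jump of $\mathbf a$, the product of all simple transpositions being $w$. It is reduced if its number of factors (bars included) is minimal among all $\mathbf a$-tilted words for $w$. **Tilted R-polynomial.** For a field $F$, let $\mathcal T^\circ_{u,v,\mathbf a}(F)$ be the set of complete flags $F_1\subset\cdots\subset F_n=F^n$ such that for all $i,k\in[n]$ $$\mathrm{rank}_{[a_k,i)_c}(F_k)=|u[k]\cap[a_k,i)_c|,\qquad \mathrm{rank}_{[i,a_k)_c}(F_k)=|v[k]\cap[i,a_k)_c|,$$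 where $\mathrm{rank}_S(F_k)$ is the dimension of the image of $F_k$ under the projection to the coordinates in $S$. This set is the same for all $\mathbf a$ with $u\le_{\mathbf a}v$, and is denoted $\mathcal T^\circ_{u,v}(F)$. The tilted R-polynomial $R^{\mathrm{tilt}}_{u,v}\in\mathbb Z[q]$ is the polynomial with $R^{\mathrm{tilt}}_{u,v}(q)=\#\mathcal T^\circ_{u,v}(\mathbb F_q)$ for every prime power $q$. **Lengths and Hecke algebra.** Let $\ell(u,v)$ be the length of a shortest directed path from $u$ to $v$ in the quantum Bruhat graph, which has the edges $w\to w\,(i\ j)$, $i<j$, with $\ell(w(i\ j))=\ell(w)+1$ or $\ell(w(i\ j))=\ell(w)+1-2(j-i)$. Let $\mathcal H$ be the $\mathbb Z[q,q^{-1}]$-algebra generated by $T_1,\dots,T_{n-1}$ with relations $$T_i^2=(1-q)T_i+q,\qquad T_iT_j=T_jT_i\ (|i-j|>1),\qquad T_iT_{i+1}T_i=T_{i+1}T_iT_{i+1}.$$ It is free with basis $T_w=T_{i_1}\cdots T_{i_\ell}$, $w\in S_n$ ($s_{i_1}\cdots s_{i_\ell}$ any ordinary reduced word of $w$), and the trace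 $\epsilon:\mathcal H\to\mathbb Z[q,q^{-1}]$ is the linear map with $\epsilon(T_{\mathrm{id}})=1$ and $\epsilon(T_w)=0$ for $w\ne\mathrm{id}$. For a tilted word $\mathbf w$ with simple transpositions $s_{i_1},\dots,s_{i_\ell}$ (bars omitted) put $T_{\mathbf w}=T_{i_1}\cdots T_{i_\ell}$, an invertible element. **Theorem.** Let $u,v\in S_n$ and $\mathbf a\in[n]^n$ with $u\lesssim_{\mathbf a}v$, and let $\mathbf u,\mathbf v$ be any $\mathbf a$-tilted reduced words for $u$ and $v$. Then the polynomial $R^{\mathrm{tilt}}_{u,v}$ exists and is unique, and $$R^{\mathrm{tilt}}_{u,v}(q)=q^{\ell(u,v)}\,\epsilon\big(T_{\mathbf v}^{-1}T_{\mathbf u}\big).$$ Likewise, for the algebra with $T_i^2=(q-1)T_i+q$ instead (the other relations, $T_{\mathbf w}$ and $\epsilon$ being defined in the same way), $R^{\mathrm{tilt}}_{u,v}(q)=(-q)^{\ell(u,v)}\,\epsilon(T_{\mathbf v}^{-1}T_{\mathbf u})$. -/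

import Mathlib

open scoped LaurentPolynomial Polynomial

namespace TiltedRichardson

/-! Throughout, the set `[n] = {1, …, n}` is modelled by `Fin n` (all indices and values are shifted
down by one), and a permutation `w` is read in one-line notation `w 0, w 1, …, w (n - 1)`. -/

section Combinatorics

variable {n : ℕ}

/-- The cyclic interval `[a, b)_c`; it is empty for `a = b`. -/
def cyclicIco (a b : Fin n) : Finset (Fin n) :=
  if a ≤ b then Finset.Ico a b else Finset.Ici a ∪ Finset.Iio b

/-- The shifted Gale order `A ≤_r B`. Subtraction in `Fin n` is modulo `n`, so `x ↦ x - r` carries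
the order `r <_r r + 1 <_r ⋯ <_r r - 1` to the usual one; the increasing enumerations of
`A` and `B` with respect to `<_r` are compared entry by entry (and `A`, `B` have equal size). -/
def ShiftedGaleLE (r : Fin n) (A B : Finset (Fin n)) : Prop :=
  List.Forall₂ (· ≤ ·) ((A.image (· - r)).sort (· ≤ ·)) ((B.image (· - r)).sort (· ≤ ·))

/-- `w[k] = {w_1, …, w_k}`, the set of the first `k` entries of `w`. -/
def firstEntries (w : Equiv.Perm (Fin n)) (k : ℕ) : Finset (Fin n) :=
  (Finset.univ.filter fun i : Fin n => (i : ℕ) < k).image w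

/-- The entry of `a` after position `k`, with the convention `a_{n+1} = 1`. -/
def nextEntry (a : Fin n → Fin n) (k : Fin n) : Fin n :=
  if h : (k : ℕ) + 1 < n then a ⟨k + 1, h⟩ else ⟨0, k.pos⟩

/-- The `a`-tilted Bruhat order `u ≤_a v`. -/
def TiltedLE (a : Fin n → Fin n) (u v : Equiv.Perm (Fin n)) : Prop :=
  ∀ k : Fin n, ShiftedGaleLE (a k) (firstEntries u (k + 1)) (firstEntries v (k + 1))

/-- The equivalence relation `u ∼_a v`. -/
def TiltedEquiv (a : Fin n → Fin n) (u v : Equiv.Perm (Fin n)) : Prop :=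
  ∀ k : Fin n, (firstEntries u (k + 1) ∩ cyclicIco (a k) (nextEntry a k)).card =
    (firstEntries v (k + 1) ∩ cyclicIco (a k) (nextEntry a k)).card

/-- The `a`-tilted Bruhat order modulo `∼_a`, written `u ≲_a v`. -/
def TiltedLESim (a : Fin n → Fin n) (u v : Equiv.Perm (Fin n)) : Prop :=
  TiltedLE a u v ∧ TiltedEquiv a u v

/-- The number of inversions of `w`. -/
def permLength (w : Equiv.Perm (Fin n)) : ℕ :=
  (Finset.univ.filter fun p : Fin n × Fin n => p.1 < p.2 ∧ w p.2 < w p.1).card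

/-- The edges `w ⟶ w t_{ij}` of the quantum Bruhat graph: `ℓ(w t_{ij}) = ℓ(w) + 1` or
`ℓ(w t_{ij}) = ℓ(w) + 1 - 2 (j - i)`. -/
def QuantumBruhatEdge (w w' : Equiv.Perm (Fin n)) : Prop :=
  ∃ i j : Fin n, i < j ∧ w' = w * Equiv.swap i j ∧
    ((permLength w' : ℤ) = permLength w + 1 ∨
      (permLength w' : ℤ) = permLength w + 1 - 2 * ((j : ℤ) - (i : ℤ)))

/-- There is a directed path with `m` edges from `u` to `v` in the quantum Bruhat graph. -/
def QuantumBruhatPath (m : ℕ) (u v : Equiv.Perm (Fin n)) : Prop :=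
  ∃ p : ℕ → Equiv.Perm (Fin n), p 0 = u ∧ p m = v ∧ ∀ i < m, QuantumBruhatEdge (p i) (p (i + 1))

/-- `ℓ(u, v)`, the length of a shortest directed path from `u` to `v` in the quantum Bruhat graph
(the graph is strongly connected). -/
noncomputable def quantumBruhatDist (u v : Equiv.Perm (Fin n)) : ℕ :=
  sInf {m | QuantumBruhatPath m u v}

end Combinatorics

section Words

variable {n : ℕ}

/-- Position `i` of the simple transposition `s_i = (i  i+1)`. -/
def lo (i : Fin (n - 1)) : Fin n := ⟨i, by omega⟩

/-- Position `i + 1` of the simple transposition `s_i = (i  i+1)`. -/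
def hi (i : Fin (n - 1)) : Fin n := ⟨i + 1, by omega⟩

/-- The simple transposition `s_i`. -/
def simpleSwap (i : Fin (n - 1)) : Equiv.Perm (Fin n) := Equiv.swap (lo i) (hi i)

/-- The product `s_{i_1} ⋯ s_{i_ℓ}` of a word in the simple transpositions. -/
def wordProd (l : List (Fin (n - 1))) : Equiv.Perm (Fin n) := (l.map simpleSwap).prod

/-- The set of jumps of `a`. -/
def jumps (a : Fin n → Fin n) : Set (Fin n) := {j | a j ≠ nextEntry a j}

/-- For the minimal jump `j` of `a`, this is the flattening of `a`. -/
def flattenAt (a : Fin n → Fin n) (j : Fin n) : Fin n → Fin n :=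
  fun k => if k ≤ j then nextEntry a j else a k

/-- For the minimal jump `j` of `a`: the permutation `w` is `a`-flattenable. Here `p` is the number of
initial positions whose entries lie in `[a_1, a_{j+1})_c`, so `0 ≤ p ≤ j` for the 1-based `j`. -/
def IsFlattenableAt (a : Fin n → Fin n) (j : Fin n) (w : Equiv.Perm (Fin n)) : Prop :=
  ∃ p : ℕ, p ≤ (j : ℕ) + 1 ∧
    (∀ i : Fin n, (i : ℕ) < p → w i ∈ cyclicIco (a ⟨0, j.pos⟩) (nextEntry a j)) ∧
    (∀ i : Fin n, p ≤ (i : ℕ) → i ≤ j → w i ∈ cyclicIco (nextEntry a j) (a ⟨0, j.pos⟩))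

/-- The factors of a tilted word: simple transpositions and bars. -/
inductive Factor (n : ℕ) : Type
  | s (i : Fin (n - 1)) : Factor n
  | bar : Factor n

/-- `IsTiltedWord a ws w`: the sequence of factors `ws` is an `a`-tilted word for `w`. If `a` has no
jumps, it is a classical word. Otherwise it consists of a word for some `a`-flattenable
permutation, tilted by the flattening of `a`, then the last bar, then simple transpositions
`s_i` with `i` not a jump of `a`. -/
inductive IsTiltedWord : (Fin n → Fin n) → List (Factor n) → Equiv.Perm (Fin n) → Prop
  | base (a : Fin n → Fin n) (ha : jumps a = ∅) (l : List (Fin (n - 1))) :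
      IsTiltedWord a (l.map Factor.s) (wordProd l)
  | step (a : Fin n → Fin n) (j : Fin n) (hj : IsLeast (jumps a) j) (pre : List (Factor n))
      (w' : Equiv.Perm (Fin n)) (hpre : IsTiltedWord (flattenAt a j) pre w')
      (hflat : IsFlattenableAt a j w') (l : List (Fin (n - 1))) (hl : ∀ i ∈ l, lo i ∉ jumps a) :
      IsTiltedWord a (pre ++ Factor.bar :: l.map Factor.s) (w' * wordProd l)

/-- An `a`-tilted reduced word for `w`: an `a`-tilted word for `w` with the least possible number
of factors (bars included). -/
def IsTiltedReducedWord (a : Fin n → Fin n) (ws : List (Factor n)) (w : Equiv.Perm (Fin n)) : Prop :=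
  IsTiltedWord a ws w ∧ ∀ ws', IsTiltedWord a ws' w → ws.length ≤ ws'.length

end Words

section Richardson

variable {n : ℕ} {F : Type*} [Field F]

/-- A complete flag in `F^n`; `space k` is the subspace `F_{k+1}`, of dimension `k + 1`. -/
@[ext]
structure CompleteFlag (F : Type*) [Field F] (n : ℕ) where
  space : Fin n → Submodule F (Fin n → F)
  mono : Monotone space
  finrank_space : ∀ k, Module.finrank F (space k) = (k : ℕ) + 1

/-- `rank_S(V)`: the dimension of the image of `V` under the projection `F^n → F^S`, that is, the rank
of the rows indexed by `S` of any matrix whose columns span `V`. -/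
noncomputable def rowRank (S : Finset (Fin n)) (V : Submodule F (Fin n → F)) : ℕ :=
  Module.finrank F (V.map (LinearMap.funLeft F F (Subtype.val : S → Fin n)))

/-- The `F`-points of the open tilted Richardson variety `T°_{u,v,a}`. -/
def openTiltedRichardsonAt (F : Type*) [Field F] (a : Fin n → Fin n) (u v : Equiv.Perm (Fin n)) :
    Set (CompleteFlag F n) :=
  {x | ∀ i k : Fin n,
    rowRank (cyclicIco (a k) i) (x.space k) =
        (firstEntries u (k + 1) ∩ cyclicIco (a k) i).card ∧
      rowRank (cyclicIco i (a k)) (x.space k) =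
        (firstEntries v (k + 1) ∩ cyclicIco i (a k)).card}

/-- The `F`-points of the open tilted Richardson variety `T°_{u,v}`: the set `T°_{u,v,a}` is the same
for all `a` with `u ≤_a v`, and `T°_{u,v}` is this common set. -/
def openTiltedRichardson (F : Type*) [Field F] (u v : Equiv.Perm (Fin n)) :
    Set (CompleteFlag F n) :=
  {x | ∃ a : Fin n → Fin n, TiltedLE a u v ∧ x ∈ openTiltedRichardsonAt F a u v}

/-- `R` is the tilted R-polynomial of `u` and `v`: its value at `q` is the number of
`𝔽_q`-points of `T°_{u,v}`, for all finite fields `𝔽_q`. -/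
def IsTiltedRPolynomial (u v : Equiv.Perm (Fin n)) (R : ℤ[X]) : Prop :=
  ∀ (F : Type) [Field F] [Finite F],
    R.eval (Nat.card F : ℤ) = (Nat.card (openTiltedRichardson F u v) : ℤ)

end Richardson

section Hecke

/-- The indeterminate `q` of `ℤ[q, q⁻¹]`. -/
noncomputable def qq : ℤ[T;T⁻¹] := LaurentPolynomial.T 1

/-- The defining relations of the Hecke algebra of `S_n`, with quadratic relation
`T_i² = b T_i + q`. -/
inductive HeckeRel (n : ℕ) (b : ℤ[T;T⁻¹]) :
    FreeAlgebra ℤ[T;T⁻¹] (Fin (n - 1)) → FreeAlgebra ℤ[T;T⁻¹] (Fin (n - 1)) → Prop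
  | quad (i : Fin (n - 1)) :
      HeckeRel n b (FreeAlgebra.ι _ i * FreeAlgebra.ι _ i)
        (b • FreeAlgebra.ι _ i + algebraMap _ _ qq)
  | comm (i j : Fin (n - 1)) (h : (i : ℕ) + 1 < j) :
      HeckeRel n b (FreeAlgebra.ι _ i * FreeAlgebra.ι _ j)
        (FreeAlgebra.ι _ j * FreeAlgebra.ι _ i)
  | braid (i j : Fin (n - 1)) (h : (i : ℕ) + 1 = j) :
      HeckeRel n b (FreeAlgebra.ι _ i * FreeAlgebra.ι _ j * FreeAlgebra.ι _ i)
        (FreeAlgebra.ι _ j * FreeAlgebra.ι _ i * FreeAlgebra.ι _ j)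

/-- The Hecke algebra of `S_n` over `ℤ[q, q⁻¹]`, with quadratic relation `T_i² = b T_i + q`. The two
usual normalizations are `b = q - 1` and `b = 1 - q`; the map `T_i ↦ -T_i` exchanges them. -/
def HeckeAlgebra (n : ℕ) (b : ℤ[T;T⁻¹]) : Type := RingQuot (HeckeRel n b)

noncomputable instance (n : ℕ) (b : ℤ[T;T⁻¹]) : Ring (HeckeAlgebra n b) :=
  inferInstanceAs (Ring (RingQuot (HeckeRel n b)))

noncomputable instance (n : ℕ) (b : ℤ[T;T⁻¹]) : Algebra ℤ[T;T⁻¹] (HeckeAlgebra n b) :=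
  inferInstanceAs (Algebra ℤ[T;T⁻¹] (RingQuot (HeckeRel n b)))

variable {n : ℕ} (b : ℤ[T;T⁻¹])

/-- The generator `T_i` as an element of the Hecke algebra. -/
noncomputable def heckeGen (i : Fin (n - 1)) : HeckeAlgebra n b :=
  RingQuot.mkAlgHom ℤ[T;T⁻¹] (HeckeRel n b) (FreeAlgebra.ι _ i)

theorem heckeGen_sq (i : Fin (n - 1)) :
    heckeGen b i * heckeGen b i = b • heckeGen b i + algebraMap _ _ qq := by
  have h := RingQuot.mkAlgHom_rel ℤ[T;T⁻¹] (HeckeRel.quad (b := b) i)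
  rw [map_mul, map_add, map_smul, AlgHom.commutes] at h
  exact h

theorem qq_inv_mul : (LaurentPolynomial.T (-1) : ℤ[T;T⁻¹]) * qq = 1 := by
  rw [qq, ← LaurentPolynomial.T_add]; simp

/-- The generator `T_i` as a unit, with `T_i⁻¹ = q⁻¹ (T_i - b)`. -/
noncomputable def heckeUnit (i : Fin (n - 1)) : (HeckeAlgebra n b)ˣ where
  val := heckeGen b i
  inv := (LaurentPolynomial.T (-1) : ℤ[T;T⁻¹]) • (heckeGen b i - algebraMap _ _ b)
  val_inv := by
    rw [mul_smul_comm, mul_sub, heckeGen_sq, ← Algebra.commutes, ← Algebra.smul_def,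
      add_sub_cancel_left, Algebra.smul_def, ← map_mul, qq_inv_mul, map_one]
  inv_val := by
    rw [smul_mul_assoc, sub_mul, heckeGen_sq, ← Algebra.smul_def,
      add_sub_cancel_left, Algebra.smul_def, ← map_mul, qq_inv_mul, map_one]

/-- `T_ws = T_{i_1} ⋯ T_{i_ℓ}` for a tilted word `ws`; bars contribute nothing. -/
noncomputable def heckeWord (ws : List (Factor n)) : (HeckeAlgebra n b)ˣ :=
  (ws.map fun f => match f with
    | Factor.s i => heckeUnit b i
    | Factor.bar => 1).prod

/-- Right multiplication by `T_i` on the free module with basis `S_n`. -/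
noncomputable def heckeOp (i : Fin (n - 1)) :
    (Equiv.Perm (Fin n) →₀ ℤ[T;T⁻¹]) →ₗ[ℤ[T;T⁻¹]] (Equiv.Perm (Fin n) →₀ ℤ[T;T⁻¹]) :=
  Finsupp.linearCombination ℤ[T;T⁻¹] fun w =>
    if w (lo i) < w (hi i) then Finsupp.single (w * simpleSwap i) 1
    else qq • Finsupp.single (w * simpleSwap i) 1 + b • Finsupp.single w 1

theorem heckeOp_single (i : Fin (n - 1)) (w : Equiv.Perm (Fin n)) :
    heckeOp b i (Finsupp.single w 1) =
      if w (lo i) < w (hi i) then Finsupp.single (w * simpleSwap i) 1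
      else qq • Finsupp.single (w * simpleSwap i) 1 + b • Finsupp.single w 1 := by
  simp [heckeOp]

theorem lo_ne_hi (i : Fin (n - 1)) : lo i ≠ hi i := by simp [lo, hi]

theorem simpleSwap_mul_self (g : Equiv.Perm (Fin n)) (i : Fin (n - 1)) :
    g * simpleSwap i * simpleSwap i = g := by
  simp [simpleSwap, mul_assoc]

theorem heckeOp_quad (i : Fin (n - 1)) :
    heckeOp b i * heckeOp b i = b • heckeOp b i + algebraMap _ _ qq := by
  refine Finsupp.lhom_ext' fun w => LinearMap.ext_ring ?_
  have hne : w (lo i) ≠ w (hi i) := fun h => lo_ne_hi i (w.injective h)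
  have e1 : (w * simpleSwap i) (lo i) = w (hi i) := by simp [simpleSwap]
  have e2 : (w * simpleSwap i) (hi i) = w (lo i) := by simp [simpleSwap]
  simp only [LinearMap.comp_apply, Module.End.mul_apply, Finsupp.lsingle_apply,
    LinearMap.add_apply, LinearMap.smul_apply, Module.algebraMap_end_apply]
  rcases lt_or_gt_of_ne hne with h | h
  · simp only [heckeOp_single, e1, e2, h, h.not_gt, if_true, if_false, map_add, map_smul,
      simpleSwap_mul_self]
    module
  · simp only [heckeOp_single, e1, e2, h, h.not_gt, if_true, if_false, map_add, map_smul,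
      simpleSwap_mul_self]
    module

theorem heckeOp_comm (i j : Fin (n - 1)) (h : (i : ℕ) + 1 < j) :
    heckeOp b i * heckeOp b j = heckeOp b j * heckeOp b i := by
  refine Finsupp.lhom_ext' fun w => LinearMap.ext_ring ?_
  have a1 : lo i ≠ lo j := by simp only [lo, ne_eq, Fin.mk.injEq]; omega
  have a2 : lo i ≠ hi j := by simp only [lo, hi, ne_eq, Fin.mk.injEq]; omega
  have a3 : hi i ≠ lo j := by simp only [lo, hi, ne_eq, Fin.mk.injEq]; omega
  have a4 : hi i ≠ hi j := by simp only [hi, ne_eq, Fin.mk.injEq]; omega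
  have e1 : (w * simpleSwap i) (lo j) = w (lo j) := by
    simp [simpleSwap, Equiv.swap_apply_of_ne_of_ne a1.symm a3.symm]
  have e2 : (w * simpleSwap i) (hi j) = w (hi j) := by
    simp [simpleSwap, Equiv.swap_apply_of_ne_of_ne a2.symm a4.symm]
  have e3 : (w * simpleSwap j) (lo i) = w (lo i) := by
    simp [simpleSwap, Equiv.swap_apply_of_ne_of_ne a1 a2]
  have e4 : (w * simpleSwap j) (hi i) = w (hi i) := by
    simp [simpleSwap, Equiv.swap_apply_of_ne_of_ne a3 a4]
  have hs : w * simpleSwap i * simpleSwap j = w * simpleSwap j * simpleSwap i := by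
    rw [mul_assoc, mul_assoc]
    congr 1
    have hd : Equiv.Perm.Disjoint (simpleSwap i) (simpleSwap j) := by
      intro x
      by_cases hx : x = lo i ∨ x = hi i
      · right
        rcases hx with rfl | rfl
        · exact Equiv.swap_apply_of_ne_of_ne a1 a2
        · exact Equiv.swap_apply_of_ne_of_ne a3 a4
      · left
        rw [not_or] at hx
        exact Equiv.swap_apply_of_ne_of_ne hx.1 hx.2
    exact hd.commute
  simp only [LinearMap.comp_apply, Module.End.mul_apply, Finsupp.lsingle_apply]
  by_cases h1 : w (lo i) < w (hi i) <;> by_cases h2 : w (lo j) < w (hi j) <;>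
    simp only [heckeOp_single, e1, e2, e3, e4, h1, h2, if_true, if_false, map_add, map_smul, hs]
  all_goals module

theorem heckeOp_braid (i j : Fin (n - 1)) (h : (i : ℕ) + 1 = j) :
    heckeOp b i * heckeOp b j * heckeOp b i = heckeOp b j * heckeOp b i * heckeOp b j := by
  refine Finsupp.lhom_ext' fun w => LinearMap.ext_ring ?_
  have hj : lo j = hi i := by simp only [lo, hi, Fin.mk.injEq]; omega
  have a1 : hi j ≠ lo i := by simp only [lo, hi, ne_eq, Fin.mk.injEq]; omega
  have a2 : hi j ≠ hi i := by simp only [hi, ne_eq, Fin.mk.injEq]; omega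
  have a3 := lo_ne_hi i
  have i1 (g : Equiv.Perm (Fin n)) : (g * simpleSwap i) (lo i) = g (hi i) := by simp [simpleSwap]
  have i2 (g : Equiv.Perm (Fin n)) : (g * simpleSwap i) (hi i) = g (lo i) := by simp [simpleSwap]
  have i3 (g : Equiv.Perm (Fin n)) : (g * simpleSwap i) (hi j) = g (hi j) := by
    simp [simpleSwap, Equiv.swap_apply_of_ne_of_ne a1 a2]
  have j1 (g : Equiv.Perm (Fin n)) : (g * simpleSwap j) (lo i) = g (lo i) := by
    simp [simpleSwap, hj, Equiv.swap_apply_of_ne_of_ne a3 a1.symm]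
  have j2 (g : Equiv.Perm (Fin n)) : (g * simpleSwap j) (hi i) = g (hi j) := by
    simp [simpleSwap, hj]
  have j3 (g : Equiv.Perm (Fin n)) : (g * simpleSwap j) (hi j) = g (hi i) := by
    simp [simpleSwap, hj]
  have hs : w * simpleSwap j * simpleSwap i * simpleSwap j =
      w * simpleSwap i * simpleSwap j * simpleSwap i := by
    refine Equiv.ext fun x => ?_
    by_cases x1 : x = lo i
    · subst x1; simp only [i1, i2, i3, j1, j2, j3]
    by_cases x2 : x = hi i
    · subst x2; simp only [i1, i2, i3, j1, j2, j3]
    by_cases x3 : x = hi j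
    · subst x3; simp only [i1, i2, i3, j1, j2, j3]
    simp [simpleSwap, hj, Equiv.swap_apply_of_ne_of_ne x1 x2, Equiv.swap_apply_of_ne_of_ne x2 x3]
  have n1 : w (lo i) ≠ w (hi i) := fun h => a3 (w.injective h)
  have n2 : w (lo i) ≠ w (hi j) := fun h => a1.symm (w.injective h)
  have n3 : w (hi i) ≠ w (hi j) := fun h => a2.symm (w.injective h)
  simp only [LinearMap.comp_apply, Module.End.mul_apply, Finsupp.lsingle_apply]
  rcases lt_or_gt_of_ne n1 with h1 | h1 <;> rcases lt_or_gt_of_ne n2 with h2 | h2 <;>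
    rcases lt_or_gt_of_ne n3 with h3 | h3 <;>
    first
    | (exfalso; order)
    | (simp only [heckeOp_single, hj, i1, i2, i3, j1, j2, j3, h1, h2, h3, h1.not_gt, h2.not_gt,
        h3.not_gt, if_true, if_false, map_add, map_smul, simpleSwap_mul_self, hs, smul_add]
       try module)

/-- The right regular representation, on the free module with basis `S_n`. -/
noncomputable def heckeRegular : HeckeAlgebra n b →ₐ[ℤ[T;T⁻¹]]
    (Module.End ℤ[T;T⁻¹] (Equiv.Perm (Fin n) →₀ ℤ[T;T⁻¹]))ᵐᵒᵖ :=
  RingQuot.liftAlgHom ℤ[T;T⁻¹]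
    ⟨FreeAlgebra.lift ℤ[T;T⁻¹] fun i => MulOpposite.op (heckeOp b i), by
      intro x y hxy
      induction hxy with
      | quad i =>
        simp only [map_mul, map_add, map_smul, FreeAlgebra.lift_ι_apply, AlgHom.commutes]
        rw [← MulOpposite.op_mul, heckeOp_quad]; rfl
      | comm i j h =>
        simp only [map_mul, FreeAlgebra.lift_ι_apply]
        rw [← MulOpposite.op_mul, ← MulOpposite.op_mul, heckeOp_comm b i j h]
      | braid i j h =>
        simp only [map_mul, FreeAlgebra.lift_ι_apply]
        simp only [← MulOpposite.op_mul, ← mul_assoc]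
        rw [heckeOp_braid b i j h]⟩

theorem heckeRegular_gen (i : Fin (n - 1)) :
    heckeRegular b (heckeGen b i) = MulOpposite.op (heckeOp b i) := by
  unfold heckeRegular heckeGen
  erw [RingQuot.liftAlgHom_mkAlgHom_apply]
  simp

/-- The trace `ε`: the coefficient of `T_id` in the expansion of `h = T_id · h` in the basis `T_w`,
read off from the right regular representation. -/
noncomputable def heckeTrace : HeckeAlgebra n b →ₗ[ℤ[T;T⁻¹]] ℤ[T;T⁻¹] where
  toFun h := (heckeRegular b h).unop (Finsupp.single 1 1) 1
  map_add' := by simp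
  map_smul' := by simp

theorem permLength_mul_of_lt (w : Equiv.Perm (Fin n)) (i : Fin (n - 1))
    (h : w (lo i) < w (hi i)) : permLength (w * simpleSwap i) = permLength w + 1 := by
  have key : (Finset.univ.filter fun p : Fin n × Fin n =>
        p.1 < p.2 ∧ (w * simpleSwap i) p.2 < (w * simpleSwap i) p.1) =
      insert (lo i, hi i) ((Finset.univ.filter fun p : Fin n × Fin n =>
        p.1 < p.2 ∧ w p.2 < w p.1).map
          (Equiv.prodCongr (simpleSwap i) (simpleSwap i)).toEmbedding) := by
    ext ⟨p, q⟩
    rw [Finset.mem_insert, Finset.mem_map_equiv]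
    have hv : ((hi i : Fin n) : ℕ) = (lo i : Fin n) + 1 := rfl
    simp only [Finset.mem_filter, Finset.mem_univ, true_and, Equiv.prodCongr_symm, simpleSwap,
      Equiv.symm_swap, Equiv.prodCongr_apply, Prod.map, Prod.mk.injEq, Equiv.Perm.mul_apply,
      Equiv.swap_apply_def, Fin.ext_iff, Fin.lt_def] at h hv ⊢
    generalize hl : lo i = x at *
    generalize hh : hi i = y at *
    split_ifs <;> try omega
  unfold permLength
  rw [key, Finset.card_insert_of_notMem, Finset.card_map]
  rw [Finset.mem_map_equiv]
  have hn : ¬ hi i < lo i := not_lt.2 (Nat.le_succ _)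
  simp [simpleSwap, hn]

theorem permLength_mul_of_gt (w : Equiv.Perm (Fin n)) (i : Fin (n - 1))
    (h : ¬ w (lo i) < w (hi i)) : permLength (w * simpleSwap i) + 1 = permLength w := by
  have hne : w (lo i) ≠ w (hi i) := fun h => lo_ne_hi i (w.injective h)
  have := permLength_mul_of_lt (w * simpleSwap i) i
    (by simpa [simpleSwap] using lt_of_le_of_ne (not_lt.1 h) hne.symm)
  rw [simpleSwap_mul_self] at this
  exact this.symm

theorem permLength_wordProd_le (l : List (Fin (n - 1))) : permLength (wordProd l) ≤ l.length := by
  induction l using List.reverseRecOn with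
  | nil =>
    simp only [wordProd, List.map_nil, List.prod_nil, List.length_nil, permLength,
      Equiv.Perm.coe_one, id, nonpos_iff_eq_zero, Finset.card_eq_zero,
      Finset.filter_eq_empty_iff, not_and, not_lt]
    exact fun p _ h => h.le
  | append_singleton l i ih =>
    have e : wordProd (l ++ [i]) = wordProd l * simpleSwap i := by simp [wordProd]
    rw [e, List.length_append, List.length_singleton]
    by_cases h : wordProd l (lo i) < wordProd l (hi i)
    · rw [permLength_mul_of_lt _ _ h]; omega
    · have := permLength_mul_of_gt _ _ h; omega

/-- For a reduced word of `w`, right multiplication by `T_w` sends `T_id` to `T_w`. -/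
theorem heckeRegular_reduced (l : List (Fin (n - 1))) (hl : l.length = permLength (wordProd l)) :
    (heckeRegular b (l.map (heckeGen b)).prod).unop (Finsupp.single 1 1) =
      Finsupp.single (wordProd l) 1 := by
  induction l using List.reverseRecOn with
  | nil => simp [wordProd]
  | append_singleton l i ih =>
    have e : wordProd (l ++ [i]) = wordProd l * simpleSwap i := by simp [wordProd]
    rw [e, List.length_append, List.length_singleton] at hl
    have hb := permLength_wordProd_le l
    by_cases h : wordProd l (lo i) < wordProd l (hi i)
    · rw [permLength_mul_of_lt _ _ h] at hl
      rw [List.map_append, List.prod_append, map_mul, MulOpposite.unop_mul, Module.End.mul_apply,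
        ih (by omega), List.map_singleton, List.prod_singleton, heckeRegular_gen,
        MulOpposite.unop_op, heckeOp_single, if_pos h, e]
    · have := permLength_mul_of_gt _ _ h; omega

/-- The defining property of the trace: `ε(T_w) = 1` if `w = id`, and `ε(T_w) = 0` otherwise. -/
theorem heckeTrace_reduced (l : List (Fin (n - 1))) (hl : l.length = permLength (wordProd l)) :
    heckeTrace b (l.map (heckeGen b)).prod = if wordProd l = 1 then 1 else 0 := by
  change (heckeRegular b (l.map (heckeGen b)).prod).unop (Finsupp.single 1 1) 1 = _
  rw [heckeRegular_reduced b l hl, Finsupp.single_apply]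

end Hecke

end TiltedRichardson

open TiltedRichardson

/-!
The proof compares two families of functions on pairs `u ∼_a v`: the numbers of `𝔽_q`-points of the
varieties `T°_{u,v,a}`, and the values at `q` of `q^{ℓ_a(v) - ℓ_a(u)} ε(T_v⁻¹ T_u)`, where `ℓ_a` is the
statistic `tiltedLength` and `T_w` is the product of the generators along an `a`-tilted reduced word
of `w`.

*Distances.* No edge of the quantum Bruhat graph raises `ℓ_a` by more than one, and if `u <_a v`, then some
edge leaving `u` raises it by one and stays below `v` (`TiltedCountLE.exists_edge`). Hence
`ℓ(u, v) = ℓ_a(v) - ℓ_a(u)` whenever `u ≤_a v` (`TiltedLE.quantumBruhatDist_eq`).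

*Recursion.* Let `i` be a position that is not a jump and let `s_i` lengthen both `u` and `v`. Flags that
agree off position `i` form a projective line, on which the rank conditions single out one point for
`u` and one for `v`; counting gives the recursion of the R-polynomials (`pointCount_recursion`). The
traces satisfy the same recursion, as `ε` is a trace and `T_i⁻¹ = q⁻¹ (T_i - (1 - q))`
(`tracePoly_recursion`). So it is enough to compare both for those `v` whose entries in the first block,
where `a` is constant, are sorted (`pointCount_eq_of_increasesBelow`).

*Induction on the jumps.* Without jumps, sorted means `v = id`, and both sides are `1` for `u = id` and `0`
otherwise. If `j` is the least jump, `r` is the value of `a` up to `j` and `s` the next one, then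
sorting the first block reduces `a`-tilted words to words for the flattened tilt
(`TiltedBasis.stepElt`), and a sorted `v` is flattenable. If `u` is flattenable too, both sides are
unchanged by flattening, because `u` and `v` have equally many initial entries in `[r, s)_c`
(`openTiltedRichardsonAt_eq`, `tiltedLength_sub_eq`). If `u` is not flattenable, both sides vanish:
`T°_{u,v,a}` has no points (`pointCount_eq_zero`), and the trace is conjugated by `T_d`, for the
permutation `d` that interchanges the two parts of the block, to traces that correspond to
empty varieties for the flattened tilt (`conj_blockShift_mem_span`,
`TiltedBasis.heckeTrace_eq_zero`). The data carried through the induction form a `TiltedBasis`, which also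
records that tilted words of least length have product `T_w`.

Finally, a Laurent polynomial with integer values at all primes is a polynomial, and it is determined by
these values (`exists_toLaurent_eq`, `eq_zero_of_evalCard`). The second normalization of the Hecke
algebra follows from the first through `T_i ↦ -T_i` (`heckeTrace_heckeWord`).
-/

namespace TiltedRichardson

/-! ### Cyclic orders and cyclic intervals -/

section CyclicOrder

variable {n : ℕ}

/-- The rank of `x` in the order `r <_r r + 1 <_r ⋯ <_r r - 1`, counted from `0`; thus
`x <_r y` means `cyc r x < cyc r y`. -/
def cyc (r x : Fin n) : ℕ := ((x - r : Fin n) : ℕ)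

theorem cyc_eq (r x : Fin n) :
    cyc r x = if (r : ℕ) ≤ x then (x : ℕ) - r else (x : ℕ) + n - r := by
  have hr := r.isLt
  have hx := x.isLt
  have h : cyc r x = ((n - r) + x) % n := rfl
  rw [h]
  split_ifs with h1
  · rw [show n - (r : ℕ) + x = (x - r) + n by omega, Nat.add_mod_right, Nat.mod_eq_of_lt (by omega)]
  · rw [Nat.mod_eq_of_lt (by omega)]; omega

theorem cyc_inj {r x y : Fin n} : cyc r x = cyc r y ↔ x = y := by
  have hr := r.isLt
  have hx := x.isLt
  have hy := y.isLt
  rw [cyc_eq, cyc_eq, Fin.ext_iff]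
  split_ifs <;> omega

theorem cyc_self (r : Fin n) : cyc r r = 0 := by simp [cyc_eq]

theorem mem_cyclicIco {r y z : Fin n} : z ∈ cyclicIco r y ↔ cyc r z < cyc r y := by
  have hr := r.isLt
  have hz := z.isLt
  have hy := y.isLt
  rw [cyc_eq, cyc_eq, cyclicIco]
  split_ifs <;> simp only [Finset.mem_Ico, Finset.mem_union, Finset.mem_Ici, Finset.mem_Iio,
    Fin.le_def, Fin.lt_def] at * <;> omega

/-- The interval `[y, r)_c` is empty for `y = r`, which needs the first condition. -/
theorem mem_cyclicIco' {r y z : Fin n} : z ∈ cyclicIco y r ↔ y ≠ r ∧ cyc r y ≤ cyc r z := by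
  have hr := r.isLt
  have hz := z.isLt
  have hy := y.isLt
  rw [cyc_eq, cyc_eq, cyclicIco, ne_eq, Fin.ext_iff]
  split_ifs <;> simp only [Finset.mem_Ico, Finset.mem_union, Finset.mem_Ici, Finset.mem_Iio,
    Fin.le_def, Fin.lt_def] at * <;> omega

theorem cyclicIco_self (a : Fin n) : cyclicIco a a = ∅ := by simp [cyclicIco]

theorem cyclicIco_compl {a b : Fin n} (h : a ≠ b) : (cyclicIco a b)ᶜ = cyclicIco b a := by
  ext z
  rw [Finset.mem_compl, mem_cyclicIco, mem_cyclicIco', not_lt]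
  simp [h.symm]

theorem notMem_cyclicIco {a b z : Fin n} (h : a ≠ b) :
    z ∉ cyclicIco a b ↔ z ∈ cyclicIco b a := by
  rw [← cyclicIco_compl h, Finset.mem_compl]

/-- On `[a, b)_c` the orders `<_a` and `<_b` agree. -/
theorem cyc_lt_cyc_iff_left {a b x y : Fin n} (hx : x ∈ cyclicIco a b) (hy : y ∈ cyclicIco a b) :
    cyc a x < cyc a y ↔ cyc b x < cyc b y := by
  have := a.isLt
  have := b.isLt
  have := x.isLt
  have := y.isLt
  rw [mem_cyclicIco] at hx hy
  simp only [cyc_eq] at *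
  split_ifs at * <;> omega

/-- In the order `<_a` the interval `[a, b)_c` precedes `[b, a)_c`. -/
theorem cyc_lt_cyc_of_mem {a b x y : Fin n} (hx : x ∈ cyclicIco a b) (hy : y ∈ cyclicIco b a) :
    cyc a x < cyc a y :=
  (mem_cyclicIco.1 hx).trans_le (mem_cyclicIco'.1 hy).2

/-- For `r` outside the cyclic interval `(c, d]`, the element `d` is the largest of `[c, d]` for
`<_r`. -/
theorem cyc_le_of_outside {r c d x : Fin n} (hr : r = c ∨ cyc c d < cyc c r)
    (hx : cyc c x ≤ cyc c d) : cyc r x ≤ cyc r d := by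
  have := r.isLt
  have := x.isLt
  have := c.isLt
  have := d.isLt
  simp only [cyc_eq, Fin.ext_iff] at *
  split_ifs at * <;> omega

/-- For `r` outside `(c, d]`, this cyclic interval consists of the elements between `c` and `d`
for `<_r`. -/
theorem mem_Ioc_of_outside {r c d x : Fin n} (hr : r = c ∨ cyc c d < cyc c r)
    (h1 : cyc r c < cyc r x) (h2 : cyc r x ≤ cyc r d) : x ≠ c ∧ cyc c x ≤ cyc c d := by
  have := r.isLt
  have := x.isLt
  have := c.isLt
  have := d.isLt
  simp only [cyc_eq, ne_eq, Fin.ext_iff] at *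
  split_ifs at * <;> omega

/-- For `r` in `(c, d]`, the elements up to `d` for `<_r` lie in `(c, d]`. -/
theorem mem_Ioc_of_inside {r c d x : Fin n} (hr : r ≠ c) (hr' : cyc c r ≤ cyc c d)
    (h : cyc r x ≤ cyc r d) : x ≠ c ∧ cyc c x ≤ cyc c d := by
  have := r.isLt
  have := x.isLt
  have := c.isLt
  have := d.isLt
  simp only [cyc_eq, ne_eq, Fin.ext_iff] at *
  split_ifs at * <;> omega

end CyclicOrder

/-! ### Initial segments of permutations -/

section FirstEntries

variable {n : ℕ}

theorem mem_firstEntries {w : Equiv.Perm (Fin n)} {m : ℕ} {x : Fin n} :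
    x ∈ firstEntries w m ↔ ((w.symm x : Fin n) : ℕ) < m := by
  simp only [firstEntries, Finset.mem_image, Finset.mem_filter, Finset.mem_univ, true_and]
  exact ⟨by rintro ⟨i, hi, rfl⟩; simpa using hi, fun h => ⟨_, h, by simp⟩⟩

theorem apply_mem_firstEntries {w : Equiv.Perm (Fin n)} {m : ℕ} {i : Fin n} :
    w i ∈ firstEntries w m ↔ (i : ℕ) < m := by
  rw [mem_firstEntries, Equiv.symm_apply_apply]

theorem card_firstEntries (w : Equiv.Perm (Fin n)) {m : ℕ} (hm : m ≤ n) :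
    (firstEntries w m).card = m := by
  rw [firstEntries, Finset.card_image_of_injective _ w.injective]
  have : (Finset.univ.filter fun i : Fin n => (i : ℕ) < m).card =
      ((Finset.range m)).card := by
    refine Finset.card_bij (fun i _ => (i : ℕ)) ?_ ?_ ?_
    · intro i hi; simpa using hi
    · intro i _ j _ h; exact Fin.ext h
    · intro k hk
      have hk' := Finset.mem_range.1 hk
      exact ⟨⟨k, by omega⟩, by simpa using hk', rfl⟩
  rw [this, Finset.card_range]

/-- Rearranging positions below `m` does not change the first `m` entries. -/
theorem firstEntries_mul_of_maps {w x : Equiv.Perm (Fin n)} {m : ℕ}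
    (hx : ∀ i : Fin n, ((x i : Fin n) : ℕ) < m ↔ (i : ℕ) < m) :
    firstEntries (w * x) m = firstEntries w m := by
  ext z
  rw [mem_firstEntries, mem_firstEntries, ← hx]
  simp [Equiv.Perm.mul_def]

theorem firstEntries_swap_of_not {w : Equiv.Perm (Fin n)} {i j : Fin n} {m : ℕ} (hij : i < j)
    (h : ¬ ((i : ℕ) < m ∧ m ≤ j)) :
    firstEntries (w * Equiv.swap i j) m = firstEntries w m := by
  refine firstEntries_mul_of_maps fun k => ?_
  have hij' : (i : ℕ) < j := hij
  rw [Equiv.swap_apply_def]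
  split_ifs with h1 h2
  · subst h1; omega
  · subst h2; omega
  · rfl

theorem card_firstEntries_swap {w : Equiv.Perm (Fin n)} {i j : Fin n} {m : ℕ}
    (hi : (i : ℕ) < m) (hj : m ≤ j) (S : Finset (Fin n)) :
    (firstEntries (w * Equiv.swap i j) m ∩ S).card + (if w i ∈ S then 1 else 0) =
      (firstEntries w m ∩ S).card + if w j ∈ S then 1 else 0 := by
  set E := (firstEntries w m).erase (w i) with hE
  have hij : i ≠ j := by rintro rfl; omega
  have h1 : firstEntries w m = insert (w i) E := by
    rw [hE, Finset.insert_erase]; exact apply_mem_firstEntries.2 hi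
  have hjE : w j ∉ E := by
    rw [hE, Finset.mem_erase, apply_mem_firstEntries]; omega
  have hiE : w i ∉ E := by simp [hE]
  have h2 : firstEntries (w * Equiv.swap i j) m = insert (w j) E := by
    ext z
    obtain ⟨k, rfl⟩ := w.surjective z
    rw [mem_firstEntries, Finset.mem_insert, hE, Finset.mem_erase, apply_mem_firstEntries]
    have : (w * Equiv.swap i j).symm (w k) = Equiv.swap i j k := by
      rw [Equiv.symm_apply_eq]; simp
    rw [this, Equiv.swap_apply_def, w.injective.eq_iff, ne_eq, w.injective.eq_iff]
    split_ifs with h3 h4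
    · subst h3; simp only [hij, not_true_eq_false, false_and, or_false, iff_false]; omega
    · subst h4; simp only [true_or, iff_true]; omega
    · simp [h3, h4]
  have key : ∀ (c : Fin n), c ∉ E → (insert c E ∩ S).card = (E ∩ S).card + if c ∈ S then 1 else 0 := by
    intro c hc
    by_cases h : c ∈ S
    · rw [Finset.insert_inter_of_mem h, Finset.card_insert_of_notMem (by simp [hc]), if_pos h]
    · rw [Finset.insert_inter_of_notMem h, if_neg h, add_zero]
  rw [h2, h1, key _ hjE, key _ hiE]
  omega

theorem lo_lt_hi (i : Fin (n - 1)) : lo i < hi i := Nat.lt_succ_self _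

theorem mul_simpleSwap_lo (w : Equiv.Perm (Fin n)) (i : Fin (n - 1)) :
    (w * simpleSwap i) (lo i) = w (hi i) := by simp [simpleSwap]

theorem mul_simpleSwap_hi (w : Equiv.Perm (Fin n)) (i : Fin (n - 1)) :
    (w * simpleSwap i) (hi i) = w (lo i) := by simp [simpleSwap]

theorem mul_simpleSwap_of_ne (w : Equiv.Perm (Fin n)) {i : Fin (n - 1)} {k : Fin n}
    (h1 : k ≠ lo i) (h2 : k ≠ hi i) : (w * simpleSwap i) k = w k := by
  simp [simpleSwap, Equiv.swap_apply_of_ne_of_ne h1 h2]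

theorem firstEntries_simpleSwap_of_ne {w : Equiv.Perm (Fin n)} {i : Fin (n - 1)} {k : Fin n}
    (h : k ≠ lo i) : firstEntries (w * simpleSwap i) (k + 1) = firstEntries w (k + 1) := by
  refine firstEntries_swap_of_not (lo_lt_hi i) fun hk => h ?_
  simp only [lo, hi] at hk
  exact Fin.ext (by simp only [lo]; omega)

end FirstEntries

/-! ### Tilted orders -/

section TiltedOrder

variable {n : ℕ}

theorem nextEntry_lo (a : Fin n → Fin n) (i : Fin (n - 1)) : nextEntry a (lo i) = a (hi i) := by
  have : ((lo i : Fin n) : ℕ) + 1 < n := (hi i).isLt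
  rw [nextEntry, dif_pos this]; rfl

theorem lo_notMem_jumps {a : Fin n → Fin n} {i : Fin (n - 1)} :
    lo i ∉ jumps a ↔ a (lo i) = a (hi i) := by
  simp [jumps, nextEntry_lo]

theorem TiltedEquiv.symm {a : Fin n → Fin n} {u v : Equiv.Perm (Fin n)} (h : TiltedEquiv a u v) :
    TiltedEquiv a v u := fun k => (h k).symm

theorem TiltedEquiv.trans {a : Fin n → Fin n} {u v w : Equiv.Perm (Fin n)}
    (h : TiltedEquiv a u v) (h' : TiltedEquiv a v w) : TiltedEquiv a u w :=
  fun k => (h k).trans (h' k)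

theorem tiltedEquiv_mul_simpleSwap {a : Fin n → Fin n} {i : Fin (n - 1)}
    (hi' : a (lo i) = a (hi i)) (u : Equiv.Perm (Fin n)) : TiltedEquiv a (u * simpleSwap i) u := by
  intro k
  by_cases h : k = lo i
  · subst h; rw [nextEntry_lo, ← hi', cyclicIco_self]; simp
  · rw [firstEntries_simpleSwap_of_ne h]

theorem countP_le_of_forall₂ {l₁ l₂ : List (Fin n)} (h : List.Forall₂ (· ≤ ·) l₁ l₂) (t : ℕ) :
    l₂.countP (fun x : Fin n => (x : ℕ) < t) ≤ l₁.countP (fun x : Fin n => (x : ℕ) < t) := by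
  induction h with
  | nil => simp
  | @cons x y _ _ hab _ ih =>
    have hab' : (x : ℕ) ≤ y := hab
    rw [List.countP_cons, List.countP_cons]
    simp only [decide_eq_true_eq]
    split_ifs <;> omega

/-- The first `t` elements in the order `<_r`. -/
def cycIio (r : Fin n) (t : ℕ) : Finset (Fin n) := Finset.univ.filter fun x => cyc r x < t

theorem mem_cycIio {r x : Fin n} {t : ℕ} : x ∈ cycIio r t ↔ cyc r x < t := by simp [cycIio]

theorem cyclicIco_eq_cycIio (r y : Fin n) : cyclicIco r y = cycIio r (cyc r y) := by
  ext; rw [mem_cyclicIco, mem_cycIio]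

theorem countP_sort_image (r : Fin n) (t : ℕ) (A : Finset (Fin n)) :
    ((A.image (· - r)).sort (· ≤ ·)).countP (fun x : Fin n => (x : ℕ) < t) = (A ∩ cycIio r t).card := by
  have h0 : ∀ x y : Fin n, x - r = y - r → x = y := fun x y h =>
    cyc_inj.1 (congrArg Fin.val h)
  have h1 : ((A.image (· - r)).sort (· ≤ ·)).countP (fun x : Fin n => (x : ℕ) < t) =
      ((A.image (· - r)).filter (fun x : Fin n => (x : ℕ) < t)).card := by
    rw [← Multiset.coe_countP, Finset.sort_eq, Finset.card, Finset.filter_val,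
      Multiset.countP_eq_card_filter]
  rw [h1, Finset.filter_image, Finset.card_image_of_injOn fun x _ y _ h => h0 x y h]
  congr 1
  ext z
  rw [Finset.mem_filter, Finset.mem_inter, mem_cycIio]
  rfl

/-- The shifted Gale order, read off from the sizes of intersections with initial segments. -/
theorem ShiftedGaleLE.card_le {r : Fin n} {A B : Finset (Fin n)} (h : ShiftedGaleLE r A B)
    (t : ℕ) : (B ∩ cycIio r t).card ≤ (A ∩ cycIio r t).card := by
  rw [← countP_sort_image, ← countP_sort_image]
  exact countP_le_of_forall₂ h _

end TiltedOrder

/-! ### Tilted length and distance in the quantum Bruhat graph -/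

section Distance

variable {n : ℕ}

theorem permLength_eq_sum (w : Equiv.Perm (Fin n)) :
    (permLength w : ℤ) = ∑ p : Fin n, ∑ q : Fin n,
      (if p < q then (1 : ℤ) else 0) * (if w q < w p then 1 else 0) := by
  rw [permLength, Finset.card_filter, ← Finset.univ_product_univ, Finset.sum_product]
  push_cast
  refine Finset.sum_congr rfl fun p _ => Finset.sum_congr rfl fun q _ => ?_
  by_cases h1 : p < q <;> by_cases h2 : w q < w p <;> simp [h1, h2]

/-- The change of length under multiplication by a transposition `(i j)`. -/
theorem permLength_mul_swap (w : Equiv.Perm (Fin n)) {i j : Fin n} (hij : i < j)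
    (hw : w i < w j) :
    permLength (w * Equiv.swap i j) = permLength w + 1 +
      2 * (Finset.univ.filter fun k => i < k ∧ k < j ∧ w i < w k ∧ w k < w j).card := by
  have h1 : (permLength (w * Equiv.swap i j) : ℤ) = ∑ p : Fin n, ∑ q : Fin n,
      (if Equiv.swap i j p < Equiv.swap i j q then (1 : ℤ) else 0) *
        (if w q < w p then 1 else 0) := by
    rw [permLength_eq_sum, ← Equiv.sum_comp (Equiv.swap i j)]
    refine Finset.sum_congr rfl fun p _ => ?_
    rw [← Equiv.sum_comp (Equiv.swap i j)]
    simp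
  have hne : i ≠ j := hij.ne
  have h2 : ∀ p q : Fin n,
      (if Equiv.swap i j p < Equiv.swap i j q then (1 : ℤ) else 0) =
      (if p < q then 1 else 0) + (if p = j then if q = i then 1 else 0 else 0)
        - (if p = i then if q = j then 1 else 0 else 0)
        + (if p = j then if i < q ∧ q < j then 1 else 0 else 0)
        - (if p = i then if i < q ∧ q < j then 1 else 0 else 0)
        + (if q = i then if i < p ∧ p < j then 1 else 0 else 0)
        - (if q = j then if i < p ∧ p < j then 1 else 0 else 0) := by
    intro p q
    simp only [Equiv.swap_apply_def, Fin.ext_iff, Fin.lt_def] at hij hne ⊢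
    split_ifs <;> omega
  have h3 : (permLength (w * Equiv.swap i j) : ℤ) = permLength w + 1 +
      ∑ k : Fin n, (if i < k ∧ k < j then (1 : ℤ) else 0) *
        ((if w k < w j then 1 else 0) - (if w k < w i then 1 else 0)
          + (if w i < w k then 1 else 0) - (if w j < w k then 1 else 0)) := by
    rw [h1, permLength_eq_sum]
    simp only [h2, add_mul, sub_mul, ite_mul, zero_mul, one_mul, Finset.sum_add_distrib,
      Finset.sum_sub_distrib, Finset.sum_ite_eq', Finset.mem_univ, if_true,
      mul_add, mul_sub]
    have e : ∀ (f : Fin n → Fin n → ℤ) (c : Fin n),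
        ∑ x : Fin n, ∑ y : Fin n, (if x = c then f x y else 0) = ∑ y, f c y := by
      intro f c
      rw [Finset.sum_comm]
      simp
    simp only [e, Finset.sum_ite_eq', Finset.mem_univ, if_true, hw, hw.not_gt, if_false]
    ring
  have h4 : ∀ k : Fin n, (if i < k ∧ k < j then (1 : ℤ) else 0) *
        ((if w k < w j then 1 else 0) - (if w k < w i then 1 else 0)
          + (if w i < w k then 1 else 0) - (if w j < w k then 1 else 0)) =
      2 * (if i < k ∧ k < j ∧ w i < w k ∧ w k < w j then 1 else 0) := by
    intro k
    by_cases hk : i < k ∧ k < j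
    · have a1 : w k ≠ w i := w.injective.ne hk.1.ne'
      have a2 : w k ≠ w j := w.injective.ne hk.2.ne
      simp only [hk.1, hk.2, true_and, and_self, if_true, one_mul]
      simp only [Fin.lt_def, ne_eq, Fin.ext_iff] at *
      split_ifs <;> omega
    · rw [if_neg hk, if_neg fun h : i < k ∧ k < j ∧ _ => hk ⟨h.1, h.2.1⟩]; simp
  simp only [h4] at h3
  rw [← Finset.mul_sum, ← Finset.sum_filter, Finset.sum_const, nsmul_one] at h3
  exact_mod_cast h3

theorem permLength_mul_swap_lt (w : Equiv.Perm (Fin n)) {i j : Fin n} (hij : i < j)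
    (hw : w j < w i) : permLength (w * Equiv.swap i j) < permLength w := by
  have h := permLength_mul_swap (w * Equiv.swap i j) hij (by simpa using hw)
  rw [mul_assoc, Equiv.swap_mul_self, mul_one] at h
  omega

/-- The tilted length `ℓ_a(w)`. Only its differences matter: for `u ≤_a v` they are distances in the
quantum Bruhat graph, and for `u ∼_a v` they are differences of the numbers of letters in tilted
reduced words. The correction to `ℓ(w)` makes `ℓ_a(w s_i)` exceed `ℓ_a(w)` by one precisely if
`w_i <_r w_{i+1}` for `r = a_i`. -/
def tiltedLength (a : Fin n → Fin n) (w : Equiv.Perm (Fin n)) : ℤ :=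
  permLength w + 2 * ∑ k : Fin n, ((firstEntries w (k + 1) ∩ Finset.Iio (a k)).card : ℤ)

theorem tiltedLength_mul_swap (a : Fin n → Fin n) (w : Equiv.Perm (Fin n)) {i j : Fin n}
    (hij : i < j) :
    tiltedLength a (w * Equiv.swap i j) = tiltedLength a w +
      ((permLength (w * Equiv.swap i j) : ℤ) - permLength w) +
      2 * ∑ k ∈ Finset.Ico i j,
        ((if w j < a k then (1 : ℤ) else 0) - (if w i < a k then 1 else 0)) := by
  have h : ∑ k : Fin n,
      ((firstEntries (w * Equiv.swap i j) (k + 1) ∩ Finset.Iio (a k)).card : ℤ) =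
      ∑ k : Fin n, ((firstEntries w (k + 1) ∩ Finset.Iio (a k)).card : ℤ) +
      ∑ k ∈ Finset.Ico i j,
        ((if w j < a k then (1 : ℤ) else 0) - (if w i < a k then 1 else 0)) := by
    rw [← Finset.sum_filter_add_sum_filter_not Finset.univ (· ∈ Finset.Ico i j),
      ← Finset.sum_filter_add_sum_filter_not Finset.univ (· ∈ Finset.Ico i j)
        (fun k => ((firstEntries w (k + 1) ∩ Finset.Iio (a k)).card : ℤ)),
      Finset.filter_mem_eq_inter, Finset.univ_inter, add_right_comm, ← Finset.sum_add_distrib]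
    congr 1
    · refine Finset.sum_congr rfl fun k hk => ?_
      obtain ⟨h1, h2⟩ := Finset.mem_Ico.1 hk
      have := card_firstEntries_swap (w := w) (i := i) (j := j) (m := k + 1)
        (Nat.lt_succ_of_le h1) h2 (Finset.Iio (a k))
      simp only [Finset.mem_Iio] at this
      zify at this
      linarith
    · refine Finset.sum_congr rfl fun k hk => ?_
      rw [firstEntries_swap_of_not hij]
      rw [Finset.mem_filter, Finset.mem_Ico, Fin.le_def, Fin.lt_def] at hk
      omega
  rw [tiltedLength, tiltedLength, h]
  ring

theorem tiltedLength_le_of_edge (a : Fin n → Fin n) {w w' : Equiv.Perm (Fin n)}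
    (h : QuantumBruhatEdge w w') : tiltedLength a w' ≤ tiltedLength a w + 1 := by
  obtain ⟨i, j, hij, rfl, h | h⟩ := h
  · have hw : w i < w j := by
      refine lt_of_le_of_ne (not_lt.1 fun hlt => ?_) (w.injective.ne hij.ne)
      have := permLength_mul_swap_lt w hij hlt
      omega
    rw [tiltedLength_mul_swap a w hij, h]
    have : ∑ k ∈ Finset.Ico i j,
        ((if w j < a k then (1 : ℤ) else 0) - (if w i < a k then 1 else 0)) ≤ 0 := by
      refine Finset.sum_nonpos fun k _ => ?_
      have := fun h : w j < a k => hw.trans h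
      split_ifs <;> simp_all
    linarith
  · rw [tiltedLength_mul_swap a w hij, h]
    have : ∑ k ∈ Finset.Ico i j,
        ((if w j < a k then (1 : ℤ) else 0) - (if w i < a k then 1 else 0)) ≤
        ∑ k ∈ Finset.Ico i j, 1 := by
      refine Finset.sum_le_sum fun k _ => ?_
      split_ifs <;> simp
    rw [Finset.sum_const, Fin.card_Ico, nsmul_one] at this
    have hij' : (i : ℕ) ≤ j := hij.le
    push_cast [hij'] at this
    linarith

theorem tiltedLength_le_of_path (a : Fin n → Fin n) {m : ℕ} {u v : Equiv.Perm (Fin n)}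
    (h : QuantumBruhatPath m u v) : tiltedLength a v ≤ tiltedLength a u + m := by
  obtain ⟨p, rfl, rfl, h⟩ := h
  induction m with
  | zero => simp
  | succ m ih =>
    have h1 := ih fun i hi => h i (hi.trans (Nat.lt_succ_self m))
    have h2 := tiltedLength_le_of_edge a (h m (Nat.lt_succ_self m))
    push_cast
    linarith

/-- A transposition that exchanges cyclically consecutive values, in the sense that no intermediate
position carries a value cyclically between them and no `a_k` in the range separates them, is an edge
of the quantum Bruhat graph that raises the tilted length by one. -/
theorem edge_of_consecutive {a : Fin n → Fin n} {w : Equiv.Perm (Fin n)} {i j : Fin n} (hij : i < j)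
    (hb : ∀ k, i < k → k < j → cyc (w i) (w j) < cyc (w i) (w k))
    (ha : ∀ k, i ≤ k → k < j → a k = w i ∨ cyc (w i) (w j) < cyc (w i) (a k)) :
    QuantumBruhatEdge w (w * Equiv.swap i j) ∧
      tiltedLength a (w * Equiv.swap i j) = tiltedLength a w + 1 := by
  have hne : w i ≠ w j := w.injective.ne hij.ne
  have hij' : (i : ℕ) < j := hij
  rcases lt_or_gt_of_ne hne with hw | hw
  · have h0 : (Finset.univ.filter fun k => i < k ∧ k < j ∧ w i < w k ∧ w k < w j) = ∅ := by
      refine Finset.filter_eq_empty_iff.2 fun k _ h => ?_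
      have := hb k h.1 h.2.1
      simp only [cyc_eq, Fin.lt_def] at this h hw
      split_ifs at this <;> omega
    have h1 := permLength_mul_swap w hij hw
    rw [h0, Finset.card_empty, mul_zero, add_zero] at h1
    refine ⟨⟨i, j, hij, rfl, Or.inl (by rw [h1]; push_cast; ring)⟩, ?_⟩
    rw [tiltedLength_mul_swap a w hij, h1, Finset.sum_eq_zero]
    · push_cast; ring
    · intro k hk
      obtain ⟨h1, h2⟩ := Finset.mem_Ico.1 hk
      have := ha k h1 h2
      have h3 := (a k).isLt
      have h4 := (w j).isLt
      rw [Fin.ext_iff] at this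
      simp only [cyc_eq, Fin.lt_def] at this hw ⊢
      split_ifs at this ⊢ <;> omega
  · have h0 : (Finset.univ.filter fun k => i < k ∧ k < j ∧
        (w * Equiv.swap i j) i < (w * Equiv.swap i j) k ∧
        (w * Equiv.swap i j) k < (w * Equiv.swap i j) j) = Finset.Ioo i j := by
      ext k
      simp only [Finset.mem_filter, Finset.mem_univ, true_and, Finset.mem_Ioo]
      refine ⟨fun h => ⟨h.1, h.2.1⟩, fun h => ⟨h.1, h.2, ?_⟩⟩
      rw [Equiv.Perm.mul_apply, Equiv.Perm.mul_apply, Equiv.Perm.mul_apply, Equiv.swap_apply_left,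
        Equiv.swap_apply_right, Equiv.swap_apply_of_ne_of_ne h.1.ne' h.2.ne]
      have := hb k h.1 h.2
      have h3 := (w k).isLt
      have h4 := (w i).isLt
      simp only [cyc_eq, Fin.lt_def] at this hw ⊢
      split_ifs at this <;> omega
    have h1 := permLength_mul_swap (w * Equiv.swap i j) hij (by simpa using hw)
    rw [h0, Fin.card_Ioo, mul_assoc, Equiv.swap_mul_self, mul_one] at h1
    have h2 : (permLength (w * Equiv.swap i j) : ℤ) =
        permLength w + 1 - 2 * ((j : ℤ) - (i : ℤ)) := by omega
    refine ⟨⟨i, j, hij, rfl, Or.inr h2⟩, ?_⟩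
    have h3 : ∑ k ∈ Finset.Ico i j,
        ((if w j < a k then (1 : ℤ) else 0) - (if w i < a k then 1 else 0)) =
        ∑ k ∈ Finset.Ico i j, 1 := by
      refine Finset.sum_congr rfl fun k hk => ?_
      obtain ⟨h1, h2⟩ := Finset.mem_Ico.1 hk
      have := ha k h1 h2
      have h3 := (a k).isLt
      have h4 := (w i).isLt
      rw [Fin.ext_iff] at this
      simp only [cyc_eq, Fin.lt_def] at this hw ⊢
      split_ifs at this ⊢ <;> omega
    rw [tiltedLength_mul_swap a w hij, h2, h3, Finset.sum_const, Fin.card_Ico, nsmul_one]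
    push_cast [hij'.le]
    ring

/-- The counting form of the tilted Bruhat order. -/
def TiltedCountLE (a : Fin n → Fin n) (u v : Equiv.Perm (Fin n)) : Prop :=
  ∀ (k : Fin n) (t : ℕ), (firstEntries v (k + 1) ∩ cycIio (a k) t).card ≤
    (firstEntries u (k + 1) ∩ cycIio (a k) t).card

theorem TiltedLE.countLE {a : Fin n → Fin n} {u v : Equiv.Perm (Fin n)} (h : TiltedLE a u v) :
    TiltedCountLE a u v := fun k t => (h k).card_le t

/-- If `u <_a v`, some edge leaving `u` raises the tilted length by one and stays below `v`. -/
theorem TiltedCountLE.exists_edge {a : Fin n → Fin n} {u v : Equiv.Perm (Fin n)}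
    (h : TiltedCountLE a u v) (hne : u ≠ v) :
    ∃ u', QuantumBruhatEdge u u' ∧ tiltedLength a u' = tiltedLength a u + 1 ∧
      TiltedCountLE a u' v := by
  -- `k` is the first position where `u` and `v` differ
  obtain ⟨k, hk, hkmin⟩ : ∃ k, u k ≠ v k ∧ ∀ q, q < k → u q = v q := by
    have hex : ∃ k, u k ≠ v k := by
      by_contra! hc
      exact hne (Equiv.ext hc)
    obtain ⟨k, hk, hmin⟩ := WellFounded.has_min (wellFounded_lt (α := Fin n)) {k | u k ≠ v k} hex
    exact ⟨k, hk, fun q hq => by_contra fun hc => hmin q hc hq⟩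
  -- `j` is the first later position whose value lies in the cyclic interval `(u k, v k]`
  obtain ⟨j, hkj, hj, hjmin⟩ : ∃ j, k < j ∧ cyc (u k) (u j) ≤ cyc (u k) (v k) ∧
      ∀ q, k < q → q < j → cyc (u k) (v k) < cyc (u k) (u q) := by
    have hex : ∃ j, k < j ∧ cyc (u k) (u j) ≤ cyc (u k) (v k) := by
      refine ⟨u.symm (v k), ?_, by simp⟩
      by_contra! hc
      rcases hc.lt_or_eq with hc | hc
      · have := hkmin _ hc
        rw [Equiv.apply_symm_apply] at this
        exact hc.ne' (v.injective this)
      · rw [Equiv.symm_apply_eq] at hc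
        exact hk hc.symm
    obtain ⟨j, hj, hmin⟩ := WellFounded.has_min (wellFounded_lt (α := Fin n))
      {j | k < j ∧ cyc (u k) (u j) ≤ cyc (u k) (v k)} hex
    exact ⟨j, hj.1, hj.2, fun q h1 h2 => by_contra fun hc => hmin q ⟨h1, not_lt.1 hc⟩ h2⟩
  have hjk : u j ≠ u k := u.injective.ne hkj.ne'
  -- between positions `k` and `j` the entries of `v` have an advantage on `(u k, v k]`
  have hcount : ∀ m : Fin n, k ≤ m → m < j → ∀ S : Finset (Fin n), v k ∈ S →
      (∀ x ∈ S, x ≠ u k ∧ cyc (u k) x ≤ cyc (u k) (v k)) →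
      (firstEntries u (m + 1) ∩ S).card + 1 ≤ (firstEntries v (m + 1) ∩ S).card := by
    intro m hkm hmj S hvS hS
    refine Finset.card_lt_card ⟨fun x hx => ?_, fun hsub => ?_⟩
    all_goals
      have hP : ∀ x ∈ firstEntries u (m + 1) ∩ S, ∃ q, q < k ∧ x = v q := by
        intro x hx
        rw [Finset.mem_inter] at hx
        obtain ⟨q, rfl⟩ := u.surjective x
        rw [apply_mem_firstEntries] at hx
        have hx2 := hS _ hx.2
        have hqk : q ≠ k := fun hc => hx2.1 (by rw [hc])
        rcases lt_or_gt_of_ne hqk with hq | hq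
        · exact ⟨q, hq, hkmin q hq⟩
        · exact absurd (hjmin q hq (lt_of_le_of_lt (Nat.lt_succ_iff.1 hx.1) hmj)) (not_lt.2 hx2.2)
    · obtain ⟨q, hq, rfl⟩ := hP x hx
      refine Finset.mem_inter.2 ⟨apply_mem_firstEntries.2 ?_, (Finset.mem_inter.1 hx).2⟩
      exact Nat.lt_succ_of_le (hq.le.trans hkm)
    · obtain ⟨q, hq, hq'⟩ := hP (v k) (hsub (Finset.mem_inter.2
        ⟨apply_mem_firstEntries.2 (Nat.lt_succ_of_le hkm), hvS⟩))
      exact hq.ne' (v.injective hq')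
  have hA : ∀ m : Fin n, k ≤ m → m < j → a m = u k ∨ cyc (u k) (v k) < cyc (u k) (a m) := by
    intro m hkm hmj
    by_contra! hc
    have h1 := hcount m hkm hmj (cycIio (a m) (cyc (a m) (v k) + 1)) (by simp [mem_cycIio]) ?_
    · have := h m (cyc (a m) (v k) + 1)
      omega
    · intro x hx
      rw [mem_cycIio] at hx
      exact mem_Ioc_of_inside hc.1 hc.2 (Nat.lt_succ_iff.1 hx)
  obtain ⟨hedge, hlen⟩ := edge_of_consecutive (a := a) hkj
    (fun q h1 h2 => hj.trans_lt (hjmin q h1 h2))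
    (fun m h1 h2 => (hA m h1 h2).imp id fun h' => hj.trans_lt h')
  refine ⟨_, hedge, hlen, fun m t => ?_⟩
  by_cases hm : (k : ℕ) < m + 1 ∧ (m : ℕ) + 1 ≤ j
  swap
  · rw [firstEntries_swap_of_not hkj hm]; exact h m t
  have hkm : k ≤ m := Nat.lt_succ_iff.1 hm.1
  have hmj : m < j := hm.2
  have hsw := card_firstEntries_swap (w := u) hm.1 hm.2 (cycIio (a m) t)
  have h0 := h m t
  by_cases hc : u k ∈ cycIio (a m) t ∧ u j ∉ cycIio (a m) t
  swap
  · by_cases h1 : u k ∈ cycIio (a m) t <;> by_cases h2 : u j ∈ cycIio (a m) t <;>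
      simp [h1, h2] at hsw hc <;> omega
  rw [if_pos hc.1, if_neg hc.2] at hsw
  simp only [mem_cycIio, not_lt] at hc
  have hA' := hA m hkm hmj
  have hjv : cyc (a m) (u j) ≤ cyc (a m) (v k) := cyc_le_of_outside hA' hj
  have hsub : cycIio (a m) t ⊆ cycIio (a m) (cyc (a m) (v k) + 1) := by
    intro x hx
    rw [mem_cycIio] at hx ⊢
    omega
  have hsplit : ∀ E : Finset (Fin n), (E ∩ cycIio (a m) (cyc (a m) (v k) + 1)).card =
      (E ∩ cycIio (a m) t).card +
        (E ∩ (cycIio (a m) (cyc (a m) (v k) + 1) \ cycIio (a m) t)).card := by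
    intro E
    rw [← Finset.card_union_of_disjoint, ← Finset.inter_union_distrib_left,
      Finset.union_sdiff_of_subset hsub]
    exact (Finset.disjoint_sdiff.mono_left Finset.inter_subset_right).mono_right
      Finset.inter_subset_right
  have h1 := hcount m hkm hmj (cycIio (a m) (cyc (a m) (v k) + 1) \ cycIio (a m) t) ?_ ?_
  · have h2 := h m (cyc (a m) (v k) + 1)
    rw [hsplit, hsplit] at h2
    omega
  · rw [Finset.mem_sdiff, mem_cycIio, mem_cycIio]
    omega
  · intro x hx
    rw [Finset.mem_sdiff, mem_cycIio, mem_cycIio] at hx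
    exact mem_Ioc_of_outside hA' (by omega) (by omega)

/-- Going up in `≤_a` along edges that raise the tilted length by one reaches `v`, since the tilted length
is bounded. -/
theorem TiltedCountLE.exists_path {a : Fin n → Fin n} {v : Equiv.Perm (Fin n)}
    (u : Equiv.Perm (Fin n)) (h : TiltedCountLE a u v) :
    ∃ m : ℕ, QuantumBruhatPath m u v ∧ tiltedLength a v = tiltedLength a u + m := by
  obtain ⟨C, hC⟩ := (Set.finite_range (tiltedLength a)).bddAbove
  induction hN : (C - tiltedLength a u).toNat using Nat.strong_induction_on generalizing u with
  | _ N ih =>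
    by_cases huv : u = v
    · subst huv
      exact ⟨0, ⟨fun _ => u, rfl, rfl, by simp⟩, by simp⟩
    obtain ⟨u', he, hl, hle⟩ := h.exists_edge huv
    have hu' : tiltedLength a u' ≤ C := hC ⟨u', rfl⟩
    obtain ⟨m, ⟨p, hp0, hpm, hp⟩, hm⟩ := ih _ (by omega) u' hle rfl
    refine ⟨m + 1, ⟨fun i => Nat.casesOn i u p, rfl, hpm, fun i hi => ?_⟩, by push_cast; omega⟩
    cases i with
    | zero => simpa [hp0] using he
    | succ i => exact hp i (by omega)

/-- The distance in the quantum Bruhat graph between `u ≤_a v` is the difference of the tilted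
lengths. -/
theorem TiltedLE.quantumBruhatDist_eq {a : Fin n → Fin n} {u v : Equiv.Perm (Fin n)}
    (h : TiltedLE a u v) : (quantumBruhatDist u v : ℤ) = tiltedLength a v - tiltedLength a u := by
  obtain ⟨m, hp, hm⟩ := h.countLE.exists_path
  have hleast : IsLeast {m | QuantumBruhatPath m u v} m :=
    ⟨hp, fun m' hm' => by have := tiltedLength_le_of_path a hm'; omega⟩
  rw [quantumBruhatDist, hleast.csInf_eq]
  omega

end Distance

/-! ### Row ranks of subspaces -/

section RowRank

variable {n : ℕ} {F : Type*} [Field F]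

/-- The subspace of vectors whose coordinates in `S` vanish. -/
def vanishing (F : Type*) [Field F] (S : Finset (Fin n)) : Submodule F (Fin n → F) :=
  LinearMap.ker (LinearMap.funLeft F F (Subtype.val : S → Fin n))

theorem mem_vanishing {S : Finset (Fin n)} {x : Fin n → F} :
    x ∈ vanishing F S ↔ ∀ i ∈ S, x i = 0 := by
  rw [vanishing, LinearMap.mem_ker, funext_iff]
  exact ⟨fun h i hi => h ⟨i, hi⟩, fun h i => h i i.2⟩

theorem vanishing_anti {S T : Finset (Fin n)} (h : S ⊆ T) : vanishing F T ≤ vanishing F S :=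
  fun _ hx => mem_vanishing.2 fun i hi => mem_vanishing.1 hx i (h hi)

theorem rowRank_add_finrank (S : Finset (Fin n)) (V : Submodule F (Fin n → F)) :
    rowRank S V + Module.finrank F ↥(V ⊓ vanishing F S) = Module.finrank F V := by
  have h := LinearMap.finrank_range_add_finrank_ker
    ((LinearMap.funLeft F F (Subtype.val : S → Fin n)).domRestrict V)
  rw [LinearMap.range_domRestrict, LinearMap.ker_domRestrict] at h
  rw [← h, rowRank]
  congr 1
  have e : V ⊓ vanishing F S = ((LinearMap.ker (LinearMap.funLeft F F
      (Subtype.val : S → Fin n))).comap V.subtype).map V.subtype := by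
    rw [Submodule.map_comap_eq, Submodule.range_subtype]; rfl
  rw [e]
  exact LinearEquiv.finrank_eq (Submodule.equivMapOfInjective V.subtype V.injective_subtype _).symm

theorem rowRank_submodular (S T : Finset (Fin n)) (V : Submodule F (Fin n → F)) :
    rowRank (S ∪ T) V + rowRank (S ∩ T) V ≤ rowRank S V + rowRank T V := by
  have h1 := rowRank_add_finrank S V
  have h2 := rowRank_add_finrank T V
  have h3 := rowRank_add_finrank (S ∪ T) V
  have h4 := rowRank_add_finrank (S ∩ T) V
  have h5 := Submodule.finrank_sup_add_finrank_inf_eq (V ⊓ vanishing F S) (V ⊓ vanishing F T)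
  have h6 : (V ⊓ vanishing F S) ⊓ (V ⊓ vanishing F T) = V ⊓ vanishing F (S ∪ T) := by
    ext x
    simp only [Submodule.mem_inf, mem_vanishing, Finset.mem_union]
    constructor
    · rintro ⟨⟨h, h1⟩, _, h2⟩; exact ⟨h, fun i hi => hi.elim (h1 i) (h2 i)⟩
    · rintro ⟨h, h1⟩; exact ⟨⟨h, fun i hi => h1 i (.inl hi)⟩, h, fun i hi => h1 i (.inr hi)⟩
  have h7 := Submodule.finrank_mono (R := F) (sup_le
    (inf_le_inf_left V (vanishing_anti (F := F) (Finset.inter_subset_left (s₁ := S) (s₂ := T))))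
    (inf_le_inf_left V (vanishing_anti (F := F) (Finset.inter_subset_right (s₁ := S) (s₂ := T)))))
  rw [h6] at h5
  omega

theorem rowRank_empty (V : Submodule F (Fin n → F)) : rowRank ∅ V = 0 := by
  have h := rowRank_add_finrank ∅ V
  have : vanishing F (∅ : Finset (Fin n)) = ⊤ := by ext; simp [mem_vanishing]
  rw [this, inf_top_eq] at h
  omega

theorem rowRank_univ (V : Submodule F (Fin n → F)) :
    rowRank Finset.univ V = Module.finrank F V := by
  have h := rowRank_add_finrank Finset.univ V
  have : vanishing F (Finset.univ : Finset (Fin n)) = ⊥ := by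
    ext; simp [mem_vanishing, funext_iff]
  rw [this, inf_bot_eq, finrank_bot] at h
  omega

theorem rowRank_mono {V W : Submodule F (Fin n → F)} (h : V ≤ W) (S : Finset (Fin n)) :
    rowRank S V ≤ rowRank S W := Submodule.finrank_mono (Submodule.map_mono h)

theorem rowRank_le_finrank (S : Finset (Fin n)) (V : Submodule F (Fin n → F)) :
    rowRank S V ≤ Module.finrank F V := by have := rowRank_add_finrank S V; omega

theorem rowRank_add_finrank_le {V W : Submodule F (Fin n → F)} (h : V ≤ W) (S : Finset (Fin n)) :
    rowRank S W + Module.finrank F V ≤ rowRank S V + Module.finrank F W := by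
  have h1 := rowRank_add_finrank S V
  have h2 := rowRank_add_finrank S W
  have := Submodule.finrank_mono (R := F) (inf_le_inf_right (vanishing F S) h)
  omega

/-- If the rank of `V` is the sum of its ranks on `S` and on the complement, then `V` splits, and row
ranks are additive over subsets of the two parts. -/
theorem rowRank_union_of_split {S A B : Finset (Fin n)} {V : Submodule F (Fin n → F)}
    (h : rowRank S V + rowRank Sᶜ V = Module.finrank F V) (hA : A ⊆ S) (hB : B ⊆ Sᶜ) :
    rowRank (A ∪ B) V = rowRank A V + rowRank B V := by
  have hd : ∀ x, x ∈ B → x ∉ S := fun x hx => Finset.mem_compl.1 (hB hx)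
  have h1 := rowRank_submodular (S ∪ B) Sᶜ V
  have e1 : S ∪ B ∪ Sᶜ = Finset.univ := by ext x; by_cases hx : x ∈ S <;> simp [hx]
  have e2 : (S ∪ B) ∩ Sᶜ = B := by
    ext x
    have := hd x
    simp only [Finset.mem_inter, Finset.mem_union, Finset.mem_compl]; tauto
  have h2 := rowRank_submodular (A ∪ B) S V
  have e3 : A ∪ B ∪ S = S ∪ B := by
    ext x
    have := @hA x
    simp only [Finset.mem_union]; tauto
  have e4 : (A ∪ B) ∩ S = A := by
    ext x
    have := @hA x
    have := hd x
    simp only [Finset.mem_inter, Finset.mem_union]; tauto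
  have h3 := rowRank_submodular A B V
  rw [e1, e2, rowRank_univ] at h1
  rw [e3, e4] at h2
  omega

/-- `I` is the set of pivots of `V` for the order `<_r`. -/
def HasMin (r : Fin n) (I : Finset (Fin n)) (V : Submodule F (Fin n → F)) : Prop :=
  ∀ i, rowRank (cyclicIco r i) V = (I ∩ cyclicIco r i).card

/-- `J` is the set of pivots of `V` for the reverse of the order `<_r`. -/
def HasMax (r : Fin n) (J : Finset (Fin n)) (V : Submodule F (Fin n → F)) : Prop :=
  ∀ i, rowRank (cyclicIco i r) V = (J ∩ cyclicIco i r).card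

theorem cyclicIco_union {x m y : Fin n} (h : cyc x m ≤ cyc x y) :
    cyclicIco x y = cyclicIco x m ∪ cyclicIco m y ∧ Disjoint (cyclicIco x m) (cyclicIco m y) := by
  have h1 := x.isLt
  have h2 := m.isLt
  have h3 := y.isLt
  rw [Finset.disjoint_left]
  constructor
  · ext z
    have h4 := z.isLt
    simp only [Finset.mem_union, mem_cyclicIco, cyc_eq] at *
    split_ifs at * <;> omega
  · intro z
    have h4 := z.isLt
    simp only [mem_cyclicIco, cyc_eq] at *
    split_ifs at * <;> omega

theorem card_inter_cyclicIco_add {x m y : Fin n} (h : cyc x m ≤ cyc x y) (I : Finset (Fin n)) :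
    (I ∩ cyclicIco x y).card = (I ∩ cyclicIco x m).card + (I ∩ cyclicIco m y).card := by
  obtain ⟨h1, h2⟩ := cyclicIco_union h
  rw [h1, Finset.inter_union_distrib_left, Finset.card_union_of_disjoint]
  exact (h2.mono_left Finset.inter_subset_right).mono_right Finset.inter_subset_right

theorem card_inter_cyclicIco_compl {r s : Fin n} (h : r ≠ s) (I : Finset (Fin n)) :
    (I ∩ cyclicIco r s).card + (I ∩ cyclicIco s r).card = I.card := by
  rw [← cyclicIco_compl h, Finset.inter_comm, Finset.inter_comm I, ← Finset.card_union_of_disjoint,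
    ← Finset.union_inter_distrib_right, Finset.union_compl, Finset.univ_inter]
  exact (disjoint_compl_right.mono_left Finset.inter_subset_left).mono_right
    Finset.inter_subset_left

/-- If two sets `I` and `J` meet `[r, s)_c` in equally many elements, then a subspace with minimum
`I` and maximum `J` for `<_r` splits along `[r, s)_c`, and has the same minimum and maximum
for `<_s`. -/
theorem hasMin_hasMax_change {r s : Fin n} {I J : Finset (Fin n)} {V : Submodule F (Fin n → F)}
    (hI : I.card = Module.finrank F V) (hJ : J.card = Module.finrank F V)
    (h : (I ∩ cyclicIco r s).card = (J ∩ cyclicIco r s).card)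
    (hmin : HasMin r I V) (hmax : HasMax r J V) : HasMin s I V ∧ HasMax s J V := by
  by_cases hrs : r = s
  · subst hrs; exact ⟨hmin, hmax⟩
  have c1 := card_inter_cyclicIco_compl hrs I
  have c2 := card_inter_cyclicIco_compl hrs J
  have r1 := hmin s
  have r2 := hmax s
  have hsplit : rowRank (cyclicIco r s) V + rowRank (cyclicIco r s)ᶜ V = Module.finrank F V := by
    rw [cyclicIco_compl hrs]; omega
  have hadd := fun {A B : Finset (Fin n)} (hA : A ⊆ cyclicIco r s) (hB : B ⊆ cyclicIco s r) =>
    rowRank_union_of_split hsplit hA (hB.trans (cyclicIco_compl hrs).ge)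
  refine ⟨fun i => ?_, fun i => ?_⟩
  · by_cases hi : i ∈ cyclicIco r s
    · have hc := (mem_cyclicIco'.1 hi).2
      obtain ⟨e1, -⟩ := cyclicIco_union hc
      have hsub : cyclicIco r i ⊆ cyclicIco r s := by
        intro z hz
        rw [mem_cyclicIco] at *
        omega
      rw [card_inter_cyclicIco_add hc, e1, Finset.union_comm, hadd hsub subset_rfl, hmin i]
      omega
    · rw [notMem_cyclicIco hrs] at hi
      have hc := (mem_cyclicIco'.1 hi).2
      obtain ⟨e1, -⟩ := cyclicIco_union hc
      have hsub : cyclicIco s i ⊆ cyclicIco s r := by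
        intro z hz
        rw [mem_cyclicIco] at *
        omega
      have h1 := hmin i
      rw [card_inter_cyclicIco_add hc, e1, hadd subset_rfl hsub] at h1
      omega
  · by_cases hi : i ∈ cyclicIco r s
    · by_cases hir : i = r
      · subst hir; omega
      have hc : cyc i s ≤ cyc i r := by
        have h1 := r.isLt
        have h2 := i.isLt
        have h3 := s.isLt
        simp only [mem_cyclicIco, cyc_eq, Fin.ext_iff] at *
        split_ifs at * <;> omega
      obtain ⟨e1, -⟩ := cyclicIco_union hc
      have hsub : cyclicIco i s ⊆ cyclicIco r s := by
        intro z hz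
        rw [mem_cyclicIco'] at *
        exact ⟨Ne.symm hrs |>.symm, by
          have h1 := r.isLt
          have h2 := i.isLt
          have h3 := s.isLt
          have h4 := z.isLt
          simp only [cyc_eq, ne_eq, Fin.ext_iff] at *
          split_ifs at * <;> omega⟩
      have h1 := hmax i
      rw [card_inter_cyclicIco_add hc, e1, hadd hsub subset_rfl] at h1
      omega
    · rw [notMem_cyclicIco hrs] at hi
      by_cases his : i = s
      · subst his; rw [cyclicIco_self, rowRank_empty]; simp
      have hc : cyc i r ≤ cyc i s := by
        have h1 := r.isLt
        have h2 := i.isLt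
        have h3 := s.isLt
        simp only [mem_cyclicIco, cyc_eq, Fin.ext_iff] at *
        split_ifs at * <;> omega
      obtain ⟨e1, -⟩ := cyclicIco_union hc
      have hsub : cyclicIco i r ⊆ cyclicIco s r := by
        intro z hz
        rw [mem_cyclicIco'] at *
        exact ⟨Ne.symm hrs, by
          have h1 := r.isLt
          have h2 := i.isLt
          have h3 := s.isLt
          have h4 := z.isLt
          simp only [cyc_eq, ne_eq, Fin.ext_iff] at *
          split_ifs at * <;> omega⟩
      rw [card_inter_cyclicIco_add hc, e1, Finset.union_comm, hadd subset_rfl hsub, hmax i]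
      omega

theorem hasMin_hasMax_change_iff {r s : Fin n} {I J : Finset (Fin n)}
    {V : Submodule F (Fin n → F)}
    (hI : I.card = Module.finrank F V) (hJ : J.card = Module.finrank F V)
    (h : (I ∩ cyclicIco r s).card = (J ∩ cyclicIco r s).card) :
    HasMin r I V ∧ HasMax r J V ↔ HasMin s I V ∧ HasMax s J V := by
  refine ⟨fun H => hasMin_hasMax_change hI hJ h H.1 H.2, fun H => ?_⟩
  refine hasMin_hasMax_change hI hJ ?_ H.1 H.2
  by_cases hrs : r = s
  · subst hrs; exact h
  have c1 := card_inter_cyclicIco_compl hrs I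
  have c2 := card_inter_cyclicIco_compl hrs J
  omega

end RowRank

/-! ### Subspaces in a rank-two quotient -/

section Interval

variable {n : ℕ} {F : Type*} [Field F]

/-- `V` is one of the points of the projective line between `L` and `U`. -/
def IsBetween (L U V : Submodule F (Fin n → F)) : Prop :=
  L ≤ V ∧ V ≤ U ∧ Module.finrank F V = Module.finrank F L + 1

section

variable {L U : Submodule F (Fin n → F)} {S : Finset (Fin n)}

/-- If passing from `L` to `U` raises the rank on `S` by one, then the vectors of `U` vanishing on `S`
span, together with `L`, a point of the projective line; it is the only one with the same
rank on `S` as `L`. -/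
theorem isBetween_sup (hLU : L ≤ U) (hS : rowRank S U = rowRank S L + 1)
    (hd : Module.finrank F U = Module.finrank F L + 2) :
    IsBetween L U (L ⊔ U ⊓ vanishing F S) := by
  refine ⟨le_sup_left, sup_le hLU inf_le_left, ?_⟩
  have h1 := Submodule.finrank_sup_add_finrank_inf_eq L (U ⊓ vanishing F S)
  have h2 := rowRank_add_finrank S U
  have h3 := rowRank_add_finrank S L
  have e : L ⊓ (U ⊓ vanishing F S) = L ⊓ vanishing F S := by
    rw [← inf_assoc, inf_eq_left.2 hLU]
  rw [e] at h1
  omega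

theorem rowRank_eq_iff_of_isBetween (hLU : L ≤ U) (hS : rowRank S U = rowRank S L + 1)
    (hd : Module.finrank F U = Module.finrank F L + 2) {V : Submodule F (Fin n → F)}
    (hV : IsBetween L U V) :
    rowRank S V = rowRank S L ↔ V = L ⊔ U ⊓ vanishing F S := by
  obtain ⟨-, -, hD⟩ := isBetween_sup hLU hS hd
  obtain ⟨hLV, hVU, hVd⟩ := hV
  have h2 := rowRank_add_finrank S V
  have h3 := rowRank_add_finrank S L
  have h4 := rowRank_add_finrank S U
  constructor
  · intro h
    have h1 := Submodule.finrank_sup_add_finrank_inf_eq L (V ⊓ vanishing F S)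
    have e : L ⊓ (V ⊓ vanishing F S) = L ⊓ vanishing F S := by
      rw [← inf_assoc, inf_eq_left.2 hLV]
    rw [e] at h1
    have e1 : L ⊔ V ⊓ vanishing F S = V :=
      Submodule.eq_of_le_of_finrank_eq (sup_le hLV inf_le_left) (by omega)
    have e2 : L ⊔ V ⊓ vanishing F S = L ⊔ U ⊓ vanishing F S :=
      Submodule.eq_of_le_of_finrank_eq (sup_le_sup_left (inf_le_inf_right _ hVU) _)
        (by rw [e1]; omega)
    rw [← e2, e1]
  · intro h
    have h1 := Submodule.finrank_mono (R := F) (le_inf (h ▸ le_sup_right : U ⊓ vanishing F S ≤ V)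
      inf_le_right)
    have h5 := rowRank_mono hLV S
    omega

end

/-- The pivots of the points of a projective line: exactly one point, the span of `L` and of the
vectors of `U` that vanish on `S₀`, gets the later pivot `β`, and all others get `α`. -/
theorem pivots_of_isBetween {L U V : Submodule F (Fin n → F)} (hLU : L ≤ U)
    (hd : Module.finrank F U = Module.finrank F L + 2) (hV : IsBetween L U V)
    {𝒮 : Set (Finset (Fin n))} (hchain : ∀ S ∈ 𝒮, ∀ T ∈ 𝒮, S ⊆ T ∨ T ⊆ S)
    {I : Finset (Fin n)} {α β : Fin n} (hα : α ∉ I) (hβ : β ∉ I) (hne : α ≠ β)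
    (hαβ : ∀ S ∈ 𝒮, β ∈ S → α ∈ S) {S₀ : Finset (Fin n)} (hS₀ : S₀ ∈ 𝒮) (hα₀ : α ∈ S₀)
    (hβ₀ : β ∉ S₀) (hL : ∀ S ∈ 𝒮, rowRank S L = (I ∩ S).card)
    (hU : ∀ S ∈ 𝒮, rowRank S U = (insert α (insert β I) ∩ S).card) :
    IsBetween L U (L ⊔ U ⊓ vanishing F S₀) ∧
    ((∀ S ∈ 𝒮, rowRank S V = (insert β I ∩ S).card) ↔ V = L ⊔ U ⊓ vanishing F S₀) ∧
    ((∀ S ∈ 𝒮, rowRank S V = (insert α I ∩ S).card) ↔ V ≠ L ⊔ U ⊓ vanishing F S₀) := by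
  have hins : ∀ (c : Fin n) (I : Finset (Fin n)), c ∉ I → ∀ S,
      (insert c I ∩ S).card = (I ∩ S).card + if c ∈ S then 1 else 0 := by
    intro c I hc S
    by_cases h : c ∈ S
    · rw [Finset.insert_inter_of_mem h, Finset.card_insert_of_notMem (by simp [hc]), if_pos h]
    · rw [Finset.insert_inter_of_notMem h, if_neg h, add_zero]
  have hα' : α ∉ insert β I := by simp [hα, hne]
  have key : ∀ S ∈ 𝒮, α ∈ S → β ∉ S → rowRank S U = rowRank S L + 1 := by
    intro S hS h1 h2
    rw [hU S hS, hL S hS, hins α _ hα', hins β _ hβ, if_pos h1, if_neg h2]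
  have hsame : ∀ S ∈ 𝒮, α ∈ S → β ∉ S →
      L ⊔ U ⊓ vanishing F S = L ⊔ U ⊓ vanishing F S₀ := by
    intro S hS h1 h2
    have d1 := (isBetween_sup hLU (key S hS h1 h2) hd).2.2
    have d2 := (isBetween_sup hLU (key S₀ hS₀ hα₀ hβ₀) hd).2.2
    rcases hchain S hS S₀ hS₀ with h | h
    · exact (Submodule.eq_of_le_of_finrank_eq (sup_le_sup_left (inf_le_inf_left _
        (vanishing_anti h)) _) (d2.trans d1.symm)).symm
    · exact Submodule.eq_of_le_of_finrank_eq (sup_le_sup_left (inf_le_inf_left _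
        (vanishing_anti h)) _) (d1.trans d2.symm)
  have hbd : ∀ S, rowRank S L ≤ rowRank S V ∧ rowRank S V ≤ rowRank S L + 1 ∧
      rowRank S V ≤ rowRank S U ∧ rowRank S U ≤ rowRank S V + 1 := by
    intro S
    have h1 := rowRank_mono hV.1 S
    have h2 := rowRank_mono hV.2.1 S
    have h3 := rowRank_add_finrank_le hV.1 S
    have h4 := rowRank_add_finrank_le hV.2.1 S
    have := hV.2.2
    omega
  -- only the sets of the chain that contain `α` but not `β` distinguish the points
  have hother : ∀ S ∈ 𝒮, (α ∈ S ∧ β ∉ S) ∨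
      (rowRank S V = (insert β I ∩ S).card ∧ rowRank S V = (insert α I ∩ S).card) := by
    intro S hS
    have h1 := hU S hS
    have h2 := hL S hS
    have h3 := hbd S
    have h4 := hαβ S hS
    rw [hins α _ hα', hins β _ hβ] at h1
    rw [hins α _ hα, hins β _ hβ]
    by_cases hαS : α ∈ S
    · by_cases hβS : β ∈ S
      · rw [if_pos hαS, if_pos hβS] at h1
        rw [if_pos hαS, if_pos hβS]
        exact Or.inr (by omega)
      · exact Or.inl ⟨hαS, hβS⟩
    · have hβS : β ∉ S := fun h => hαS (h4 h)
      rw [if_neg hαS, if_neg hβS] at h1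
      rw [if_neg hαS, if_neg hβS]
      exact Or.inr (by omega)
  have hS₀V := rowRank_eq_iff_of_isBetween hLU (key S₀ hS₀ hα₀ hβ₀) hd hV
  refine ⟨isBetween_sup hLU (key S₀ hS₀ hα₀ hβ₀) hd,
    ⟨fun h => ?_, fun h S hS => ?_⟩, ⟨fun h hV' => ?_, fun h S hS => ?_⟩⟩
  · rw [← hS₀V, h S₀ hS₀, hins β _ hβ, if_neg hβ₀, hL S₀ hS₀, add_zero]
  · rcases hother S hS with hc | hc
    · rw [hins β _ hβ, if_neg hc.2, add_zero, ← hL S hS,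
        rowRank_eq_iff_of_isBetween hLU (key S hS hc.1 hc.2) hd hV, hsame S hS hc.1 hc.2, h]
    · exact hc.1
  · have := h S₀ hS₀
    rw [hS₀V.2 hV', hins α _ hα, if_pos hα₀, hL S₀ hS₀] at this
    omega
  · rcases hother S hS with hc | hc
    · have h1 : rowRank S V ≠ rowRank S L := by
        rw [ne_eq, rowRank_eq_iff_of_isBetween hLU (key S hS hc.1 hc.2) hd hV,
          hsame S hS hc.1 hc.2]
        exact h
      have := hbd S
      have := hL S hS
      rw [hins α _ hα, if_pos hc.1]
      omega
    · exact hc.2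

end Interval

/-! ### Flags that differ in one step -/

section PointCount

variable {n : ℕ} {F : Type*} [Field F]

/-- A projective line over `𝔽_q` minus one point has `q` points. -/
theorem card_isBetween_ne [Finite F] {L U D : Submodule F (Fin n → F)} (hD : IsBetween L U D)
    (hd : Module.finrank F U = Module.finrank F L + 2) :
    Nat.card {V // IsBetween L U V ∧ V ≠ D} = Nat.card F := by
  obtain ⟨hLD, hDU, hDd⟩ := hD
  obtain ⟨e₁, he₁, he₁'⟩ : ∃ e ∈ D, e ∉ L := by
    by_contra! h
    have := Submodule.finrank_mono (R := F) (show D ≤ L from h)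
    omega
  obtain ⟨e₂, he₂, he₂'⟩ : ∃ e ∈ U, e ∉ D := by
    by_contra! h
    have := Submodule.finrank_mono (R := F) (show U ≤ D from h)
    omega
  have hx : ∀ c : F, e₂ + c • e₁ ∉ D := fun c h => he₂' <| by
    simpa using D.sub_mem h (D.smul_mem c he₁)
  have hDspan : D = L ⊔ F ∙ e₁ := by
    refine (Submodule.eq_of_le_of_finrank_eq (sup_le hLD ?_) ?_).symm
    · rwa [Submodule.span_singleton_le_iff_mem]
    · rw [Submodule.finrank_sup_span_singleton he₁', hDd]
  let f : F → {V // IsBetween L U V ∧ V ≠ D} := fun c => ⟨L ⊔ F ∙ (e₂ + c • e₁), by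
    refine ⟨⟨le_sup_left, sup_le (hLD.trans hDU) ?_, ?_⟩, fun h => ?_⟩
    · rw [Submodule.span_singleton_le_iff_mem]
      exact U.add_mem he₂ (U.smul_mem c (hDU he₁))
    · exact Submodule.finrank_sup_span_singleton fun h => hx c (hLD h)
    · exact hx c (h ▸ (le_sup_right : F ∙ (e₂ + c • e₁) ≤ _) (Submodule.mem_span_singleton_self _))⟩
  have hmem : ∀ c, e₂ + c • e₁ ∈ (f c).1 := fun c =>
    (le_sup_right : F ∙ (e₂ + c • e₁) ≤ _) (Submodule.mem_span_singleton_self _)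
  refine (Nat.card_eq_of_bijective f ⟨fun c c' h => ?_, fun V => ?_⟩).symm
  · by_contra hcc
    have h1 := hmem c
    have h2 := hmem c'
    rw [← h] at h2
    have h3 : e₁ ∈ (f c).1 := by
      have h4 := (f c).1.sub_mem h1 h2
      rw [add_sub_add_left_eq_sub, ← sub_smul] at h4
      exact (Submodule.smul_mem_iff _ (sub_ne_zero.2 hcc)).1 h4
    obtain ⟨y, hy, z, hz, hyz⟩ := Submodule.mem_sup.1 h3
    obtain ⟨l, rfl⟩ := Submodule.mem_span_singleton.1 hz
    by_cases hl : l = 0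
    · rw [hl, zero_smul, add_zero] at hyz
      exact he₁' (hyz ▸ hy)
    · refine hx c ((Submodule.smul_mem_iff _ hl).1 ?_)
      rw [← eq_sub_iff_add_eq'] at hyz
      rw [hyz]
      exact D.sub_mem he₁ (hLD hy)
  · obtain ⟨V, ⟨hLV, hVU, hVd⟩, hVD⟩ := V
    have hsup : V ⊔ D = U := by
      refine Submodule.eq_of_le_of_finrank_le (sup_le hVU hDU) ?_
      by_contra! hlt
      have h1 : V = V ⊔ D := Submodule.eq_of_le_of_finrank_le le_sup_left (by omega)
      have h2 : D = V ⊔ D := Submodule.eq_of_le_of_finrank_le le_sup_right (by omega)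
      exact hVD (h1.trans h2.symm)
    rw [← hsup, hDspan, ← sup_assoc, sup_eq_left.2 hLV] at he₂
    obtain ⟨x, hxV, z, hz, hxz⟩ := Submodule.mem_sup.1 he₂
    obtain ⟨l, rfl⟩ := Submodule.mem_span_singleton.1 hz
    refine ⟨-l, Subtype.ext (Submodule.eq_of_le_of_finrank_eq (sup_le hLV ?_) ?_)⟩
    · rw [Submodule.span_singleton_le_iff_mem, ← hxz]
      simpa using hxV
    · rw [hVd]
      exact (f (-l)).2.1.2.2

namespace CompleteFlag

instance [Finite F] : Finite (CompleteFlag F n) :=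
  Finite.of_injective CompleteFlag.space fun _ _ h => CompleteFlag.ext h

/-- The step of the flag preceding `k`, which is `0` if `k` is the first index. -/
def lower (x : CompleteFlag F n) (k : Fin n) : Submodule F (Fin n → F) :=
  if h : 0 < (k : ℕ) then x.space ⟨k - 1, by omega⟩ else ⊥

theorem finrank_lower (x : CompleteFlag F n) (k : Fin n) : Module.finrank F (x.lower k) = k := by
  by_cases h : 0 < (k : ℕ)
  · rw [lower, dif_pos h, x.finrank_space]; simp only; omega
  · rw [lower, dif_neg h, finrank_bot]; omega

theorem lower_le (x : CompleteFlag F n) (k : Fin n) : x.lower k ≤ x.space k := by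
  unfold lower
  split_ifs with h
  · exact x.mono (Fin.le_def.2 (by simp))
  · exact bot_le

theorem le_lower (x : CompleteFlag F n) {p k : Fin n} (h : p < k) : x.space p ≤ x.lower k := by
  have h' : (p : ℕ) < k := h
  rw [lower, dif_pos (by omega)]
  exact x.mono (Fin.le_def.2 (by simp only; omega))

theorem isBetween (x : CompleteFlag F n) (i : Fin (n - 1)) :
    IsBetween (x.lower (lo i)) (x.space (hi i)) (x.space (lo i)) :=
  ⟨x.lower_le _, x.mono (lo_lt_hi i).le, by rw [x.finrank_space, x.finrank_lower]⟩

theorem finrank_hi (x : CompleteFlag F n) (i : Fin (n - 1)) :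
    Module.finrank F (x.space (hi i)) = Module.finrank F (x.lower (lo i)) + 2 := by
  rw [x.finrank_space, x.finrank_lower]; rfl

/-- Replace the step at position `i` of a flag by `V`, lying between the neighbouring steps. -/
def replace (x : CompleteFlag F n) (i : Fin (n - 1)) (V : Submodule F (Fin n → F))
    (hV : IsBetween (x.lower (lo i)) (x.space (hi i)) V) : CompleteFlag F n where
  space := Function.update x.space (lo i) V
  mono := by
    intro p q hpq
    by_cases hp : p = lo i
    · subst hp
      rw [Function.update_self]
      by_cases hq : q = lo i
      · rw [hq, Function.update_self]
      · rw [Function.update_of_ne hq]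
        exact hV.2.1.trans (x.mono (lt_of_le_of_ne hpq (Ne.symm hq)))
    · rw [Function.update_of_ne hp]
      by_cases hq : q = lo i
      · subst hq
        rw [Function.update_self]
        exact (x.le_lower (lt_of_le_of_ne hpq hp)).trans hV.1
      · rw [Function.update_of_ne hq]
        exact x.mono hpq
  finrank_space := by
    intro k
    by_cases hk : k = lo i
    · subst hk
      rw [Function.update_self, hV.2.2, x.finrank_lower]
    · rw [Function.update_of_ne hk, x.finrank_space]

section

variable (x : CompleteFlag F n) (i : Fin (n - 1)) {V : Submodule F (Fin n → F)}
  (hV : IsBetween (x.lower (lo i)) (x.space (hi i)) V)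

theorem replace_space_lo : (x.replace i V hV).space (lo i) = V := Function.update_self ..

theorem replace_space_of_ne {k : Fin n} (hk : k ≠ lo i) :
    (x.replace i V hV).space k = x.space k := Function.update_of_ne hk ..

theorem replace_space_hi : (x.replace i V hV).space (hi i) = x.space (hi i) :=
  x.replace_space_of_ne i hV (lo_lt_hi i).ne'

theorem replace_lower : (x.replace i V hV).lower (lo i) = x.lower (lo i) := by
  unfold lower
  split_ifs with h
  · refine x.replace_space_of_ne i hV fun h' => ?_
    have := congrArg Fin.val h'
    simp only at this
    omega
  · rfl

end

/-- Two flags that agree except possibly at position `i`. -/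
def AgreeOff (i : Fin (n - 1)) (x y : CompleteFlag F n) : Prop :=
  ∀ k, k ≠ lo i → x.space k = y.space k

theorem AgreeOff.lower_eq {i : Fin (n - 1)} {x y : CompleteFlag F n} (h : AgreeOff i x y) :
    x.lower (lo i) = y.lower (lo i) := by
  unfold lower
  split_ifs with h'
  · refine h _ fun h'' => ?_
    have := congrArg Fin.val h''
    simp only at this
    omega
  · rfl

theorem AgreeOff.hi_eq {i : Fin (n - 1)} {x y : CompleteFlag F n} (h : AgreeOff i x y) :
    x.space (hi i) = y.space (hi i) := h _ (lo_lt_hi i).ne'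

theorem AgreeOff.ext {i : Fin (n - 1)} {x y : CompleteFlag F n} (h : AgreeOff i x y)
    (h' : x.space (lo i) = y.space (lo i)) : x = y := by
  refine CompleteFlag.ext (funext fun k => ?_)
  by_cases hk : k = lo i
  · rw [hk, h']
  · exact h k hk

theorem agreeOff_replace (x : CompleteFlag F n) (i : Fin (n - 1)) {V : Submodule F (Fin n → F)}
    (hV : IsBetween (x.lower (lo i)) (x.space (hi i)) V) : AgreeOff i (x.replace i V hV) x :=
  fun _ hk => x.replace_space_of_ne i hV hk

theorem agreeOff_replace_replace (x : CompleteFlag F n) (i : Fin (n - 1))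
    {V W : Submodule F (Fin n → F)} (hV : IsBetween (x.lower (lo i)) (x.space (hi i)) V)
    (hW : IsBetween ((x.replace i V hV).lower (lo i)) ((x.replace i V hV).space (hi i)) W) :
    AgreeOff i ((x.replace i V hV).replace i W hW) x :=
  fun k hk => (agreeOff_replace _ i hW k hk).trans (agreeOff_replace x i hV k hk)

end CompleteFlag

open CompleteFlag in
/-- Point counts over the projective lines of flags agreeing off position `i`: the set `O`
consists of whole lines, each with two marked points `P` and `Q`. -/
theorem card_lines [Finite F] (i : Fin (n - 1)) (O : CompleteFlag F n → Prop)
    (hO : ∀ x y, AgreeOff i x y → O x → O y)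
    (P Q : CompleteFlag F n → Submodule F (Fin n → F))
    (hP : ∀ x y, AgreeOff i x y → P x = P y) (hQ : ∀ x y, AgreeOff i x y → Q x = Q y)
    (hPb : ∀ x, O x → IsBetween (x.lower (lo i)) (x.space (hi i)) (P x))
    (hQb : ∀ x, O x → IsBetween (x.lower (lo i)) (x.space (hi i)) (Q x)) :
    Nat.card {x // O x ∧ x.space (lo i) = P x ∧ x.space (lo i) ≠ Q x} =
      Nat.card {x // O x ∧ x.space (lo i) ≠ P x ∧ x.space (lo i) = Q x} ∧
    (Nat.card {x // O x ∧ x.space (lo i) ≠ P x ∧ x.space (lo i) ≠ Q x} : ℤ) =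
      ((Nat.card F : ℤ) - 1) * Nat.card {x // O x ∧ x.space (lo i) ≠ P x ∧ x.space (lo i) = Q x} +
      (Nat.card F : ℤ) * Nat.card {x // O x ∧ x.space (lo i) = P x ∧ x.space (lo i) = Q x} := by
  classical
  have hrO : ∀ x V hV, O x → O (x.replace i V hV) := fun x V hV h =>
    hO x _ (fun k hk => (agreeOff_replace x i hV k hk).symm) h
  have hrP : ∀ x V hV, P (x.replace i V hV) = P x := fun x V hV => hP _ _ (agreeOff_replace x i hV)
  have hrQ : ∀ x V hV, Q (x.replace i V hV) = Q x := fun x V hV => hQ _ _ (agreeOff_replace x i hV)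
  constructor
  · -- exchange `P` and `Q` on the lines where they differ
    refine Nat.card_congr
      { toFun := fun x => ⟨x.1.replace i (Q x.1) (hQb _ x.2.1), hrO _ _ _ x.2.1, ?_, ?_⟩
        invFun := fun x => ⟨x.1.replace i (P x.1) (hPb _ x.2.1), hrO _ _ _ x.2.1, ?_, ?_⟩
        left_inv := fun x => Subtype.ext (AgreeOff.ext (i := i) ?_ ?_)
        right_inv := fun x => Subtype.ext (AgreeOff.ext (i := i) ?_ ?_) }
    · rw [replace_space_lo, hrP, ← x.2.2.1]; exact x.2.2.2.symm
    · rw [replace_space_lo, hrQ]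
    · rw [replace_space_lo, hrP]
    · rw [replace_space_lo, hrQ, ← x.2.2.2]; exact x.2.2.1.symm
    · exact agreeOff_replace_replace x.1 i (hQb _ x.2.1) (hPb _ (hrO _ _ _ x.2.1))
    · rw [replace_space_lo, hrP, x.2.2.1]
    · exact agreeOff_replace_replace x.1 i (hPb _ x.2.1) (hQb _ (hrO _ _ _ x.2.1))
    · rw [replace_space_lo, hrQ, x.2.2.2]
  · -- the lines are parametrized by their points `Q`; each has `q` or `q - 1` points off `P` and `Q`
    let Z := {x : CompleteFlag F n // O x ∧ x.space (lo i) = Q x}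
    let Φ : Z → Type _ := fun z =>
      {V // (IsBetween (z.1.lower (lo i)) (z.1.space (hi i)) V ∧ V ≠ Q z.1) ∧ V ≠ P z.1}
    have e : {x // O x ∧ x.space (lo i) ≠ P x ∧ x.space (lo i) ≠ Q x} ≃ Σ z : Z, Φ z :=
      { toFun := fun x => ⟨⟨x.1.replace i (Q x.1) (hQb _ x.2.1), hrO _ _ _ x.2.1, by
            rw [replace_space_lo, hrQ]⟩, ⟨x.1.space (lo i), ⟨by
              simp only [replace_lower, replace_space_hi]; exact x.1.isBetween i, by
              simp only [hrQ]; exact x.2.2.2⟩, by simp only [hrP]; exact x.2.2.1⟩⟩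
        invFun := fun s => ⟨s.1.1.replace i s.2.1 s.2.2.1.1, hrO _ _ _ s.1.2.1, by
          rw [replace_space_lo, hrP]; exact s.2.2.2, by
          rw [replace_space_lo, hrQ]; exact s.2.2.1.2⟩
        left_inv := fun x => Subtype.ext (AgreeOff.ext (i := i)
          (agreeOff_replace_replace x.1 i (hQb _ x.2.1)
            (by simp only [replace_lower, replace_space_hi]; exact x.1.isBetween i))
          (by rw [replace_space_lo]))
        right_inv := fun s => by
          obtain ⟨z, V⟩ := s
          have h1 : (⟨(z.1.replace i V.1 V.2.1.1).replace i (Q (z.1.replace i V.1 V.2.1.1))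
              (hQb _ (hrO _ _ _ z.2.1)), hrO _ _ _ (hrO _ _ _ z.2.1), by
                rw [replace_space_lo]; exact (hrQ _ _ _).symm⟩ : Z) = z := by
            refine Subtype.ext (AgreeOff.ext (i := i)
              (agreeOff_replace_replace z.1 i V.2.1.1 (hQb _ (hrO _ _ _ z.2.1))) ?_)
            rw [replace_space_lo]
            exact (hrQ _ _ _).trans z.2.2.symm
          refine Sigma.ext h1 ?_
          refine (Subtype.heq_iff_coe_eq ?_).2 ?_
          · intro V'
            simp only [replace_lower, replace_space_hi, hrP, hrQ]
          · simp only [replace_space_lo] }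
    have hΦ : ∀ z : Z, (Nat.card (Φ z) : ℤ) =
        (Nat.card F : ℤ) - if z.1.space (lo i) = P z.1 then 0 else 1 := by
      intro z
      have h1 := card_isBetween_ne (hQb _ z.2.1) (z.1.finrank_hi i)
      by_cases hz : z.1.space (lo i) = P z.1
      · rw [if_pos hz, ← h1, sub_zero]
        congr 1
        refine Nat.card_congr (Equiv.subtypeEquivRight fun V => ?_)
        rw [← hz, z.2.2]
        simp
      · rw [if_neg hz, ← h1]
        have h2 := Nat.card_congr (Equiv.sumCompl fun V : {V //
          IsBetween (z.1.lower (lo i)) (z.1.space (hi i)) V ∧ V ≠ Q z.1} => V.1 ≠ P z.1)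
        rw [Nat.card_sum] at h2
        have h3 : Nat.card {V : {V // IsBetween (z.1.lower (lo i)) (z.1.space (hi i)) V ∧
            V ≠ Q z.1} // ¬ V.1 ≠ P z.1} = 1 := by
          rw [Nat.card_eq_one_iff_unique]
          refine ⟨⟨fun x y => ?_⟩, ⟨⟨⟨P z.1, hPb _ z.2.1, ?_⟩, by simp⟩⟩⟩
          · have h4 := not_not.1 x.2
            have h5 := not_not.1 y.2
            exact Subtype.ext (Subtype.ext (h4.trans h5.symm))
          · rw [← z.2.2]; exact fun h => hz h.symm
        have h4 := Nat.card_congr (Equiv.subtypeSubtypeEquivSubtypeInter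
          (fun V => IsBetween (z.1.lower (lo i)) (z.1.space (hi i)) V ∧ V ≠ Q z.1)
          (fun V => V ≠ P z.1))
        have h5 : Nat.card (Φ z) = Nat.card {V : {V // IsBetween (z.1.lower (lo i))
            (z.1.space (hi i)) V ∧ V ≠ Q z.1} // V.1 ≠ P z.1} := h4.symm
        rw [h5]
        omega
    have : Fintype Z := Fintype.ofFinite Z
    rw [Nat.card_congr e, Nat.card_sigma, Nat.cast_sum, Finset.sum_congr rfl fun z _ => hΦ z]
    have hN : (Nat.card Z : ℤ) =
        Nat.card {x // O x ∧ x.space (lo i) = P x ∧ x.space (lo i) = Q x} +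
        Nat.card {x // O x ∧ x.space (lo i) ≠ P x ∧ x.space (lo i) = Q x} := by
      rw [← Nat.card_congr (Equiv.sumCompl fun z : Z => z.1.space (lo i) = P z.1), Nat.card_sum]
      push_cast
      congr 2
      · refine Nat.card_congr ((Equiv.subtypeSubtypeEquivSubtypeInter _
          (fun x : CompleteFlag F n => x.space (lo i) = P x)).trans
          (Equiv.subtypeEquivRight fun x => ?_))
        tauto
      · refine Nat.card_congr ((Equiv.subtypeSubtypeEquivSubtypeInter _
          (fun x : CompleteFlag F n => ¬ x.space (lo i) = P x)).trans
          (Equiv.subtypeEquivRight fun x => ?_))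
        tauto
    have hN' : (∑ z : Z, if z.1.space (lo i) = P z.1 then (0 : ℤ) else 1) =
        Nat.card {x // O x ∧ x.space (lo i) ≠ P x ∧ x.space (lo i) = Q x} := by
      have h1 : ∀ z : Z, (if z.1.space (lo i) = P z.1 then (0 : ℤ) else 1) =
          if ¬ z.1.space (lo i) = P z.1 then 1 else 0 := fun z => by rw [ite_not]
      rw [Finset.sum_congr rfl fun z _ => h1 z, Finset.sum_boole, ← Fintype.card_subtype,
        ← Nat.card_eq_fintype_card]
      congr 1
      refine Nat.card_congr ((Equiv.subtypeSubtypeEquivSubtypeInter _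
          (fun x : CompleteFlag F n => ¬ x.space (lo i) = P x)).trans
          (Equiv.subtypeEquivRight fun x => ?_))
      tauto
    rw [Finset.sum_sub_distrib, hN', Finset.sum_const, Finset.card_univ,
      ← Nat.card_eq_fintype_card, nsmul_eq_mul, hN]
    ring

end PointCount

/-! ### Points of open tilted Richardson varieties -/

section Points

variable {n : ℕ} {F : Type*} [Field F]

theorem mem_openTiltedRichardsonAt {a : Fin n → Fin n} {u v : Equiv.Perm (Fin n)}
    {x : CompleteFlag F n} : x ∈ openTiltedRichardsonAt F a u v ↔
      ∀ k, HasMin (a k) (firstEntries u (k + 1)) (x.space k) ∧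
        HasMax (a k) (firstEntries v (k + 1)) (x.space k) :=
  ⟨fun h k => ⟨fun i => (h i k).1, fun i => (h i k).2⟩, fun h i k => ⟨(h k).1 i, (h k).2 i⟩⟩

theorem card_firstEntries_eq_finrank (u : Equiv.Perm (Fin n)) (x : CompleteFlag F n) (k : Fin n) :
    (firstEntries u (k + 1)).card = Module.finrank F (x.space k) := by
  rw [card_firstEntries u k.isLt, x.finrank_space]

/-- The tilt may be changed from `a` to `a'` if `u` and `v` have equally many of their first `k` entries
in `[a_k, a'_k)_c`. -/
theorem openTiltedRichardsonAt_eq {a a' : Fin n → Fin n} {u v : Equiv.Perm (Fin n)}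
    (h : ∀ k : Fin n, (firstEntries u (k + 1) ∩ cyclicIco (a k) (a' k)).card =
      (firstEntries v (k + 1) ∩ cyclicIco (a k) (a' k)).card) :
    openTiltedRichardsonAt F a u v = openTiltedRichardsonAt F a' u v := by
  ext x
  rw [mem_openTiltedRichardsonAt, mem_openTiltedRichardsonAt]
  exact forall_congr' fun k => hasMin_hasMax_change_iff (card_firstEntries_eq_finrank u x k)
    (card_firstEntries_eq_finrank v x k) (h k)

theorem TiltedCountLE.card_inter_eq {a a' : Fin n → Fin n} {u v : Equiv.Perm (Fin n)}
    (h : TiltedCountLE a u v) (h' : TiltedCountLE a' u v) (k : Fin n) :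
    (firstEntries u (k + 1) ∩ cyclicIco (a k) (a' k)).card =
      (firstEntries v (k + 1) ∩ cyclicIco (a k) (a' k)).card := by
  by_cases hk : a k = a' k
  · rw [hk, cyclicIco_self]; simp
  have h1 := h k (cyc (a k) (a' k))
  have h2 := h' k (cyc (a' k) (a k))
  rw [← cyclicIco_eq_cycIio] at h1 h2
  have h3 := card_inter_cyclicIco_compl hk (firstEntries u (k + 1))
  have h4 := card_inter_cyclicIco_compl hk (firstEntries v (k + 1))
  rw [card_firstEntries _ k.isLt] at h3 h4
  omega

/-- The set `T°_{u,v}` is `T°_{u,v,a}` for any `a` with `u ≤_a v`. -/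
theorem openTiltedRichardson_eq {a : Fin n → Fin n} {u v : Equiv.Perm (Fin n)}
    (h : TiltedLE a u v) : openTiltedRichardson F u v = openTiltedRichardsonAt F a u v := by
  ext x
  refine ⟨?_, fun hx => ⟨a, h, hx⟩⟩
  rintro ⟨a', h', hx⟩
  rwa [← openTiltedRichardsonAt_eq (h'.countLE.card_inter_eq h.countLE)]

/-- If an initial segment of `v` lies in an initial segment of the cyclic order, then so does the one of
`u`, provided that `T°_{u,v,a}` has a point. -/
theorem apply_mem_cyclicIco_of_mem {a : Fin n → Fin n} {u v : Equiv.Perm (Fin n)}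
    {x : CompleteFlag F n} (hx : x ∈ openTiltedRichardsonAt F a u v) {k s : Fin n}
    (hs : a k ≠ s) (hv : ∀ i, i ≤ k → v i ∈ cyclicIco (a k) s) {i : Fin n} (hi : i ≤ k) :
    u i ∈ cyclicIco (a k) s := by
  obtain ⟨h1, h2⟩ := mem_openTiltedRichardsonAt.1 hx k
  have h3 := h1 s
  have h4 := h2 s
  have h5 : firstEntries v (k + 1) ∩ cyclicIco s (a k) = ∅ := by
    refine Finset.eq_empty_of_forall_notMem fun z hz => ?_
    rw [Finset.mem_inter] at hz
    obtain ⟨q, rfl⟩ := v.surjective z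
    rw [apply_mem_firstEntries] at hz
    exact (notMem_cyclicIco hs.symm).2 (hv q (Nat.lt_succ_iff.1 hz.1)) hz.2
  rw [h5, Finset.card_empty] at h4
  have h6 := rowRank_submodular (cyclicIco (a k) s) (cyclicIco s (a k)) (x.space k)
  rw [← cyclicIco_compl hs, Finset.union_compl, rowRank_univ, cyclicIco_compl hs,
    ← card_firstEntries_eq_finrank u x k] at h6
  have h7 := Finset.eq_of_subset_of_card_le
    (Finset.inter_subset_left (s₁ := firstEntries u (k + 1)) (s₂ := cyclicIco (a k) s)) (by omega)
  have h8 : u i ∈ firstEntries u (k + 1) := apply_mem_firstEntries.2 (Nat.lt_succ_of_le hi)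
  rw [← h7] at h8
  exact (Finset.mem_inter.1 h8).2

/-- The number of points of `T°_{u,v,a}`. -/
noncomputable def pointCount (F : Type*) [Field F] (a : Fin n → Fin n) (u v : Equiv.Perm (Fin n)) :
    ℤ := Nat.card (openTiltedRichardsonAt F a u v)

/-- The points of `T°_{u,v,a}` for `(u, v)`, `(u s_i, v)`, `(u, v s_i)` and `(u s_i, v s_i)`, where
`i` is not a jump: they satisfy the same conditions off position `i`, and at position `i`
they are told apart by two points of a projective line. -/
theorem exists_marked_points {a : Fin n → Fin n} {i : Fin (n - 1)} (ha : a (lo i) = a (hi i))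
    {u v : Equiv.Perm (Fin n)} (huv : TiltedEquiv a u v)
    (hu : cyc (a (lo i)) (u (lo i)) < cyc (a (lo i)) (u (hi i)))
    (hv : cyc (a (lo i)) (v (lo i)) < cyc (a (lo i)) (v (hi i)))
    (O : CompleteFlag F n → Prop)
    (hO : ∀ x, O x ↔ ∀ k, k ≠ lo i → HasMin (a k) (firstEntries u (k + 1)) (x.space k) ∧
        HasMax (a k) (firstEntries v (k + 1)) (x.space k))
    (P Q : CompleteFlag F n → Submodule F (Fin n → F))
    (hP : ∀ x, P x = x.lower (lo i) ⊔ x.space (hi i) ⊓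
      vanishing F (cyclicIco (a (lo i)) (u (hi i))))
    (hQ : ∀ x, Q x = x.lower (lo i) ⊔ x.space (hi i) ⊓
      vanishing F (cyclicIco (v (hi i)) (a (lo i))))
    (x : CompleteFlag F n) (hx : O x) :
    IsBetween (x.lower (lo i)) (x.space (hi i)) (P x) ∧
    IsBetween (x.lower (lo i)) (x.space (hi i)) (Q x) ∧
    (HasMin (a (lo i)) (firstEntries u (lo i + 1)) (x.space (lo i)) ↔ x.space (lo i) ≠ P x) ∧
    (HasMin (a (lo i)) (firstEntries (u * simpleSwap i) (lo i + 1)) (x.space (lo i)) ↔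
      x.space (lo i) = P x) ∧
    (HasMax (a (lo i)) (firstEntries v (lo i + 1)) (x.space (lo i)) ↔ x.space (lo i) = Q x) ∧
    (HasMax (a (lo i)) (firstEntries (v * simpleSwap i) (lo i + 1)) (x.space (lo i)) ↔
      x.space (lo i) ≠ Q x) := by
  rw [hO] at hx
  set r := a (lo i) with hr
  have hins1 : ∀ w : Equiv.Perm (Fin n), firstEntries w (lo i + 1) =
      insert (w (lo i)) (firstEntries w (lo i)) := by
    intro w
    ext z
    obtain ⟨q, rfl⟩ := w.surjective z
    rw [Finset.mem_insert, apply_mem_firstEntries, apply_mem_firstEntries, w.injective.eq_iff,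
      Fin.ext_iff]
    omega
  have hins2 : ∀ w : Equiv.Perm (Fin n), firstEntries w (hi i + 1) =
      insert (w (hi i)) (insert (w (lo i)) (firstEntries w (lo i))) := by
    intro w
    rw [← hins1]
    ext z
    obtain ⟨q, rfl⟩ := w.surjective z
    rw [Finset.mem_insert, apply_mem_firstEntries, apply_mem_firstEntries, w.injective.eq_iff,
      Fin.ext_iff]
    simp only [lo, hi]
    omega
  have hins3 : ∀ w : Equiv.Perm (Fin n), firstEntries (w * simpleSwap i) (lo i + 1) =
      insert (w (hi i)) (firstEntries w (lo i)) := by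
    intro w
    rw [hins1, mul_simpleSwap_lo]
    congr 1
    exact firstEntries_swap_of_not (lo_lt_hi i) (by simp)
  have hlo : ∀ w : Equiv.Perm (Fin n), w (lo i) ∉ firstEntries w (lo i) := fun w => by
    rw [apply_mem_firstEntries]; omega
  have hhi : ∀ w : Equiv.Perm (Fin n), w (hi i) ∉ firstEntries w (lo i) := fun w => by
    rw [apply_mem_firstEntries]; simp only [lo, hi]; omega
  -- the tilt may change at position `i - 1`, which does not matter because `u ∼_a v`
  have hlow : HasMin r (firstEntries u (lo i)) (x.lower (lo i)) ∧
      HasMax r (firstEntries v (lo i)) (x.lower (lo i)) := by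
    by_cases h0 : 0 < ((lo i : Fin n) : ℕ)
    · have hk : (⟨lo i - 1, by omega⟩ : Fin n) ≠ lo i := fun h => by
        have := congrArg Fin.val h
        simp only at this
        omega
      have hk1 : (((⟨lo i - 1, by omega⟩ : Fin n) : Fin n) : ℕ) + 1 = lo i := by
        simp only; omega
      have hnext : nextEntry a ⟨lo i - 1, by omega⟩ = r := by
        rw [nextEntry, dif_pos (by rw [hk1]; exact (lo i).isLt)]
        exact congrArg a (Fin.ext hk1)
      have h1 := hx _ hk
      have h2 := huv ⟨lo i - 1, by omega⟩
      rw [hnext] at h2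
      have h3 := (hasMin_hasMax_change_iff (card_firstEntries_eq_finrank u x _)
        (card_firstEntries_eq_finrank v x _) h2).1 h1
      rw [hk1] at h3
      rw [CompleteFlag.lower, dif_pos h0]
      exact h3
    · have e : ∀ w : Equiv.Perm (Fin n), firstEntries w (lo i) = ∅ := by
        intro w
        rw [← Finset.card_eq_zero, card_firstEntries _ (lo i).isLt.le]
        omega
      have e' : x.lower (lo i) = ⊥ := dif_neg h0
      have e'' : ∀ S : Finset (Fin n), rowRank S (⊥ : Submodule F (Fin n → F)) = 0 := fun S => by
        have := rowRank_le_finrank S (⊥ : Submodule F (Fin n → F))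
        rwa [finrank_bot, Nat.le_zero] at this
      rw [e, e, e']
      exact ⟨fun _ => by rw [e'']; simp, fun _ => by rw [e'']; simp⟩
  have hup := hx (hi i) (lo_lt_hi i).ne'
  rw [← ha] at hup
  have hLU : x.lower (lo i) ≤ x.space (hi i) := (x.isBetween i).1.trans (x.isBetween i).2.1
  have hmin := pivots_of_isBetween (𝒮 := Set.range (cyclicIco r)) (S₀ := cyclicIco r (u (hi i)))
    hLU (x.finrank_hi i) (x.isBetween i) ?_ (hlo u) (hhi u) (u.injective.ne (lo_lt_hi i).ne) ?_
    ⟨_, rfl⟩ (mem_cyclicIco.2 hu) (by rw [mem_cyclicIco]; omega) ?_ ?_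
  rotate_left
  · rintro _ ⟨y, rfl⟩ _ ⟨z, rfl⟩
    rcases le_total (cyc r y) (cyc r z) with h | h
    · left; intro c hc; rw [mem_cyclicIco] at *; omega
    · right; intro c hc; rw [mem_cyclicIco] at *; omega
  · rintro _ ⟨y, rfl⟩ h
    rw [mem_cyclicIco] at *; omega
  · rintro _ ⟨y, rfl⟩; exact hlow.1 y
  · rintro _ ⟨y, rfl⟩
    rw [Finset.insert_comm, ← hins2]; exact hup.1 y
  have hvr : v (hi i) ≠ r := by
    rintro h
    rw [h, cyc_self] at hv
    omega
  have hmax := pivots_of_isBetween (𝒮 := Set.range fun y => cyclicIco y r)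
    (S₀ := cyclicIco (v (hi i)) r)
    hLU (x.finrank_hi i) (x.isBetween i) ?_ (hhi v) (hlo v) (v.injective.ne (lo_lt_hi i).ne') ?_
    ⟨_, rfl⟩ (mem_cyclicIco'.2 ⟨hvr, le_rfl⟩) (by rw [mem_cyclicIco']; omega) ?_ ?_
  rotate_left
  · rintro _ ⟨y, rfl⟩ _ ⟨z, rfl⟩
    by_cases hy : y = r
    · left; subst hy; simp only [cyclicIco_self, Finset.empty_subset]
    by_cases hz : z = r
    · right; subst hz; simp only [cyclicIco_self, Finset.empty_subset]
    rcases le_total (cyc r y) (cyc r z) with h | h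
    · right; intro c hc; simp only [mem_cyclicIco'] at *; exact ⟨hy, by omega⟩
    · left; intro c hc; simp only [mem_cyclicIco'] at *; exact ⟨hz, by omega⟩
  · rintro _ ⟨y, rfl⟩ h
    simp only [mem_cyclicIco'] at *; exact ⟨h.1, by omega⟩
  · rintro _ ⟨y, rfl⟩; exact hlow.2 y
  · rintro _ ⟨y, rfl⟩
    rw [← hins2]; exact hup.2 y
  rw [hins3, hins3, hins1 u, hins1 v, hP, hQ]
  refine ⟨hmin.1, hmax.1, ?_, ?_, ?_, ?_⟩
  · rw [← hmin.2.2, Set.forall_mem_range]; rfl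
  · rw [← hmin.2.1, Set.forall_mem_range]; rfl
  · rw [← hmax.2.1, Set.forall_mem_range]; rfl
  · rw [← hmax.2.2, Set.forall_mem_range]; rfl

/-- The point counts satisfy the recursion of the R-polynomials at every position that is not a jump. -/
theorem pointCount_recursion [Finite F] {a : Fin n → Fin n} {i : Fin (n - 1)}
    (ha : a (lo i) = a (hi i)) {u v : Equiv.Perm (Fin n)} (huv : TiltedEquiv a u v)
    (hu : cyc (a (lo i)) (u (lo i)) < cyc (a (lo i)) (u (hi i)))
    (hv : cyc (a (lo i)) (v (lo i)) < cyc (a (lo i)) (v (hi i))) :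
    pointCount F a (u * simpleSwap i) (v * simpleSwap i) = pointCount F a u v ∧
    pointCount F a u (v * simpleSwap i) = ((Nat.card F : ℤ) - 1) * pointCount F a u v +
      (Nat.card F : ℤ) * pointCount F a (u * simpleSwap i) v := by
  let O : CompleteFlag F n → Prop := fun x => ∀ k, k ≠ lo i →
    HasMin (a k) (firstEntries u (k + 1)) (x.space k) ∧
      HasMax (a k) (firstEntries v (k + 1)) (x.space k)
  let P : CompleteFlag F n → Submodule F (Fin n → F) := fun x => x.lower (lo i) ⊔
    x.space (hi i) ⊓ vanishing F (cyclicIco (a (lo i)) (u (hi i)))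
  let Q : CompleteFlag F n → Submodule F (Fin n → F) := fun x => x.lower (lo i) ⊔
    x.space (hi i) ⊓ vanishing F (cyclicIco (v (hi i)) (a (lo i)))
  have key := exists_marked_points (F := F) ha huv hu hv O (fun _ => Iff.rfl) P Q (fun _ => rfl)
    (fun _ => rfl)
  have hmem : ∀ u' v' : Equiv.Perm (Fin n),
      (∀ k, k ≠ lo i → firstEntries u' (k + 1) = firstEntries u (k + 1)) →
      (∀ k, k ≠ lo i → firstEntries v' (k + 1) = firstEntries v (k + 1)) →
      ∀ x : CompleteFlag F n, x ∈ openTiltedRichardsonAt F a u' v' ↔ O x ∧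
        HasMin (a (lo i)) (firstEntries u' (lo i + 1)) (x.space (lo i)) ∧
        HasMax (a (lo i)) (firstEntries v' (lo i + 1)) (x.space (lo i)) := by
    intro u' v' h1 h2 x
    rw [mem_openTiltedRichardsonAt]
    refine ⟨fun h => ⟨fun k hk => ?_, h _⟩, fun h k => ?_⟩
    · rw [← h1 k hk, ← h2 k hk]; exact h k
    · by_cases hk : k = lo i
      · rw [hk]; exact h.2
      · rw [h1 k hk, h2 k hk]; exact h.1 k hk
  have hs : ∀ w : Equiv.Perm (Fin n), ∀ k, k ≠ lo i →
      firstEntries (w * simpleSwap i) (k + 1) = firstEntries w (k + 1) :=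
    fun w k hk => firstEntries_simpleSwap_of_ne hk
  have hlines := card_lines i O
    (fun x y h hx k hk => by rw [← h k hk]; exact hx k hk) P Q
    (fun x y h => by simp only [P]; rw [h.lower_eq, h.hi_eq])
    (fun x y h => by simp only [Q]; rw [h.lower_eq, h.hi_eq])
    (fun x hx => (key x hx).1) (fun x hx => (key x hx).2.1)
  have c1 : pointCount F a u v =
      Nat.card {x // O x ∧ x.space (lo i) ≠ P x ∧ x.space (lo i) = Q x} := by
    rw [pointCount]
    congr 1
    refine Nat.card_congr (Equiv.subtypeEquivRight fun x => ?_)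
    rw [hmem u v (fun _ _ => rfl) (fun _ _ => rfl)]
    refine and_congr_right fun hx => ?_
    obtain ⟨-, -, k1, k2, k3, k4⟩ := key x hx
    rw [k1, k3]
  have c2 : pointCount F a (u * simpleSwap i) (v * simpleSwap i) =
      Nat.card {x // O x ∧ x.space (lo i) = P x ∧ x.space (lo i) ≠ Q x} := by
    rw [pointCount]
    congr 1
    refine Nat.card_congr (Equiv.subtypeEquivRight fun x => ?_)
    rw [hmem _ _ (hs u) (hs v)]
    refine and_congr_right fun hx => ?_
    obtain ⟨-, -, k1, k2, k3, k4⟩ := key x hx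
    rw [k2, k4]
  have c3 : pointCount F a u (v * simpleSwap i) =
      Nat.card {x // O x ∧ x.space (lo i) ≠ P x ∧ x.space (lo i) ≠ Q x} := by
    rw [pointCount]
    congr 1
    refine Nat.card_congr (Equiv.subtypeEquivRight fun x => ?_)
    rw [hmem _ _ (fun _ _ => rfl) (hs v)]
    refine and_congr_right fun hx => ?_
    obtain ⟨-, -, k1, k2, k3, k4⟩ := key x hx
    rw [k1, k4]
  have c4 : pointCount F a (u * simpleSwap i) v =
      Nat.card {x // O x ∧ x.space (lo i) = P x ∧ x.space (lo i) = Q x} := by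
    rw [pointCount]
    congr 1
    refine Nat.card_congr (Equiv.subtypeEquivRight fun x => ?_)
    rw [hmem _ _ (hs u) (fun _ _ => rfl)]
    refine and_congr_right fun hx => ?_
    obtain ⟨-, -, k1, k2, k3, k4⟩ := key x hx
    rw [k2, k3]
  rw [c1, c2, c3, c4]
  exact ⟨congrArg _ hlines.1, hlines.2⟩

theorem finrank_vanishing (S : Finset (Fin n)) :
    Module.finrank F (vanishing F S) + S.card = n := by
  have h := LinearMap.finrank_range_add_finrank_ker
    (LinearMap.funLeft F F (Subtype.val : S → Fin n))
  rw [LinearMap.range_eq_top.2 (LinearMap.funLeft_surjective_of_injective _ _ _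
    Subtype.val_injective), finrank_top, Module.finrank_fintype_fun_eq_card,
    Module.finrank_fintype_fun_eq_card, Fintype.card_coe, Fintype.card_fin] at h
  rw [vanishing]
  omega

theorem rowRank_vanishing (S T : Finset (Fin n)) :
    rowRank S (vanishing F T) = (Tᶜ ∩ S).card := by
  have h := rowRank_add_finrank S (vanishing F T)
  have e : vanishing F T ⊓ vanishing F S = vanishing F (T ∪ S) := by
    ext x
    simp only [Submodule.mem_inf, mem_vanishing, Finset.mem_union]
    exact ⟨fun h i hi => hi.elim (h.1 i) (h.2 i),
      fun h => ⟨fun i hi => h i (.inl hi), fun i hi => h i (.inr hi)⟩⟩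
  rw [e] at h
  have h1 := finrank_vanishing (F := F) T
  have h2 := finrank_vanishing (F := F) (T ∪ S)
  have h3 : (T ∪ S).card = T.card + (Tᶜ ∩ S).card := by
    rw [← Finset.card_union_of_disjoint
      (disjoint_compl_right.mono_right Finset.inter_subset_left)]
    congr 1
    ext x
    by_cases hx : x ∈ T <;> simp [hx]
  omega

/-- The standard flag. -/
def standardFlag (F : Type*) [Field F] (n : ℕ) : CompleteFlag F n where
  space k := vanishing F (Finset.Ioi k)
  mono _ _ h := vanishing_anti (Finset.Ioi_subset_Ioi h)
  finrank_space k := by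
    have := finrank_vanishing (F := F) (Finset.Ioi k)
    rw [Fin.card_Ioi] at this
    omega

theorem firstEntries_one (k : Fin n) : firstEntries (1 : Equiv.Perm (Fin n)) (k + 1) =
    (Finset.Ioi k)ᶜ := by
  ext z
  rw [mem_firstEntries, Finset.mem_compl, Finset.mem_Ioi, not_lt, Fin.le_def, Nat.lt_succ_iff]
  rfl

/-- For the untilted order, the identity is the maximum only of the standard flag. -/
theorem pointCount_one {a : Fin n → Fin n} (ha : ∀ k, (a k : ℕ) = 0) (u : Equiv.Perm (Fin n)) :
    pointCount F a u 1 = if u = 1 then 1 else 0 := by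
  have hcyc : ∀ k x, cyc (a k) x = x := fun k x => by rw [cyc_eq, ha]; simp
  have hstd : ∀ x ∈ openTiltedRichardsonAt F a u 1, x = standardFlag F n := by
    intro x hx
    refine CompleteFlag.ext (funext fun k => ?_)
    have h1 := (mem_openTiltedRichardsonAt.1 hx k).2
    have h2 : rowRank (Finset.Ioi k) (x.space k) = 0 := by
      by_cases hk : (k : ℕ) + 1 < n
      · have h3 := h1 ⟨k + 1, hk⟩
        have e : cyclicIco ⟨k + 1, hk⟩ (a k) = Finset.Ioi k := by
          ext z
          rw [mem_cyclicIco', hcyc, hcyc, Finset.mem_Ioi, Fin.lt_def, ne_eq, Fin.ext_iff, ha]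
          simp only
          omega
        rw [e, firstEntries_one] at h3
        rw [h3, Finset.card_eq_zero]
        ext z
        simp
      · have e : Finset.Ioi k = ∅ := by
          ext z
          have := z.isLt
          simp only [Finset.mem_Ioi, Fin.lt_def, Finset.notMem_empty, iff_false]
          omega
        rw [e, rowRank_empty]
    have h3 := rowRank_add_finrank (Finset.Ioi k) (x.space k)
    have h4 : x.space k ⊓ vanishing F (Finset.Ioi k) = x.space k :=
      Submodule.eq_of_le_of_finrank_eq inf_le_left (by omega)
    refine Submodule.eq_of_le_of_finrank_eq (inf_eq_left.1 h4) ?_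
    rw [x.finrank_space]
    exact ((standardFlag F n).finrank_space k).symm
  have hmem : standardFlag F n ∈ openTiltedRichardsonAt F a u 1 ↔ u = 1 := by
    rw [mem_openTiltedRichardsonAt]
    constructor
    · intro h
      have h1 : ∀ k : Fin n, firstEntries u (k + 1) = (Finset.Ioi k)ᶜ := by
        intro k
        have h0 : firstEntries u (k + 1) ⊆ (Finset.Ioi k)ᶜ := by
          by_cases hk : (k : ℕ) + 1 < n
          · have h2 := (h k).1 ⟨k + 1, hk⟩
            have e : cyclicIco (a k) ⟨k + 1, hk⟩ = (Finset.Ioi k)ᶜ := by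
              ext z
              rw [mem_cyclicIco, hcyc, hcyc, Finset.mem_compl, Finset.mem_Ioi, Fin.lt_def]
              simp only
              omega
            rw [e] at h2
            have h3 : rowRank (Finset.Ioi k)ᶜ ((standardFlag F n).space k) =
                ((Finset.Ioi k)ᶜ ∩ (Finset.Ioi k)ᶜ).card := rowRank_vanishing _ _
            rw [h3, Finset.inter_self, Finset.card_compl, Fin.card_Ioi, Fintype.card_fin] at h2
            rw [← Finset.inter_eq_left]
            refine Finset.eq_of_subset_of_card_le Finset.inter_subset_left ?_
            rw [card_firstEntries u k.isLt]
            omega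
          · intro z _
            have := z.isLt
            simp only [Finset.mem_compl, Finset.mem_Ioi, Fin.lt_def]
            omega
        refine Finset.eq_of_subset_of_card_le h0 ?_
        rw [card_firstEntries u k.isLt, Finset.card_compl, Fin.card_Ioi, Fintype.card_fin]
        omega
      have h2 : ∀ k z : Fin n, u.symm z ≤ k ↔ z ≤ k := by
        intro k z
        have h3 : z ∈ firstEntries u (k + 1) ↔ z ∈ (Finset.Ioi k)ᶜ := by rw [h1]
        rw [mem_firstEntries, Finset.mem_compl, Finset.mem_Ioi, not_lt, Nat.lt_succ_iff] at h3
        exact h3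
      have h3 : ∀ z, u.symm z = z := fun z =>
        le_antisymm ((h2 z z).2 le_rfl) ((h2 _ z).1 le_rfl)
      exact Equiv.ext fun z => by rw [← h3 (u z)]; simp
    · rintro rfl k
      rw [firstEntries_one]
      exact ⟨fun i => rowRank_vanishing _ _, fun i => rowRank_vanishing _ _⟩
  rw [pointCount]
  by_cases hu : u = 1
  · have : openTiltedRichardsonAt F a u 1 = {standardFlag F n} :=
      Set.eq_singleton_iff_unique_mem.2 ⟨hmem.2 hu, hstd⟩
    rw [this, if_pos hu]
    simp
  · have : openTiltedRichardsonAt F a u 1 = ∅ :=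
      Set.eq_empty_of_forall_notMem fun x hx => hu (hmem.1 (hstd x hx ▸ hx))
    rw [this, if_neg hu]
    simp

end Points

/-! ### The standard basis of the Hecke algebra -/

section StandardBasis

variable {n : ℕ}

theorem wordProd_append_singleton (l : List (Fin (n - 1))) (i : Fin (n - 1)) :
    wordProd (l ++ [i]) = wordProd l * simpleSwap i := by simp [wordProd]

/-- A permutation that increases along adjacent positions of a range increases on the range. -/
theorem apply_lt_of_adjacent {α : Type*} [Preorder α] {f : Fin n → α} {m : ℕ}
    (h : ∀ i : Fin (n - 1), (hi i : ℕ) < m → f (lo i) < f (hi i)) {p q : Fin n} (hpq : p < q)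
    (hq : (q : ℕ) < m) : f p < f q := by
  obtain ⟨q, hq'⟩ := q
  induction q with
  | zero => exact absurd hpq (by simp [Fin.lt_def])
  | succ q ih =>
    have h1 : f ⟨q, by omega⟩ < f ⟨q + 1, hq'⟩ := h ⟨q, by omega⟩ hq
    rcases (Nat.lt_succ_iff.1 hpq).lt_or_eq with h2 | h2
    · exact (ih (by omega) h2 (by simp only at hq ⊢; omega)).trans h1
    · have : p = ⟨q, by omega⟩ := Fin.ext h2
      rw [this]; exact h1

theorem eq_one_of_increasing {w : Equiv.Perm (Fin n)} (h : ∀ i, w (lo i) < w (hi i)) : w = 1 := by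
  have hm : StrictMono w := fun p q hpq => apply_lt_of_adjacent (m := n) (fun i _ => h i) hpq q.isLt
  ext i : 1
  have := Subsingleton.elim (hm.orderIsoOfSurjective _ w.surjective) (OrderIso.refl (Fin n))
  exact congrArg (fun e : Fin n ≃o Fin n => e i) this

theorem exists_descent {w : Equiv.Perm (Fin n)} (h : w ≠ 1) : ∃ i, w (hi i) < w (lo i) := by
  by_contra! hc
  exact h (eq_one_of_increasing fun i => lt_of_le_of_ne (hc i) (w.injective.ne (lo_ne_hi i)))

theorem permLength_one : permLength (1 : Equiv.Perm (Fin n)) = 0 := by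
  have := permLength_wordProd_le ([] : List (Fin (n - 1)))
  simpa [wordProd] using this

theorem permLength_mul_of_descent {w : Equiv.Perm (Fin n)} {i : Fin (n - 1)}
    (h : w (hi i) < w (lo i)) : permLength (w * simpleSwap i) + 1 = permLength w :=
  permLength_mul_of_gt w i h.not_gt

theorem exists_reduced (w : Equiv.Perm (Fin n)) :
    ∃ l : List (Fin (n - 1)), wordProd l = w ∧ l.length = permLength w := by
  induction hN : permLength w generalizing w with
  | zero =>
    refine ⟨[], ?_, rfl⟩
    by_contra h
    obtain ⟨i, hi⟩ := exists_descent (w := w) fun h' => h (by rw [h']; rfl)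
    have := permLength_mul_of_descent hi
    omega
  | succ N ih =>
    obtain ⟨i, hi⟩ := exists_descent (w := w) (by rintro rfl; rw [permLength_one] at hN; omega)
    have := permLength_mul_of_descent hi
    obtain ⟨l, h1, h2⟩ := ih (w * simpleSwap i) (by omega)
    exact ⟨l ++ [i], by rw [wordProd_append_singleton, h1, simpleSwap_mul_self], by simp [h2]⟩

theorem simpleSwap_sq (i : Fin (n - 1)) : simpleSwap i * simpleSwap i = 1 := Equiv.swap_mul_self _ _

variable (b : ℤ[T;T⁻¹])

theorem heckeGen_comm {i j : Fin (n - 1)} (h : (i : ℕ) + 1 < j) :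
    heckeGen b i * heckeGen b j = heckeGen b j * heckeGen b i := by
  have h := RingQuot.mkAlgHom_rel ℤ[T;T⁻¹] (HeckeRel.comm (b := b) i j h)
  rw [map_mul, map_mul] at h
  exact h

theorem heckeGen_braid {i j : Fin (n - 1)} (h : (i : ℕ) + 1 = j) :
    heckeGen b i * heckeGen b j * heckeGen b i = heckeGen b j * heckeGen b i * heckeGen b j := by
  have h := RingQuot.mkAlgHom_rel ℤ[T;T⁻¹] (HeckeRel.braid (b := b) i j h)
  rw [map_mul, map_mul, map_mul, map_mul] at h
  exact h

/-- Matsumoto's theorem: the product of generators along a reduced word depends only on the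
permutation. -/
theorem heckeGen_prod_eq {l l' : List (Fin (n - 1))} (h : wordProd l = wordProd l')
    (hl : l.length = permLength (wordProd l)) (hl' : l'.length = permLength (wordProd l')) :
    (l.map (heckeGen b)).prod = (l'.map (heckeGen b)).prod := by
  induction hN : l.length using Nat.strong_induction_on generalizing l l' with
  | _ N ih =>
  rcases List.eq_nil_or_concat' l with rfl | ⟨l₁, i, rfl⟩
  · have : l' = [] := List.eq_nil_of_length_eq_zero (by rw [hl', ← h, ← hl]; rfl)
    rw [this]
  rcases List.eq_nil_or_concat' l' with rfl | ⟨l₂, j, rfl⟩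
  · rw [h, ← hl'] at hl; simp at hl
  set w := wordProd (l₁ ++ [i]) with hw
  have e1 : wordProd l₁ = w * simpleSwap i := by
    rw [hw, wordProd_append_singleton, simpleSwap_mul_self]
  have e2 : wordProd l₂ = w * simpleSwap j := by
    rw [h, wordProd_append_singleton, simpleSwap_mul_self]
  rw [← h] at hl'
  rw [List.length_append, List.length_singleton] at hl hl' hN
  have hdesc : ∀ (k : Fin (n - 1)) (m : List (Fin (n - 1))), wordProd m = w * simpleSwap k →
      m.length + 1 = permLength w → w (hi k) < w (lo k) := by
    intro k m hm hlen
    by_contra hc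
    have h1 := permLength_mul_of_lt w k
      (lt_of_le_of_ne (not_lt.1 hc) (w.injective.ne (lo_ne_hi k)))
    have h2 := permLength_wordProd_le m
    rw [hm, h1] at h2
    omega
  have di := hdesc i l₁ e1 hl
  have dj := hdesc j l₂ e2 hl'
  have li := permLength_mul_of_descent di
  have lj := permLength_mul_of_descent dj
  simp only [List.map_append, List.prod_append, List.map_singleton, List.prod_singleton]
  -- compare with words ending in the longest word of the subgroup generated by `s_i` and `s_j`
  have hfar : ∀ i j : Fin (n - 1), (i : ℕ) + 1 < j → ∀ l₁ l₂ : List (Fin (n - 1)),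
      l₁.length + 1 = permLength w → l₂.length + 1 = permLength w →
      wordProd l₁ = w * simpleSwap i → wordProd l₂ = w * simpleSwap j →
      w (hi i) < w (lo i) → w (hi j) < w (lo j) → N = permLength w →
      (l₁.map (heckeGen b)).prod * heckeGen b i = (l₂.map (heckeGen b)).prod * heckeGen b j := by
    intro i j hij l₁ l₂ hl₁ hl₂ e1 e2 di dj hNw
    have li := permLength_mul_of_descent di
    have lj := permLength_mul_of_descent dj
    have hd : (w * simpleSwap i) (hi j) < (w * simpleSwap i) (lo j) := by
      rw [mul_simpleSwap_of_ne, mul_simpleSwap_of_ne]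
      · exact dj
      all_goals simp only [lo, hi, ne_eq, Fin.mk.injEq]; omega
    have lij := permLength_mul_of_descent hd
    have hc : simpleSwap i * simpleSwap j = simpleSwap j * simpleSwap i := by
      refine Equiv.Perm.Disjoint.commute ?_
      intro x
      by_cases hx : x = lo i ∨ x = hi i
      · right
        refine Equiv.swap_apply_of_ne_of_ne ?_ ?_ <;> rcases hx with rfl | rfl <;>
          simp only [lo, hi, ne_eq, Fin.mk.injEq] <;> omega
      · rw [not_or] at hx
        exact Or.inl (Equiv.swap_apply_of_ne_of_ne hx.1 hx.2)
    obtain ⟨m, hm, hmlen⟩ := exists_reduced (w * simpleSwap i * simpleSwap j)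
    have f1 : wordProd (m ++ [j]) = w * simpleSwap i := by
      rw [wordProd_append_singleton, hm, simpleSwap_mul_self]
    have f2 : wordProd (m ++ [i]) = w * simpleSwap j := by
      rw [wordProd_append_singleton, hm, mul_assoc w, hc, ← mul_assoc, simpleSwap_mul_self]
    have g1 := ih l₁.length (by omega) (l := l₁) (l' := m ++ [j]) (by rw [e1, f1])
      (by rw [e1]; omega) (by rw [f1, List.length_append, List.length_singleton]; omega) rfl
    have g2 := ih l₂.length (by omega) (l := l₂) (l' := m ++ [i]) (by rw [e2, f2])
      (by rw [e2]; omega) (by rw [f2, List.length_append, List.length_singleton]; omega) rfl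
    rw [g1, g2]
    simp only [List.map_append, List.prod_append, List.map_singleton, List.prod_singleton]
    rw [mul_assoc, mul_assoc, heckeGen_comm b hij]
  have hnear : ∀ i j : Fin (n - 1), (i : ℕ) + 1 = j → ∀ l₁ l₂ : List (Fin (n - 1)),
      l₁.length + 1 = permLength w → l₂.length + 1 = permLength w →
      wordProd l₁ = w * simpleSwap i → wordProd l₂ = w * simpleSwap j →
      w (hi i) < w (lo i) → w (hi j) < w (lo j) → N = permLength w →
      (l₁.map (heckeGen b)).prod * heckeGen b i = (l₂.map (heckeGen b)).prod * heckeGen b j := by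
    intro i j hij l₁ l₂ hl₁ hl₂ e1 e2 di dj hNw
    have li := permLength_mul_of_descent di
    have lj := permLength_mul_of_descent dj
    have hj : lo j = hi i := by simp only [lo, hi, Fin.mk.injEq]; omega
    have a1 : hi j ≠ lo i := by simp only [lo, hi, ne_eq, Fin.mk.injEq]; omega
    have a2 : hi j ≠ hi i := by simp only [hi, ne_eq, Fin.mk.injEq]; omega
    have a3 := lo_ne_hi i
    have i1 (g : Equiv.Perm (Fin n)) : (g * simpleSwap i) (hi j) = g (hi j) :=
      mul_simpleSwap_of_ne g a1 a2
    have i2 (g : Equiv.Perm (Fin n)) : (g * simpleSwap i) (lo j) = g (lo i) := by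
      rw [hj, mul_simpleSwap_hi]
    have j1 (g : Equiv.Perm (Fin n)) : (g * simpleSwap j) (lo i) = g (lo i) :=
      mul_simpleSwap_of_ne g (by rw [hj]; exact a3) a1.symm
    have j2 (g : Equiv.Perm (Fin n)) : (g * simpleSwap j) (hi i) = g (hi j) := by
      rw [← hj, mul_simpleSwap_lo]
    rw [hj] at dj
    have hd1 : (w * simpleSwap i) (hi j) < (w * simpleSwap i) (lo j) := by
      rw [i1, i2]; exact dj.trans di
    have hd2 : (w * simpleSwap i * simpleSwap j) (hi i) < (w * simpleSwap i * simpleSwap j) (lo i) := by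
      rw [j1, j2, mul_simpleSwap_lo, i1]; exact dj
    have l2 := permLength_mul_of_descent hd1
    have l3 := permLength_mul_of_descent hd2
    have hs : simpleSwap i * simpleSwap j * simpleSwap i =
        simpleSwap j * simpleSwap i * simpleSwap j := by
      have n1 : lo i ≠ hi j := a1.symm
      have n2 : hi i ≠ hi j := a2.symm
      have h1 : simpleSwap i * simpleSwap j * simpleSwap i = Equiv.swap (lo i) (hi j) := by
        rw [simpleSwap, simpleSwap, hj, Equiv.swap_comm (lo i), Equiv.swap_comm (hi i) (hi j)]
        exact Equiv.swap_mul_swap_mul_swap a2 a1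
      have h2 : simpleSwap j * simpleSwap i * simpleSwap j = Equiv.swap (lo i) (hi j) := by
        rw [simpleSwap, simpleSwap, hj, Equiv.swap_comm (lo i) (hi j)]
        exact Equiv.swap_mul_swap_mul_swap a3 n1
      rw [h1, h2]
    obtain ⟨m, hm, hmlen⟩ := exists_reduced (w * simpleSwap i * simpleSwap j * simpleSwap i)
    have f1 : wordProd (m ++ [i] ++ [j]) = w * simpleSwap i := by
      rw [wordProd_append_singleton, wordProd_append_singleton, hm, simpleSwap_mul_self,
        simpleSwap_mul_self]
    have f2 : wordProd (m ++ [j] ++ [i]) = w * simpleSwap j := by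
      have hm' : wordProd m = w * simpleSwap j * simpleSwap i * simpleSwap j := by
        rw [hm, mul_assoc w, mul_assoc w, hs]; simp only [mul_assoc]
      rw [wordProd_append_singleton, wordProd_append_singleton, hm', simpleSwap_mul_self,
        simpleSwap_mul_self]
    have g1 := ih l₁.length (by omega) (l := l₁) (l' := m ++ [i] ++ [j]) (by rw [e1, f1])
      (by rw [e1]; omega) (by rw [f1]; simp only [List.length_append, List.length_singleton]; omega)
      rfl
    have g2 := ih l₂.length (by omega) (l := l₂) (l' := m ++ [j] ++ [i]) (by rw [e2, f2])
      (by rw [e2]; omega) (by rw [f2]; simp only [List.length_append, List.length_singleton]; omega)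
      rfl
    rw [g1, g2]
    simp only [List.map_append, List.prod_append, List.map_singleton, List.prod_singleton]
    have := heckeGen_braid b hij
    simp only [mul_assoc] at this ⊢
    rw [this]
  rcases lt_trichotomy (i : ℕ) j with hij | hij | hij
  · rcases (Nat.succ_le_of_lt hij).lt_or_eq with h1 | h1
    · exact hfar i j h1 l₁ l₂ hl hl' e1 e2 di dj (by omega)
    · exact hnear i j h1 l₁ l₂ hl hl' e1 e2 di dj (by omega)
  · have hij' : i = j := Fin.ext hij
    subst hij'
    rw [ih l₁.length (by omega) (l := l₁) (l' := l₂) (by rw [e1, e2]) (by rw [e1]; omega)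
      (by rw [e2]; omega) rfl]
  · rcases (Nat.succ_le_of_lt hij).lt_or_eq with h1 | h1
    · exact (hfar j i h1 l₂ l₁ hl' hl e2 e1 dj di (by omega)).symm
    · exact (hnear j i h1 l₂ l₁ hl' hl e2 e1 dj di (by omega)).symm

/-- The standard basis element `T_w`. -/
noncomputable def heckeT (w : Equiv.Perm (Fin n)) : HeckeAlgebra n b :=
  ((exists_reduced w).choose.map (heckeGen b)).prod

theorem heckeT_eq {l : List (Fin (n - 1))} (hl : l.length = permLength (wordProd l)) :
    heckeT b (wordProd l) = (l.map (heckeGen b)).prod := by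
  obtain ⟨h1, h2⟩ := (exists_reduced (wordProd l)).choose_spec
  exact heckeGen_prod_eq b h1 (by rw [h1, h2]) hl

theorem heckeT_one : heckeT b (1 : Equiv.Perm (Fin n)) = 1 :=
  heckeT_eq b (l := []) (by rw [wordProd, List.map_nil, List.prod_nil, permLength_one]; rfl)

theorem heckeT_mul_simpleSwap {w : Equiv.Perm (Fin n)} {i : Fin (n - 1)}
    (h : w (lo i) < w (hi i)) : heckeT b (w * simpleSwap i) = heckeT b w * heckeGen b i := by
  obtain ⟨l, rfl, hl⟩ := exists_reduced w
  rw [heckeT_eq b hl, ← wordProd_append_singleton, heckeT_eq]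
  · simp
  · rw [wordProd_append_singleton, permLength_mul_of_lt _ _ h, ← hl]; simp

theorem heckeT_simpleSwap (i : Fin (n - 1)) : heckeT b (simpleSwap i) = heckeGen b i := by
  have := heckeT_mul_simpleSwap b (w := 1) (i := i) (lo_lt_hi i)
  rwa [one_mul, heckeT_one, one_mul] at this

theorem heckeT_mul_gen_of_descent {w : Equiv.Perm (Fin n)} {i : Fin (n - 1)}
    (h : w (hi i) < w (lo i)) : heckeT b w * heckeGen b i =
      b • heckeT b w + qq • heckeT b (w * simpleSwap i) := by
  have h1 : heckeT b w = heckeT b (w * simpleSwap i) * heckeGen b i := by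
    rw [← heckeT_mul_simpleSwap, simpleSwap_mul_self]
    rwa [mul_simpleSwap_lo, mul_simpleSwap_hi]
  conv_lhs => rw [h1, mul_assoc, heckeGen_sq, mul_add, mul_smul_comm, ← h1, ← Algebra.commutes,
    ← Algebra.smul_def]

/-- If right multiplication by `s_i` lengthens `y`, the inversions of `y` are among those of
`y s_i`, up to `s_i`. -/
theorem inversion_mul_simpleSwap {y : Equiv.Perm (Fin n)} {i : Fin (n - 1)}
    (hy : y (lo i) < y (hi i)) {p q : Fin n} (hpq : p < q) (h : y q < y p) :
    simpleSwap i p < simpleSwap i q ∧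
      (y * simpleSwap i) (simpleSwap i q) < (y * simpleSwap i) (simpleSwap i p) := by
  refine ⟨?_, by simpa [simpleSwap] using h⟩
  have h1 : ((hi i : Fin n) : ℕ) = lo i + 1 := rfl
  have hne : ¬ (p = lo i ∧ q = hi i) := by
    rintro ⟨rfl, rfl⟩
    exact h.not_gt hy
  rw [simpleSwap, Equiv.swap_apply_def, Equiv.swap_apply_def]
  simp only [Fin.lt_def, Fin.ext_iff] at hpq hne ⊢
  split_ifs <;> omega

theorem simpleSwap_le_lo {i k : Fin (n - 1)} (hki : k ≠ i) :
    (∀ p, p ≤ lo k → simpleSwap i p ≤ lo k) ∧ (∀ q, hi k ≤ q → hi k ≤ simpleSwap i q) := by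
  have h : (k : ℕ) ≠ i := fun h => hki (Fin.ext h)
  have e1 : ((lo k : Fin n) : ℕ) = k := rfl
  have e2 : ((lo i : Fin n) : ℕ) = i := rfl
  have e3 : ((hi k : Fin n) : ℕ) = k + 1 := rfl
  have e4 : ((hi i : Fin n) : ℕ) = i + 1 := rfl
  constructor <;> intro p hp <;> rw [simpleSwap, Equiv.swap_apply_def] <;>
    simp only [Fin.le_def, Fin.ext_iff] at * <;> split_ifs <;> omega

/-- `T_{gy} = T_g T_y` if the lengths add, which is expressed through the inversions of `y`; the same
holds for any function on permutations that is compatible with lengthening, for an order on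
the values of `g`. -/
theorem mul_heckeT_of_inversions {α : Type*} [Preorder α] {f : Equiv.Perm (Fin n) → HeckeAlgebra n b}
    {κ : Fin n → α} {J : Set (Fin (n - 1))}
    (hf : ∀ w i, i ∈ J → κ (w (lo i)) < κ (w (hi i)) →
      f (w * simpleSwap i) = f w * heckeGen b i)
    {g y : Equiv.Perm (Fin n)} (hJ : ∀ i, (∃ p q, p ≤ lo i ∧ hi i ≤ q ∧ y q < y p) → i ∈ J)
    (h : ∀ p q, p < q → y q < y p → κ (g (y q)) < κ (g (y p))) :
    f (g * y) = f g * heckeT b y := by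
  induction hN : permLength y using Nat.strong_induction_on generalizing y with
  | _ N ih =>
  by_cases hy : y = 1
  · rw [hy, heckeT_one, mul_one, mul_one]
  obtain ⟨i, hi'⟩ := exists_descent hy
  have hup : (y * simpleSwap i) (lo i) < (y * simpleSwap i) (hi i) := by
    rwa [mul_simpleSwap_lo, mul_simpleSwap_hi]
  have hinv := fun {p q : Fin n} (hpq : p < q)
      (h' : (y * simpleSwap i) q < (y * simpleSwap i) p) => by
    have := inversion_mul_simpleSwap hup hpq h'
    rwa [simpleSwap_mul_self] at this
  have key : f (g * (y * simpleSwap i)) = f g * heckeT b (y * simpleSwap i) := by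
    refine ih _ ?_ ?_ ?_ rfl
    · have := permLength_mul_of_descent hi'
      omega
    · rintro k ⟨p, q, hp, hq, hpq⟩
      obtain ⟨h1, h2⟩ := hinv (lt_of_le_of_lt hp ((lo_lt_hi k).trans_le hq)) hpq
      refine hJ k ?_
      by_cases hki : k = i
      · exact ⟨lo i, hi i, by rw [hki], by rw [hki], hi'⟩
      · refine ⟨simpleSwap i p, simpleSwap i q, ?_, ?_, h2⟩
        · exact (simpleSwap_le_lo hki).1 p hp
        · exact (simpleSwap_le_lo hki).2 q hq
    · intro p q hpq h'
      obtain ⟨h1, h2⟩ := hinv hpq h'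
      exact h _ _ h1 h2
  have e : g * y = g * (y * simpleSwap i) * simpleSwap i := by
    rw [← mul_assoc, simpleSwap_mul_self]
  rw [e, hf _ i (hJ i ⟨_, _, le_rfl, le_rfl, hi'⟩), key, mul_assoc, ← heckeT_mul_simpleSwap b hup,
    simpleSwap_mul_self]
  have e1 : (g * (y * simpleSwap i)) (lo i) = g (y (hi i)) := by
    rw [Equiv.Perm.mul_apply, mul_simpleSwap_lo]
  have e2 : (g * (y * simpleSwap i)) (hi i) = g (y (lo i)) := by
    rw [Equiv.Perm.mul_apply, mul_simpleSwap_hi]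
  rw [e1, e2]
  exact h _ _ (lo_lt_hi i) hi'

theorem heckeT_mul_of_inversions {g y : Equiv.Perm (Fin n)}
    (h : ∀ p q, p < q → y q < y p → g (y q) < g (y p)) :
    heckeT b (g * y) = heckeT b g * heckeT b y :=
  mul_heckeT_of_inversions b (κ := id) (J := Set.univ)
    (fun _ _ _ h => heckeT_mul_simpleSwap b h) (fun _ _ => Set.mem_univ _) h

theorem heckeT_simpleSwap_mul {y : Equiv.Perm (Fin n)} {i : Fin (n - 1)}
    (h : y⁻¹ (lo i) < y⁻¹ (hi i)) : heckeT b (simpleSwap i * y) = heckeGen b i * heckeT b y := by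
  rw [heckeT_mul_of_inversions, heckeT_simpleSwap]
  intro p q hpq hy
  have h1 : ((hi i : Fin n) : ℕ) = lo i + 1 := rfl
  have hne : ¬ (y q = lo i ∧ y p = hi i) := by
    rintro ⟨h1, h2⟩
    rw [← h1, ← h2] at h
    exact h.not_gt (by simpa using hpq)
  rw [simpleSwap, Equiv.swap_apply_def, Equiv.swap_apply_def]
  simp only [Fin.lt_def, Fin.ext_iff] at hy hne ⊢
  split_ifs <;> omega

theorem gen_mul_heckeT_of_descent {y : Equiv.Perm (Fin n)} {i : Fin (n - 1)}
    (h : y⁻¹ (hi i) < y⁻¹ (lo i)) : heckeGen b i * heckeT b y =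
      b • heckeT b y + qq • heckeT b (simpleSwap i * y) := by
  have h0 : simpleSwap i * (simpleSwap i * y) = y := by
    rw [← mul_assoc, simpleSwap_sq, one_mul]
  have h1 : heckeT b y = heckeGen b i * heckeT b (simpleSwap i * y) := by
    rw [← heckeT_simpleSwap_mul, h0]
    simpa [simpleSwap, mul_inv_rev] using h
  conv_lhs => rw [h1, ← mul_assoc, heckeGen_sq, add_mul, smul_mul_assoc, ← h1, ← Algebra.smul_def]

theorem heckeAlgebra_induction {C : HeckeAlgebra n b → Prop} (halg : ∀ r, C (algebraMap ℤ[T;T⁻¹] _ r))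
    (hgen : ∀ i, C (heckeGen b i)) (hmul : ∀ x y, C x → C y → C (x * y))
    (hadd : ∀ x y, C x → C y → C (x + y)) (x : HeckeAlgebra n b) : C x := by
  obtain ⟨x, rfl⟩ := RingQuot.mkAlgHom_surjective ℤ[T;T⁻¹] (HeckeRel n b) x
  induction x using FreeAlgebra.induction with
  | grade0 r => rw [AlgHom.commutes]; exact halg r
  | grade1 i => exact hgen i
  | mul x y hx hy => rw [map_mul]; exact hmul _ _ hx hy
  | add x y hx hy => rw [map_add]; exact hadd _ _ hx hy

/-- A span of standard basis elements that is closed under lengthening and shortening by `s_i`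
is stable under right multiplication by `T_i`. -/
theorem mul_gen_mem_span {A : Set (Equiv.Perm (Fin n))} {i : Fin (n - 1)}
    (hA : ∀ w ∈ A, w * simpleSwap i ∈ A) {h : HeckeAlgebra n b}
    (hh : h ∈ Submodule.span ℤ[T;T⁻¹] (heckeT b '' A)) :
    h * heckeGen b i ∈ Submodule.span ℤ[T;T⁻¹] (heckeT b '' A) := by
  induction hh using Submodule.span_induction with
  | mem x hx =>
    obtain ⟨w, hw, rfl⟩ := hx
    have h1 := Submodule.subset_span (R := ℤ[T;T⁻¹]) (Set.mem_image_of_mem (heckeT b) (hA w hw))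
    have h2 := Submodule.subset_span (R := ℤ[T;T⁻¹]) (Set.mem_image_of_mem (heckeT b) hw)
    rcases lt_or_gt_of_ne (w.injective.ne (lo_ne_hi i)) with h | h
    · rwa [← heckeT_mul_simpleSwap b h]
    · rw [heckeT_mul_gen_of_descent b h]
      exact Submodule.add_mem _ (Submodule.smul_mem _ _ h2) (Submodule.smul_mem _ _ h1)
  | zero => rw [zero_mul]; exact Submodule.zero_mem _
  | add x y _ _ hx hy => rw [add_mul]; exact Submodule.add_mem _ hx hy
  | smul c x _ hx => rw [smul_mul_assoc]; exact Submodule.smul_mem _ _ hx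

theorem mem_span_heckeT (h : HeckeAlgebra n b) :
    h ∈ Submodule.span ℤ[T;T⁻¹] (Set.range (heckeT b)) := by
  suffices H : ∀ m ∈ Submodule.span ℤ[T;T⁻¹] (heckeT b '' Set.univ),
      m * h ∈ Submodule.span ℤ[T;T⁻¹] (heckeT b '' Set.univ) by
    have := H 1 (Submodule.subset_span ⟨1, trivial, heckeT_one b⟩)
    rwa [one_mul, Set.image_univ] at this
  induction h using heckeAlgebra_induction with
  | halg r =>
    intro m hm
    rw [← Algebra.commutes, ← Algebra.smul_def]
    exact Submodule.smul_mem _ _ hm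
  | hgen i => exact fun m hm => mul_gen_mem_span b (A := Set.univ) (fun _ _ => Set.mem_univ _) hm
  | hmul x y hx hy => intro m hm; rw [← mul_assoc]; exact hy _ (hx _ hm)
  | hadd x y hx hy => intro m hm; rw [mul_add]; exact Submodule.add_mem _ (hx _ hm) (hy _ hm)

/-! ### The trace -/

theorem heckeTrace_heckeT (w : Equiv.Perm (Fin n)) :
    heckeTrace b (heckeT b w) = if w = 1 then 1 else 0 := by
  obtain ⟨l, rfl, hl⟩ := exists_reduced w
  rw [heckeT_eq b hl, heckeTrace_reduced b l hl]

/-- `ε` is a trace. -/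
theorem heckeTrace_mul_comm (h k : HeckeAlgebra n b) :
    heckeTrace b (h * k) = heckeTrace b (k * h) := by
  induction k using heckeAlgebra_induction generalizing h with
  | halg r => rw [Algebra.commutes]
  | hmul x y hx hy => rw [← mul_assoc, hy, ← mul_assoc, hx, mul_assoc]
  | hadd x y hx hy => rw [mul_add, add_mul, map_add, map_add, hx, hy]
  | hgen i =>
    have := mem_span_heckeT b h
    induction this using Submodule.span_induction with
    | zero => simp
    | add x y _ _ hx hy => rw [add_mul, mul_add, map_add, map_add, hx, hy]
    | smul c x _ hx => rw [smul_mul_assoc, mul_smul_comm, map_smul, map_smul, hx]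
    | mem x hx =>
      obtain ⟨w, rfl⟩ := hx
      have hcomm : w * simpleSwap i = 1 ↔ simpleSwap i * w = 1 := mul_eq_one_comm
      have hinv : simpleSwap i * w = 1 → w = simpleSwap i := fun h => by
        rw [mul_eq_one_iff_eq_inv'] at h
        rw [h, simpleSwap, Equiv.swap_inv]
      have hs : (simpleSwap i : Equiv.Perm (Fin n)) (hi i) < (simpleSwap i : Equiv.Perm (Fin n)) (lo i) := by
        simpa [simpleSwap] using lo_lt_hi i
      have hs' : (simpleSwap i : Equiv.Perm (Fin n))⁻¹ = simpleSwap i := Equiv.swap_inv _ _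
      have hl : heckeTrace b (heckeT b w * heckeGen b i) =
          if w = simpleSwap i then qq else 0 := by
        rcases lt_or_gt_of_ne (w.injective.ne (lo_ne_hi i)) with h | h
        · rw [← heckeT_mul_simpleSwap b h, heckeTrace_heckeT, if_neg, if_neg]
          · rintro rfl; exact h.not_gt hs
          · intro h'; rw [hinv (hcomm.1 h')] at h; exact h.not_gt hs
        · rw [heckeT_mul_gen_of_descent b h, map_add, map_smul, map_smul, heckeTrace_heckeT,
            heckeTrace_heckeT, if_neg (by rintro rfl; exact h.not_gt (lo_lt_hi i)), smul_zero, zero_add]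
          by_cases hw : w = simpleSwap i
          · rw [if_pos hw, if_pos (by rw [hw, simpleSwap_sq]), smul_eq_mul, mul_one]
          · rw [if_neg hw, if_neg (fun h => hw (hinv (hcomm.1 h))), smul_zero]
      have hr : heckeTrace b (heckeGen b i * heckeT b w) =
          if w = simpleSwap i then qq else 0 := by
        rcases lt_or_gt_of_ne (w⁻¹.injective.ne (lo_ne_hi i)) with h | h
        · rw [← heckeT_simpleSwap_mul b h, heckeTrace_heckeT, if_neg, if_neg]
          · rintro rfl; rw [hs'] at h; exact h.not_gt hs
          · intro h'; rw [hinv h', hs'] at h; exact h.not_gt hs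
        · rw [gen_mul_heckeT_of_descent b h, map_add, map_smul, map_smul, heckeTrace_heckeT,
            heckeTrace_heckeT, if_neg (by rintro rfl; exact h.not_gt (lo_lt_hi i)), smul_zero, zero_add]
          by_cases hw : w = simpleSwap i
          · rw [if_pos hw, if_pos (by rw [hw, simpleSwap_sq]), smul_eq_mul, mul_one]
          · rw [if_neg hw, if_neg (fun h => hw (hinv h)), smul_zero]
      rw [hl, hr]

/-- The dual basis of `T_x` is `q^{-ℓ(x)} T_{x⁻¹}`. -/
theorem heckeTrace_mul_heckeT (x y : Equiv.Perm (Fin n)) :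
    heckeTrace b (heckeT b x * heckeT b y) = if x * y = 1 then qq ^ permLength y else 0 := by
  induction hN : permLength y generalizing x y with
  | zero =>
    have hy : y = 1 := by
      by_contra hy
      obtain ⟨i, hi'⟩ := exists_descent hy
      have := permLength_mul_of_descent hi'
      omega
    rw [hy, heckeT_one, mul_one, mul_one, heckeTrace_heckeT, pow_zero]
  | succ N ih =>
    obtain ⟨i, hi'⟩ := exists_descent (w := y) (by rintro rfl; rw [permLength_one] at hN; omega)
    have hlen := permLength_mul_of_descent hi'
    obtain ⟨y', rfl⟩ : ∃ y', y = y' * simpleSwap i :=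
      ⟨y * simpleSwap i, (simpleSwap_mul_self _ _).symm⟩
    rw [mul_simpleSwap_lo, mul_simpleSwap_hi] at hi'
    rw [simpleSwap_mul_self] at hlen
    rw [heckeT_mul_simpleSwap b hi', ← mul_assoc, heckeTrace_mul_comm, ← mul_assoc]
    have hiff : x * (y' * simpleSwap i) = 1 ↔ simpleSwap i * x * y' = 1 := by
      rw [← mul_assoc, mul_eq_one_comm, mul_assoc]
    simp only [hiff]
    rcases lt_or_gt_of_ne (x⁻¹.injective.ne (lo_ne_hi i)) with h | h
    · rw [← heckeT_simpleSwap_mul b h, ih _ _ (by omega)]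
      have hne : simpleSwap i * x * y' ≠ 1 := by
        intro h'
        rw [mul_eq_one_iff_inv_eq, mul_inv_rev] at h'
        rw [← h'] at hi'
        simp only [simpleSwap, Equiv.swap_inv, Equiv.Perm.mul_apply, Equiv.swap_apply_left,
          Equiv.swap_apply_right] at hi'
        exact hi'.not_gt h
      rw [if_neg hne, if_neg hne]
    · rw [gen_mul_heckeT_of_descent b h, add_mul, smul_mul_assoc, smul_mul_assoc, map_add, map_smul,
        map_smul, ih _ _ (by omega), ih _ _ (by omega), if_neg, smul_zero, zero_add]
      · split_ifs
        · rw [smul_eq_mul, pow_succ']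
        · rw [smul_zero]
      · intro h'
        rw [mul_eq_one_iff_inv_eq] at h'
        rw [← h'] at hi'
        exact hi'.not_gt h

theorem isUnit_qq : IsUnit qq := LaurentPolynomial.isUnit_T 1

/-- An element of the span of the `T_w`, `w ∈ A`, that is orthogonal to all `T_{w⁻¹}` with `w ∈ B`,
lies in the span of the `T_w` with `w ∈ A \ B`. -/
theorem mem_span_diff {A B : Set (Equiv.Perm (Fin n))} {h : HeckeAlgebra n b}
    (hh : h ∈ Submodule.span ℤ[T;T⁻¹] (heckeT b '' A))
    (hB : ∀ w ∈ B, heckeTrace b (h * heckeT b w⁻¹) = 0) :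
    h ∈ Submodule.span ℤ[T;T⁻¹] (heckeT b '' (A \ B)) := by
  rw [Finsupp.mem_span_image_iff_linearCombination] at hh ⊢
  obtain ⟨c, hc, rfl⟩ := hh
  refine ⟨c, ?_, rfl⟩
  rw [Finsupp.mem_supported] at hc ⊢
  refine fun w hw => ⟨hc hw, fun hwB => ?_⟩
  have h1 := hB w hwB
  rw [Finsupp.linearCombination_apply, Finsupp.sum, Finset.sum_mul, map_sum,
    Finset.sum_eq_single w] at h1
  · rw [smul_mul_assoc, map_smul, heckeTrace_mul_heckeT, mul_inv_cancel, if_pos rfl, smul_eq_mul,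
      (isUnit_qq.pow _).mul_left_eq_zero] at h1
    exact (Finsupp.mem_support_iff.1 hw) h1
  · intro w' _ hne
    rw [smul_mul_assoc, map_smul, heckeTrace_mul_heckeT, if_neg, smul_zero]
    rwa [mul_inv_eq_one]
  · exact fun h => absurd hw h

end StandardBasis

/-! ### Sorting initial blocks -/

section Blocks

variable {n : ℕ}

theorem tiltedLength_mul_simpleSwap {a : Fin n → Fin n} {w : Equiv.Perm (Fin n)} {i : Fin (n - 1)}
    (h : cyc (a (lo i)) (w (lo i)) < cyc (a (lo i)) (w (hi i))) :
    tiltedLength a (w * simpleSwap i) = tiltedLength a w + 1 := by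
  have hI : Finset.Ico (lo i) (hi i) = {lo i} := by
    ext k
    simp only [Finset.mem_Ico, Finset.mem_singleton, Fin.le_def, Fin.lt_def, Fin.ext_iff, lo, hi]
    omega
  have hs := tiltedLength_mul_swap a w (lo_lt_hi i)
  rw [hI, Finset.sum_singleton] at hs
  rw [simpleSwap, hs]
  have h1 := (a (lo i)).isLt
  have h2 := (w (lo i)).isLt
  have h3 := (w (hi i)).isLt
  rcases lt_or_gt_of_ne (w.injective.ne (lo_ne_hi i)) with hw | hw
  · have hl := permLength_mul_of_lt w i hw
    rw [simpleSwap] at hl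
    rw [hl]
    simp only [cyc_eq, Fin.lt_def] at h hw ⊢
    split_ifs at h ⊢ <;> push_cast <;> omega
  · have hl := permLength_mul_of_descent hw
    rw [simpleSwap] at hl
    rw [← hl]
    simp only [cyc_eq, Fin.lt_def] at h hw ⊢
    split_ifs at h ⊢ <;> push_cast <;> omega

theorem tiltedLength_nonneg (a : Fin n → Fin n) (w : Equiv.Perm (Fin n)) :
    0 ≤ tiltedLength a w := by
  unfold tiltedLength
  positivity

/-- The subgroup of permutations that fix all positions from `N` on. -/
def leadingPerms (n N : ℕ) : Subgroup (Equiv.Perm (Fin n)) where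
  carrier := {x | ∀ k : Fin n, N ≤ k → x k = k}
  one_mem' := fun _ _ => rfl
  mul_mem' := fun {x y} hx hy k hk => by rw [Equiv.Perm.mul_apply, hy k hk, hx k hk]
  inv_mem' := fun {x} hx k hk => by rw [Equiv.Perm.inv_eq_iff_eq, hx k hk]

theorem leadingPerms_apply_lt_iff {N : ℕ} {x : Equiv.Perm (Fin n)} (hx : x ∈ leadingPerms n N)
    {M : ℕ} (hM : N ≤ M) (k : Fin n) : (x k : ℕ) < M ↔ (k : ℕ) < M := by
  constructor
  · intro h
    by_contra hk
    rw [hx k (by omega)] at h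
    exact hk h
  · intro h
    by_contra hk
    have := hx (x k) (by omega)
    rw [x.injective this] at hk
    exact hk h

theorem simpleSwap_mem_leadingPerms {N : ℕ} {i : Fin (n - 1)} (h : (hi i : ℕ) < N) :
    simpleSwap i ∈ leadingPerms n N := by
  intro k hk
  have := lo_lt_hi i
  refine Equiv.swap_apply_of_ne_of_ne ?_ ?_ <;> rintro rfl <;>
    simp only [Fin.lt_def] at * <;> omega

/-- A descent of a permutation of the initial block lies inside the block. -/
theorem hi_lt_of_inversion {N : ℕ} {x : Equiv.Perm (Fin n)} (hx : x ∈ leadingPerms n N)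
    {p q : Fin n} (hpq : p < q) (h : x q < x p) : (q : ℕ) < N := by
  by_contra hq
  rw [hx q (by omega)] at h
  have h1 := (leadingPerms_apply_lt_iff hx (le_of_not_gt hq) p).2 hpq
  simp only [Fin.lt_def] at h
  omega

/-- The entries of `w` in the positions below `N` increase for `<_r`. -/
def IncreasesBelow (r : Fin n) (N : ℕ) (w : Equiv.Perm (Fin n)) : Prop :=
  ∀ i : Fin (n - 1), (hi i : ℕ) < N → cyc r (w (lo i)) < cyc r (w (hi i))

theorem IncreasesBelow.lt {r : Fin n} {N : ℕ} {w : Equiv.Perm (Fin n)} (h : IncreasesBelow r N w)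
    {p q : Fin n} (hpq : p < q) (hq : (q : ℕ) < N) : cyc r (w p) < cyc r (w q) :=
  apply_lt_of_adjacent (f := fun k => cyc r (w k)) h hpq hq

/-- To prove a property of all permutations it suffices to treat those that increase on the initial
block and to pass from `w` to `w s_i` whenever this creates an inversion in the block. -/
theorem block_induction (r : Fin n) (N : ℕ) {P : Equiv.Perm (Fin n) → Prop}
    (h0 : ∀ w, IncreasesBelow r N w → P w)
    (hs : ∀ w i, (hi i : ℕ) < N → cyc r (w (lo i)) < cyc r (w (hi i)) → P w → P (w * simpleSwap i))
    (w : Equiv.Perm (Fin n)) : P w := by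
  -- `w ↦ w s_i` raises the tilted length for the constant tilt `r`
  induction hm : (tiltedLength (fun _ => r) w).toNat using Nat.strong_induction_on generalizing w with
  | _ m ih =>
  by_cases hw : IncreasesBelow r N w
  · exact h0 w hw
  simp only [IncreasesBelow, not_forall, not_lt] at hw
  obtain ⟨i, hiN, hle⟩ := hw
  have hlt : cyc r ((w * simpleSwap i) (lo i)) < cyc r ((w * simpleSwap i) (hi i)) := by
    rw [mul_simpleSwap_lo, mul_simpleSwap_hi]
    exact lt_of_le_of_ne hle fun h => lo_ne_hi i (w.injective (cyc_inj.1 h)).symm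
  have h1 := tiltedLength_mul_simpleSwap (a := fun _ => r) hlt
  rw [simpleSwap_mul_self] at h1
  have h2 := tiltedLength_nonneg (fun _ => r) (w * simpleSwap i)
  have h3 := hs _ i hiN hlt (ih _ (by omega) _ rfl)
  rwa [simpleSwap_mul_self] at h3

theorem exists_sorted (r : Fin n) (N : ℕ) (w : Equiv.Perm (Fin n)) :
    ∃ w₀ x, IncreasesBelow r N w₀ ∧ x ∈ leadingPerms n N ∧ w = w₀ * x := by
  induction w using block_induction r N with
  | h0 w hw => exact ⟨w, 1, hw, one_mem _, (mul_one w).symm⟩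
  | hs w i hiN _ ih =>
    obtain ⟨w₀, x, h1, h2, rfl⟩ := ih
    exact ⟨w₀, x * simpleSwap i, h1, mul_mem h2 (simpleSwap_mem_leadingPerms hiN), mul_assoc _ _ _⟩

theorem sorted_unique {r : Fin n} {N : ℕ} {w₀ w₁ x y : Equiv.Perm (Fin n)}
    (h0 : IncreasesBelow r N w₀) (h1 : IncreasesBelow r N w₁) (hx : x ∈ leadingPerms n N)
    (hy : y ∈ leadingPerms n N) (h : w₀ * x = w₁ * y) : w₀ = w₁ ∧ x = y := by
  have hz : y * x⁻¹ ∈ leadingPerms n N := mul_mem hy (inv_mem hx)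
  have e : w₀ = w₁ * (y * x⁻¹) := by rw [← mul_assoc, ← h, mul_inv_cancel_right]
  have hz1 : y * x⁻¹ = 1 := by
    by_contra hne
    obtain ⟨i, hd⟩ := exists_descent hne
    have hiN := hi_lt_of_inversion hz (lo_lt_hi i) hd
    have h2 := h0 i hiN
    rw [e] at h2
    refine h2.not_gt (h1.lt hd ?_)
    rw [leadingPerms_apply_lt_iff hz le_rfl]
    exact lt_trans (show (lo i : ℕ) < hi i from lo_lt_hi i) hiN
  rw [hz1, mul_one] at e
  exact ⟨e, (mul_inv_eq_one.1 hz1).symm⟩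

/-- The permutation with the same entries as `w` whose first `N` entries are sorted for `<_r`. -/
noncomputable def sortBlock (r : Fin n) (N : ℕ) (w : Equiv.Perm (Fin n)) : Equiv.Perm (Fin n) :=
  (exists_sorted r N w).choose

/-- The permutation of the first `N` positions that unsorts `sortBlock r N w`. -/
noncomputable def blockPerm (r : Fin n) (N : ℕ) (w : Equiv.Perm (Fin n)) : Equiv.Perm (Fin n) :=
  (exists_sorted r N w).choose_spec.choose

theorem sortBlock_increases (r : Fin n) (N : ℕ) (w : Equiv.Perm (Fin n)) :
    IncreasesBelow r N (sortBlock r N w) :=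
  (exists_sorted r N w).choose_spec.choose_spec.1

theorem blockPerm_mem (r : Fin n) (N : ℕ) (w : Equiv.Perm (Fin n)) :
    blockPerm r N w ∈ leadingPerms n N :=
  (exists_sorted r N w).choose_spec.choose_spec.2.1

theorem sortBlock_mul_blockPerm (r : Fin n) (N : ℕ) (w : Equiv.Perm (Fin n)) :
    sortBlock r N w * blockPerm r N w = w :=
  (exists_sorted r N w).choose_spec.choose_spec.2.2.symm

theorem sortBlock_mul {r : Fin n} {N : ℕ} {w x : Equiv.Perm (Fin n)} (h : IncreasesBelow r N w)
    (hx : x ∈ leadingPerms n N) : sortBlock r N (w * x) = w ∧ blockPerm r N (w * x) = x :=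
  sorted_unique (sortBlock_increases r N _) h (blockPerm_mem r N _) hx (sortBlock_mul_blockPerm r N _)

/-- Outside the initial block, sorting does not change the entries. -/
theorem sortBlock_apply {r : Fin n} {N : ℕ} (w : Equiv.Perm (Fin n)) {k : Fin n} (hk : N ≤ k) :
    sortBlock r N w k = w k := by
  conv_rhs => rw [← sortBlock_mul_blockPerm r N w, Equiv.Perm.mul_apply, blockPerm_mem r N w k hk]

theorem firstEntries_mul_leadingPerms {N : ℕ} {w x : Equiv.Perm (Fin n)}
    (hx : x ∈ leadingPerms n N) {m : ℕ} (hm : N ≤ m) :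
    firstEntries (w * x) m = firstEntries w m :=
  firstEntries_mul_of_maps (leadingPerms_apply_lt_iff hx hm)

/-- The permutation of the first `p + m` positions that moves the first `p` of them, in order, after the
other `m`. -/
def blockShift (n p m : ℕ) (h : p + m ≤ n) : Equiv.Perm (Fin n) where
  toFun k := if h1 : (k : ℕ) < p then ⟨k + m, by omega⟩ else
    if h2 : (k : ℕ) < p + m then ⟨k - p, by omega⟩ else k
  invFun k := if h1 : (k : ℕ) < m then ⟨k + p, by omega⟩ else
    if h2 : (k : ℕ) < p + m then ⟨k - m, by omega⟩ else k
  left_inv k := by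
    by_cases h1 : (k : ℕ) < p
    · have h2 : ¬ (k : ℕ) + m < m := by omega
      have h3 : (k : ℕ) + m < p + m := by omega
      simp only [h1, dif_pos, h2, dif_neg, not_false_eq_true, h3, Nat.add_sub_cancel]
    · by_cases h2 : (k : ℕ) < p + m
      · have h3 : (k : ℕ) - p < m := by omega
        simp only [h1, h2, h3, dif_pos, dif_neg, not_false_eq_true]
        ext; simp only; omega
      · have h3 : ¬ (k : ℕ) < m := by omega
        simp only [h1, h2, h3, dif_neg, not_false_eq_true]
  right_inv k := by
    by_cases h1 : (k : ℕ) < m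
    · have h2 : ¬ (k : ℕ) + p < p := by omega
      have h3 : (k : ℕ) + p < p + m := by omega
      simp only [h1, dif_pos, h2, dif_neg, not_false_eq_true, h3, Nat.add_sub_cancel]
    · by_cases h2 : (k : ℕ) < p + m
      · have h3 : (k : ℕ) - m < p := by omega
        simp only [h1, h2, h3, dif_pos, dif_neg, not_false_eq_true]
        ext; simp only; omega
      · have h3 : ¬ (k : ℕ) < p := by omega
        simp only [h1, h2, h3, dif_neg, not_false_eq_true]

theorem blockShift_apply {p m : ℕ} (h : p + m ≤ n) (k : Fin n) :
    (blockShift n p m h k : ℕ) = if (k : ℕ) < p then (k : ℕ) + m else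
      if (k : ℕ) < p + m then (k : ℕ) - p else k := by
  simp only [blockShift, Equiv.coe_fn_mk]
  split_ifs <;> rfl

theorem blockShift_inv_apply {p m : ℕ} (h : p + m ≤ n) (k : Fin n) :
    ((blockShift n p m h)⁻¹ k : ℕ) = if (k : ℕ) < m then (k : ℕ) + p else
      if (k : ℕ) < p + m then (k : ℕ) - m else k := by
  change ((blockShift n p m h).symm k : ℕ) = _
  simp only [blockShift, Equiv.coe_fn_symm_mk]
  split_ifs <;> rfl

theorem blockShift_mem {p m : ℕ} (h : p + m ≤ n) :
    blockShift n p m h ∈ leadingPerms n (p + m) := by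
  intro k hk
  ext
  rw [blockShift_apply]
  split_ifs <;> omega

/-- The permutations of the first `N` positions that preserve the first `m` positions. -/
def splitPerms (n N m : ℕ) : Subgroup (Equiv.Perm (Fin n)) where
  carrier := {x | x ∈ leadingPerms n N ∧ ∀ k : Fin n, (x k : ℕ) < m ↔ (k : ℕ) < m}
  one_mem' := ⟨one_mem _, fun _ => Iff.rfl⟩
  mul_mem' := fun {x y} hx hy => ⟨mul_mem hx.1 hy.1, fun k => by
    rw [Equiv.Perm.mul_apply, hx.2, hy.2]⟩
  inv_mem' := fun {x} hx => ⟨inv_mem hx.1, fun k => by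
    rw [← hx.2 (x⁻¹ k), ← Equiv.Perm.mul_apply, mul_inv_cancel, Equiv.Perm.one_apply]⟩

theorem blockShift_conj_mem {p m : ℕ} (h : p + m ≤ n) {w : Equiv.Perm (Fin n)}
    (hw : w ∈ splitPerms n (p + m) m) :
    (blockShift n p m h)⁻¹ * w * blockShift n p m h ∈ splitPerms n (p + m) p := by
  have hd := blockShift_mem h
  have hmem := mul_mem (mul_mem (inv_mem hd) hw.1) hd
  refine ⟨hmem, fun k => ?_⟩
  have h1 := hw.2 (blockShift n p m h k)
  have h2 := leadingPerms_apply_lt_iff hw.1 le_rfl (blockShift n p m h k)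
  rw [blockShift_apply] at h1 h2
  rw [Equiv.Perm.mul_apply, Equiv.Perm.mul_apply, blockShift_inv_apply]
  split_ifs at h1 h2 ⊢ <;> omega

/-- By finiteness, a permutation that maps the first `m` positions into themselves preserves them. -/
theorem mem_splitPerms_of_forall_lt {N m : ℕ} {x : Equiv.Perm (Fin n)} (hx : x ∈ leadingPerms n N)
    (h : ∀ k : Fin n, (k : ℕ) < m → (x k : ℕ) < m) : x ∈ splitPerms n N m := by
  refine ⟨hx, fun k => ⟨fun hk => ?_, h k⟩⟩
  let S : Finset (Fin n) := Finset.univ.filter fun k => (k : ℕ) < m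
  have hS : S.image x = S := by
    refine Finset.eq_of_subset_of_card_le ?_ ?_
    · intro y hy
      obtain ⟨z, hz, rfl⟩ := Finset.mem_image.1 hy
      simp only [S, Finset.mem_filter, Finset.mem_univ, true_and] at hz ⊢
      exact h z hz
    · rw [Finset.card_image_of_injective _ x.injective]
  have h1 : x k ∈ S.image x := by rw [hS]; simpa [S] using hk
  obtain ⟨z, hz, hzk⟩ := Finset.mem_image.1 h1
  rw [← x.injective hzk]
  simpa [S] using hz

end Blocks

/-! ### Standard basis elements as units, and parabolic subalgebras -/

section Units

variable {n : ℕ} (b : ℤ[T;T⁻¹])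

/-- The standard basis element `T_w` as a unit. -/
noncomputable def heckeTUnit (w : Equiv.Perm (Fin n)) : (HeckeAlgebra n b)ˣ :=
  ((exists_reduced w).choose.map (heckeUnit b)).prod

theorem val_heckeTUnit (w : Equiv.Perm (Fin n)) :
    (heckeTUnit b w : HeckeAlgebra n b) = heckeT b w := by
  have h := map_list_prod (Units.coeHom (HeckeAlgebra n b))
    ((exists_reduced w).choose.map (heckeUnit b))
  rw [List.map_map] at h
  exact h

theorem heckeTUnit_one : heckeTUnit b (1 : Equiv.Perm (Fin n)) = 1 :=
  Units.ext (by rw [val_heckeTUnit, heckeT_one, Units.val_one])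

theorem heckeTUnit_mul_simpleSwap {w : Equiv.Perm (Fin n)} {i : Fin (n - 1)}
    (h : w (lo i) < w (hi i)) : heckeTUnit b (w * simpleSwap i) = heckeTUnit b w * heckeUnit b i :=
  Units.ext (by
    rw [Units.val_mul, val_heckeTUnit, val_heckeTUnit, heckeT_mul_simpleSwap b h]; rfl)

/-- The generators beyond the initial block commute with the `T_x` of the block. -/
theorem heckeUnit_comm_heckeTUnit {N : ℕ} {x : Equiv.Perm (Fin n)} (hx : x ∈ leadingPerms n N)
    {i : Fin (n - 1)} (hi' : N ≤ lo i) :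
    heckeUnit b i * heckeTUnit b x = heckeTUnit b x * heckeUnit b i := by
  have h0 : (lo i : ℕ) < hi i := lo_lt_hi i
  have h1 := hx (lo i) hi'
  have h2 := hx (hi i) (by omega)
  have hcomm : x * simpleSwap i = simpleSwap i * x := by
    have := Equiv.mul_swap_eq_swap_mul x (lo i) (hi i)
    rwa [h1, h2] at this
  refine Units.ext ?_
  rw [Units.val_mul, Units.val_mul, val_heckeTUnit]
  change heckeGen b i * heckeT b x = heckeT b x * heckeGen b i
  rw [← heckeT_mul_simpleSwap b (by rw [h1, h2]; exact lo_lt_hi i), hcomm, heckeT_simpleSwap_mul]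
  rw [Equiv.Perm.inv_eq_iff_eq.2 h1.symm, Equiv.Perm.inv_eq_iff_eq.2 h2.symm]
  exact lo_lt_hi i

/-- The span of the `T_w` with `w` in the initial block. -/
noncomputable def blockSpan (n : ℕ) (b : ℤ[T;T⁻¹]) (N : ℕ) : Submodule ℤ[T;T⁻¹] (HeckeAlgebra n b) :=
  Submodule.span ℤ[T;T⁻¹] (heckeT b '' (leadingPerms n N))

/-- The span of the `T_w` of the initial block is stable under right multiplication by the `T_y` of the
block and by their inverses. -/
theorem mul_heckeTUnit_mem_blockSpan {N : ℕ} {y : Equiv.Perm (Fin n)} (hy : y ∈ leadingPerms n N)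
    {h : HeckeAlgebra n b} (hh : h ∈ blockSpan n b N) :
    h * heckeTUnit b y ∈ blockSpan n b N ∧ h * ↑(heckeTUnit b y)⁻¹ ∈ blockSpan n b N := by
  induction hm : permLength y generalizing y h with
  | zero =>
    have hy1 : y = 1 := by
      by_contra hne
      obtain ⟨i, hd⟩ := exists_descent hne
      have := permLength_mul_of_descent hd
      omega
    rw [hy1, heckeTUnit_one, inv_one, Units.val_one, mul_one]
    exact ⟨hh, hh⟩
  | succ m ih =>
    obtain ⟨i, hd⟩ := exists_descent (w := y) (by rintro rfl; rw [permLength_one] at hm; omega)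
    have hlen := permLength_mul_of_descent hd
    have hiN := hi_lt_of_inversion hy (lo_lt_hi i) hd
    have hs := simpleSwap_mem_leadingPerms hiN
    have hgen : ∀ {h : HeckeAlgebra n b}, h ∈ blockSpan n b N →
        h * heckeGen b i ∈ blockSpan n b N := fun hh =>
      mul_gen_mem_span b (fun w hw => mul_mem hw hs) hh
    have e : heckeTUnit b y = heckeTUnit b (y * simpleSwap i) * heckeUnit b i := by
      rw [← heckeTUnit_mul_simpleSwap, simpleSwap_mul_self]
      rwa [mul_simpleSwap_lo, mul_simpleSwap_hi]
    have ih' := fun {h} hh => ih (y := y * simpleSwap i) (h := h) (mul_mem hy hs) hh (by omega)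
    rw [e, mul_inv_rev, Units.val_mul, Units.val_mul, ← mul_assoc, ← mul_assoc]
    refine ⟨hgen (ih' hh).1, (ih' ?_).2⟩
    change h * ((LaurentPolynomial.T (-1) : ℤ[T;T⁻¹]) • (heckeGen b i - algebraMap _ _ b)) ∈ _
    rw [mul_smul_comm, mul_sub, ← Algebra.commutes, ← Algebra.smul_def]
    exact Submodule.smul_mem _ _ (Submodule.sub_mem _ (hgen hh) (Submodule.smul_mem _ _ hh))

/-- Multiplying by `T_d` on the right, for the block shift `d`, conjugates the permutations of the two
blocks. -/
theorem heckeT_mul_blockShift {p m : ℕ} (hpm : p + m ≤ n) {w : Equiv.Perm (Fin n)}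
    (hw : w ∈ splitPerms n (p + m) m) :
    heckeT b w * heckeT b (blockShift n p m hpm) =
      heckeT b (blockShift n p m hpm) *
        heckeT b ((blockShift n p m hpm)⁻¹ * w * blockShift n p m hpm) := by
  set d := blockShift n p m hpm with hd
  rw [← heckeT_mul_of_inversions, ← heckeT_mul_of_inversions, mul_assoc, mul_inv_cancel_left]
  · intro k l hkl h
    have hz := blockShift_conj_mem hpm hw
    rw [← hd] at hz
    set z := d⁻¹ * w * d
    have hl := hi_lt_of_inversion hz.1 hkl h
    have h1 := hz.2 k
    have h2 := hz.2 l
    have h3 := leadingPerms_apply_lt_iff hz.1 le_rfl k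
    simp only [Fin.lt_def] at h hkl ⊢
    rw [hd, blockShift_apply, blockShift_apply]
    split_ifs <;> omega
  · intro k l hkl h
    have h1 := hw.2 (d k)
    have h2 := hw.2 (d l)
    have e1 := blockShift_apply hpm k
    have e2 := blockShift_apply hpm l
    rw [← hd] at e1 e2
    simp only [Fin.lt_def] at h hkl ⊢
    split_ifs at e1 e2 <;> omega

/-- Conjugation by `T_d`, for the block shift `d`, carries a `T_x` that mixes the two blocks to a
combination of such elements. -/
theorem conj_blockShift_mem_span {p m : ℕ} (hpm : p + m ≤ n) {x : Equiv.Perm (Fin n)}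
    (hx : x ∈ leadingPerms n (p + m)) (hx' : x ∉ splitPerms n (p + m) p) :
    (heckeT b (blockShift n p m hpm) * heckeT b x * ↑(heckeTUnit b (blockShift n p m hpm))⁻¹ :
        HeckeAlgebra n b) ∈
      Submodule.span ℤ[T;T⁻¹] (heckeT b '' ((leadingPerms n (p + m) : Set (Equiv.Perm (Fin n))) \
        splitPerms n (p + m) m)) := by
  have hd := blockShift_mem hpm
  refine mem_span_diff b ?_ fun w hw => ?_
  · refine (mul_heckeTUnit_mem_blockSpan b hd ?_).2
    rw [← val_heckeTUnit b x]
    exact (mul_heckeTUnit_mem_blockSpan b hx (Submodule.subset_span ⟨_, hd, rfl⟩)).1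
  · have hwi : w⁻¹ ∈ splitPerms n (p + m) m := inv_mem hw
    have h1 := heckeT_mul_blockShift b hpm hwi
    have hz := blockShift_conj_mem hpm hwi
    set z := (blockShift n p m hpm)⁻¹ * w⁻¹ * blockShift n p m hpm
    have h2 : ↑(heckeTUnit b (blockShift n p m hpm))⁻¹ * heckeT b w⁻¹ =
        heckeT b z * ↑(heckeTUnit b (blockShift n p m hpm))⁻¹ := by
      rw [Units.inv_mul_eq_iff_eq_mul, ← mul_assoc, val_heckeTUnit, ← h1, mul_assoc,
        ← val_heckeTUnit b (blockShift n p m hpm), Units.mul_inv, mul_one]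
    rw [mul_assoc, h2, ← mul_assoc, heckeTrace_mul_comm, ← mul_assoc, ← mul_assoc,
      ← val_heckeTUnit b (blockShift n p m hpm), Units.inv_mul, one_mul, heckeTrace_mul_heckeT,
      if_neg]
    intro h
    rw [mul_eq_one_iff_eq_inv] at h
    exact hx' (by rw [h]; exact inv_mem hz)

/-- The effect of a further letter of `y`, from `T_i⁻¹ = q⁻¹ (T_i - b)` and the trace property. -/
theorem qq_mul_heckeTrace_inv (x y : (HeckeAlgebra n b)ˣ) (i : Fin (n - 1)) :
    qq * heckeTrace b (↑((y * heckeUnit b i)⁻¹ * x) : HeckeAlgebra n b) =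
      heckeTrace b (↑(y⁻¹ * (x * heckeUnit b i)) : HeckeAlgebra n b) -
        b * heckeTrace b (↑(y⁻¹ * x) : HeckeAlgebra n b) := by
  have h1 : (y * heckeUnit b i)⁻¹ * x = (heckeUnit b i)⁻¹ * (y⁻¹ * x) := by
    rw [mul_inv_rev, mul_assoc]
  have h2 : (↑(heckeUnit b i)⁻¹ : HeckeAlgebra n b) =
      (LaurentPolynomial.T (-1) : ℤ[T;T⁻¹]) • (heckeGen b i - algebraMap _ (HeckeAlgebra n b) b) := rfl
  have h3 : y⁻¹ * (x * heckeUnit b i) = y⁻¹ * x * heckeUnit b i := by rw [mul_assoc]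
  have h4 : (↑(heckeUnit b i) : HeckeAlgebra n b) = heckeGen b i := rfl
  rw [h1, h3, Units.val_mul, h2, Units.val_mul (y⁻¹ * x) (heckeUnit b i), h4,
    heckeTrace_mul_comm b _ (heckeGen b i), smul_mul_assoc, map_smul, smul_eq_mul, ← mul_assoc,
    mul_comm qq, qq_inv_mul, one_mul, sub_mul, map_sub, ← Algebra.smul_def, map_smul, smul_eq_mul]

theorem heckeTrace_mul_heckeUnit (x y : (HeckeAlgebra n b)ˣ) (i : Fin (n - 1)) :
    heckeTrace b (↑((y * heckeUnit b i)⁻¹ * (x * heckeUnit b i)) : HeckeAlgebra n b) =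
      heckeTrace b (↑(y⁻¹ * x) : HeckeAlgebra n b) := by
  have h1 : (y * heckeUnit b i)⁻¹ * (x * heckeUnit b i) =
      (heckeUnit b i)⁻¹ * (y⁻¹ * x * heckeUnit b i) := by rw [mul_inv_rev]; simp only [mul_assoc]
  rw [h1, Units.val_mul, heckeTrace_mul_comm, ← Units.val_mul, mul_inv_cancel_right]

end Units

/-! ### Evaluation of Laurent polynomials -/

section Evaluation

/-- The value of a Laurent polynomial at the cardinality of a finite field. -/
noncomputable def evalCard (F : Type) [Field F] [Finite F] : ℤ[T;T⁻¹] →+* ℚ :=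
  LaurentPolynomial.eval₂ (Int.castRingHom ℚ)
    (Units.mk0 (Nat.card F : ℚ) (Nat.cast_ne_zero.2 Nat.card_pos.ne'))

variable (F : Type) [Field F] [Finite F]

theorem evalCard_qq : evalCard F qq = Nat.card F := by
  rw [evalCard, qq, LaurentPolynomial.eval₂_T, zpow_one, Units.val_mk0]

theorem evalCard_toLaurent (P : ℤ[X]) :
    evalCard F (Polynomial.toLaurent P) = (P.eval (Nat.card F : ℤ) : ℤ) := by
  rw [evalCard, LaurentPolynomial.eval₂_toLaurent]
  simp

/-- A polynomial is determined by its values at the primes. -/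
theorem polynomial_eq_of_primes {P Q : ℤ[X]}
    (h : ∀ p : ℕ, p.Prime → P.eval (p : ℤ) = Q.eval (p : ℤ)) : P = Q := by
  refine Polynomial.eq_of_infinite_eval_eq P Q ?_
  refine Set.Infinite.mono (s := (fun p : ℕ => (p : ℤ)) '' {p | p.Prime}) ?_ ?_
  · rintro _ ⟨p, hp, rfl⟩
    exact h p hp
  · exact Nat.infinite_setOfPred_prime.image Nat.cast_injective.injOn

/-- A Laurent polynomial that vanishes at the cardinality of every finite field is zero. -/
theorem eq_zero_of_evalCard {f : ℤ[T;T⁻¹]}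
    (h : ∀ (F : Type) [Field F] [Finite F], evalCard F f = 0) : f = 0 := by
  obtain ⟨m, P, hP⟩ := LaurentPolynomial.exists_T_pow f
  have hP0 : P = 0 := by
    refine polynomial_eq_of_primes fun p hp => ?_
    have : Fact p.Prime := ⟨hp⟩
    have h1 := evalCard_toLaurent (ZMod p) P
    rw [hP, map_mul, h, zero_mul, Nat.card_zmod] at h1
    rw [Polynomial.eval_zero]
    exact_mod_cast h1.symm
  rw [hP0, map_zero] at hP
  exact ((LaurentPolynomial.isUnit_T (m : ℤ)).mul_left_eq_zero).1 hP.symm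

/-- A Laurent polynomial that takes integer values at the primes is a polynomial. -/
theorem exists_toLaurent_eq {f : ℤ[T;T⁻¹]}
    (h : ∀ (F : Type) [Field F] [Finite F], ∃ z : ℤ, evalCard F f = z) :
    ∃ P : ℤ[X], Polynomial.toLaurent P = f := by
  obtain ⟨m, P, hP⟩ := LaurentPolynomial.exists_T_pow f
  induction m generalizing P with
  | zero => exact ⟨P, by rw [hP]; simp⟩
  | succ m ih =>
    -- every prime `p` divides `P(p)`, hence also the constant term of `P`
    have h0 : P.coeff 0 = 0 := by
      obtain ⟨p, hpgt, hp⟩ := Nat.exists_infinite_primes ((P.coeff 0).natAbs + 1)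
      have : Fact p.Prime := ⟨hp⟩
      obtain ⟨z, hz⟩ := h (ZMod p)
      have h1 := evalCard_toLaurent (ZMod p) P
      have h2 : evalCard (ZMod p) (LaurentPolynomial.T ((m + 1 : ℕ) : ℤ)) = (p : ℚ) ^ (m + 1) := by
        rw [evalCard, LaurentPolynomial.eval₂_T_n, Units.val_mk0, Nat.card_zmod]
      rw [hP, map_mul, hz, h2, Nat.card_zmod] at h1
      have h3 : z * (p : ℤ) ^ (m + 1) = P.eval (p : ℤ) := by exact_mod_cast h1
      have h4 : (p : ℤ) ∣ P.coeff 0 := by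
        have h5 : (p : ℤ) ∣ P.eval (p : ℤ) - P.eval 0 := by
          simpa using Polynomial.sub_dvd_eval_sub (p : ℤ) 0 P
        rw [← Polynomial.coeff_zero_eq_eval_zero] at h5
        have h6 : (p : ℤ) ∣ P.eval (p : ℤ) := ⟨z * (p : ℤ) ^ m, by rw [← h3]; ring⟩
        exact (dvd_sub_right h6).1 h5
      refine Int.eq_zero_of_abs_lt_dvd h4 ?_
      rw [Int.abs_eq_natAbs]
      exact_mod_cast hpgt
    obtain ⟨Q, rfl⟩ := Polynomial.X_dvd_iff.2 h0
    refine ih Q ?_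
    have h1 : (Polynomial.toLaurent Q) * LaurentPolynomial.T 1 =
        f * LaurentPolynomial.T (m : ℤ) * LaurentPolynomial.T 1 := by
      rw [LaurentPolynomial.mul_T_assoc, ← Nat.cast_succ, ← hP, map_mul, Polynomial.toLaurent_X,
        mul_comm]
    exact (LaurentPolynomial.isUnit_T 1).mul_right_cancel h1

end Evaluation

/-! ### Flattening the tilt -/

section Flattening

variable {n : ℕ}

theorem card_inter_Iio_of_le {r s : Fin n} (h : r ≤ s) (I : Finset (Fin n)) :
    (I ∩ Finset.Iio s).card = (I ∩ Finset.Iio r).card + (I ∩ cyclicIco r s).card := by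
  have h0 : ∀ y : Fin n, Finset.Iio y = cyclicIco ⟨0, r.pos⟩ y := by
    intro y
    ext z
    rw [mem_cyclicIco, Finset.mem_Iio, cyc_eq, cyc_eq]
    simp
  rw [h0, h0]
  refine card_inter_cyclicIco_add ?_ I
  rw [cyc_eq, cyc_eq]
  simpa using h

/-- On permutations that agree in how many of their first entries lie in `[a_k, a'_k)_c`, the tilted
lengths for `a` and `a'` differ by a constant. -/
theorem tiltedLength_sub_eq {a a' : Fin n → Fin n} {u v : Equiv.Perm (Fin n)}
    (h : ∀ k : Fin n, (firstEntries u (k + 1) ∩ cyclicIco (a k) (a' k)).card =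
      (firstEntries v (k + 1) ∩ cyclicIco (a k) (a' k)).card) :
    tiltedLength a v - tiltedLength a u = tiltedLength a' v - tiltedLength a' u := by
  have key : ∀ k : Fin n,
      ((firstEntries v (k + 1) ∩ Finset.Iio (a k)).card : ℤ) -
        (firstEntries u (k + 1) ∩ Finset.Iio (a k)).card =
      (firstEntries v (k + 1) ∩ Finset.Iio (a' k)).card -
        (firstEntries u (k + 1) ∩ Finset.Iio (a' k)).card := by
    intro k
    have hk := h k
    rcases le_or_gt (a k) (a' k) with hle | hlt
    · have h1 := card_inter_Iio_of_le hle (firstEntries u (k + 1))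
      have h2 := card_inter_Iio_of_le hle (firstEntries v (k + 1))
      omega
    · have h1 := card_inter_Iio_of_le hlt.le (firstEntries u (k + 1))
      have h2 := card_inter_Iio_of_le hlt.le (firstEntries v (k + 1))
      have h3 := card_inter_cyclicIco_compl hlt.ne' (firstEntries u (k + 1))
      have h4 := card_inter_cyclicIco_compl hlt.ne' (firstEntries v (k + 1))
      rw [card_firstEntries _ k.isLt] at h3 h4
      omega
  have hsum := Finset.sum_congr rfl fun k (_ : k ∈ Finset.univ) => key k
  rw [Finset.sum_sub_distrib, Finset.sum_sub_distrib] at hsum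
  unfold tiltedLength
  linarith

/-- Among the first `N` entries of `w`, the first `p` lie in `[r, s)_c` and the others in
`[s, r)_c`. -/
def IsSplit (r s : Fin n) (p N : ℕ) (w : Equiv.Perm (Fin n)) : Prop :=
  (∀ k : Fin n, (k : ℕ) < p → w k ∈ cyclicIco r s) ∧
    ∀ k : Fin n, p ≤ (k : ℕ) → (k : ℕ) < N → w k ∈ cyclicIco s r

theorem IncreasesBelow.exists_isSplit {r : Fin n} {N : ℕ} {w : Equiv.Perm (Fin n)}
    (h : IncreasesBelow r N w) (hN : N ≤ n) {s : Fin n} (hrs : r ≠ s) :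
    ∃ p ≤ N, IsSplit r s p N w := by
  induction N with
  | zero => exact ⟨0, le_rfl, fun k hk => absurd hk (Nat.not_lt_zero _),
      fun k _ hk => absurd hk (Nat.not_lt_zero _)⟩
  | succ N ih =>
    by_cases hw : w ⟨N, hN⟩ ∈ cyclicIco r s
    · refine ⟨N + 1, le_rfl, fun k hk => ?_, fun k h1 h2 => absurd h2 (not_lt.2 h1)⟩
      rcases (Nat.lt_succ_iff.1 hk).lt_or_eq with hk | hk
      · rw [mem_cyclicIco] at hw ⊢
        exact (h.lt (p := k) (q := ⟨N, hN⟩) hk (Nat.lt_succ_self N)).trans hw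
      · rwa [show k = ⟨N, hN⟩ from Fin.ext hk]
    · obtain ⟨p, hp, h1, h2⟩ := ih (fun i hiN => h i (hiN.trans (Nat.lt_succ_self N))) (by omega)
      refine ⟨p, by omega, h1, fun k hk1 hk2 => ?_⟩
      rcases (Nat.lt_succ_iff.1 hk2).lt_or_eq with hk | hk
      · exact h2 k hk1 hk
      · rw [show k = ⟨N, hN⟩ from Fin.ext hk]
        exact (notMem_cyclicIco hrs).1 hw

theorem IsSplit.card_inter {r s : Fin n} {p N : ℕ} {w : Equiv.Perm (Fin n)} (h : IsSplit r s p N w)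
    (hrs : r ≠ s) (hN : N ≤ n) {m : ℕ} (hm : m ≤ N) :
    (firstEntries w m ∩ cyclicIco r s).card = min m p := by
  have : firstEntries w m ∩ cyclicIco r s = firstEntries w (min m p) := by
    ext x
    obtain ⟨k, rfl⟩ := w.surjective x
    rw [Finset.mem_inter, apply_mem_firstEntries, apply_mem_firstEntries, lt_min_iff]
    refine and_congr_right fun hk => ⟨fun hx => ?_, fun hk => h.1 k hk⟩
    by_contra hp
    have := h.2 k (not_lt.1 hp) (by omega)
    exact (notMem_cyclicIco hrs).2 this hx
  rw [this, card_firstEntries _ (by omega)]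

theorem IsSplit.unique {r s : Fin n} {p p' N : ℕ} {u v : Equiv.Perm (Fin n)}
    (hu : IsSplit r s p N u) (hv : IsSplit r s p' N v) (hrs : r ≠ s) (hN : N ≤ n) (hp : p ≤ N)
    (hp' : p' ≤ N) (h : (firstEntries u N ∩ cyclicIco r s).card =
      (firstEntries v N ∩ cyclicIco r s).card) : p = p' := by
  rw [hu.card_inter hrs hN le_rfl, hv.card_inter hrs hN le_rfl] at h
  omega

theorem IsSplit.mul {r s : Fin n} {p N : ℕ} {w x : Equiv.Perm (Fin n)} (h : IsSplit r s p N w)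
    (hx : x ∈ splitPerms n N p) : IsSplit r s p N (w * x) := by
  refine ⟨fun k hk => h.1 _ ((hx.2 k).2 hk), fun k h1 h2 => h.2 _ ?_ ?_⟩
  · have := hx.2 k
    omega
  · exact (leadingPerms_apply_lt_iff hx.1 le_rfl k).2 h2

theorem IsSplit.mem_splitPerms {r s : Fin n} {p N : ℕ} {w x : Equiv.Perm (Fin n)}
    (h : IsSplit r s p N w) (hrs : r ≠ s) (hp : p ≤ N) (hx : x ∈ leadingPerms n N)
    (hwx : ∀ k : Fin n, (k : ℕ) < p → (w * x) k ∈ cyclicIco r s) : x ∈ splitPerms n N p := by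
  refine mem_splitPerms_of_forall_lt hx fun k hk => ?_
  by_contra hc
  have h1 := h.2 (x k) (not_lt.1 hc) ((leadingPerms_apply_lt_iff hx le_rfl k).2 (by omega))
  exact (notMem_cyclicIco hrs).2 h1 (hwx k hk)

/-- On a split block that increases for `<_r`, entries on the same side increase for `<_s` as well. -/
theorem IsSplit.cyc_lt_cyc {r s : Fin n} {p N : ℕ} {w : Equiv.Perm (Fin n)} (h : IsSplit r s p N w)
    (hw : IncreasesBelow r N w) {k l : Fin n} (hkl : k < l) (hl : (l : ℕ) < N)
    (hp : (k : ℕ) < p ↔ (l : ℕ) < p) : cyc s (w k) < cyc s (w l) := by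
  have h0 := hw.lt hkl hl
  have hkl' : (k : ℕ) < l := hkl
  by_cases hk : (k : ℕ) < p
  · exact (cyc_lt_cyc_iff_left (h.1 k hk) (h.1 l (hp.1 hk))).1 h0
  · exact (cyc_lt_cyc_iff_left (h.2 k (by omega) (by omega)) (h.2 l (by omega) hl)).2 h0

theorem IsSplit.mul_blockShift_inv {r s : Fin n} {p m : ℕ} {w : Equiv.Perm (Fin n)}
    (h : IsSplit r s p (p + m) w) (hpm : p + m ≤ n) :
    IsSplit s r m (p + m) (w * (blockShift n p m hpm)⁻¹) := by
  constructor
  · intro k hk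
    have e := blockShift_inv_apply hpm k
    rw [if_pos hk] at e
    exact h.2 _ (by omega) (by omega)
  · intro k h1 h2
    have e := blockShift_inv_apply hpm k
    rw [if_neg (by omega), if_pos h2] at e
    exact h.1 _ (by omega)

/-- Shifting the entries in `[s, r)_c` to the front turns the `<_r`-sorted block into the
`<_s`-sorted block. -/
theorem IsSplit.increasesBelow_mul_blockShift_inv {r s : Fin n} {p m : ℕ} {w : Equiv.Perm (Fin n)}
    (h : IsSplit r s p (p + m) w) (hw : IncreasesBelow r (p + m) w) (hpm : p + m ≤ n) :
    IncreasesBelow s (p + m) (w * (blockShift n p m hpm)⁻¹) := by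
  intro i hi'
  have hlt : (lo i : ℕ) < hi i := lo_lt_hi i
  have e1 := blockShift_inv_apply hpm (lo i)
  have e2 := blockShift_inv_apply hpm (hi i)
  have hs := h.mul_blockShift_inv hpm
  by_cases hk : (lo i : ℕ) < m ∧ m ≤ hi i
  · exact cyc_lt_cyc_of_mem (hs.1 _ hk.1) (hs.2 _ hk.2 hi')
  · refine h.cyc_lt_cyc hw ?_ ?_ ?_
    · simp only [Fin.lt_def]
      split_ifs at e1 e2 <;> omega
    · split_ifs at e1 e2 <;> omega
    · split_ifs at e1 e2 <;> omega

variable {a : Fin n → Fin n} {j : Fin n}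

/-- The tilt is constant up to its first jump. -/
theorem eq_of_notMem_jumps {k l : Fin n} (hkl : k ≤ l) (h : ∀ i, i < l → i ∉ jumps a) :
    a k = a l := by
  obtain ⟨l, hl⟩ := l
  induction l with
  | zero => rw [show k = ⟨0, hl⟩ from Fin.ext (Nat.le_zero.1 hkl)]
  | succ l ih =>
    rcases (show (k : ℕ) ≤ l + 1 from hkl).lt_or_eq with hk | hk
    · rw [ih (by omega) (Nat.lt_succ_iff.1 hk) fun i hi => h i (lt_trans hi (Nat.lt_succ_self l))]
      have := h ⟨l, by omega⟩ (Nat.lt_succ_self l)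
      simp only [jumps, Set.mem_ofPred_eq, not_not] at this
      rw [this, nextEntry, dif_pos hl]
    · rw [show k = ⟨l + 1, hl⟩ from Fin.ext hk]

theorem eq_of_le_least (hj : IsLeast (jumps a) j) {k : Fin n} (hk : k ≤ j) : a k = a j :=
  eq_of_notMem_jumps hk fun _ hi h => (hj.2 h).not_gt hi

/-- A tilt without jumps is trivial. -/
theorem val_eq_zero_of_jumps_eq_empty (ha : jumps a = ∅) (k : Fin n) : (a k : ℕ) = 0 := by
  have hn : n - 1 < n := Nat.sub_lt k.pos one_pos
  rw [eq_of_notMem_jumps (a := a) (l := ⟨n - 1, hn⟩) (Nat.le_sub_one_of_lt k.isLt)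
    (fun i _ => by rw [ha]; exact Set.notMem_empty i)]
  have h : (⟨n - 1, hn⟩ : Fin n) ∉ jumps a := by rw [ha]; exact Set.notMem_empty _
  simp only [jumps, Set.mem_ofPred_eq, not_not] at h
  rw [h, nextEntry, dif_neg]
  simp only
  omega

theorem flattenAt_of_le {k : Fin n} (hk : k ≤ j) : flattenAt a j k = nextEntry a j := if_pos hk

theorem flattenAt_of_gt {k : Fin n} (hk : j < k) : flattenAt a j k = a k := if_neg hk.not_ge

theorem nextEntry_flattenAt_of_lt {k : Fin n} (hk : k < j) :
    nextEntry (flattenAt a j) k = nextEntry a j := by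
  have hk' : (k : ℕ) < j := hk
  rw [nextEntry, dif_pos (by omega), flattenAt_of_le]
  exact hk'

theorem nextEntry_flattenAt_of_ge {k : Fin n} (hk : j ≤ k) :
    nextEntry (flattenAt a j) k = nextEntry a k := by
  unfold nextEntry
  split_ifs with h
  · exact flattenAt_of_gt (Nat.lt_succ_of_le hk)
  · rfl

theorem jumps_flattenAt (hj : IsLeast (jumps a) j) : jumps (flattenAt a j) = jumps a \ {j} := by
  ext k
  simp only [jumps, Set.mem_ofPred_eq, Set.mem_sdiff, Set.mem_singleton_iff]
  rcases lt_trichotomy k j with hk | hk | hk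
  · rw [flattenAt_of_le hk.le, nextEntry_flattenAt_of_lt hk]
    exact ⟨fun h => absurd rfl h, fun h => absurd (hj.2 h.1) hk.not_ge⟩
  · subst hk
    rw [flattenAt_of_le le_rfl, nextEntry_flattenAt_of_ge le_rfl]
    exact ⟨fun h => absurd rfl h, fun h => absurd rfl h.2⟩
  · rw [flattenAt_of_gt hk, nextEntry_flattenAt_of_ge hk.le]
    exact ⟨fun h => ⟨h, hk.ne'⟩, fun h => h.1⟩

theorem TiltedEquiv.flattenAt {u v : Equiv.Perm (Fin n)} (h : TiltedEquiv a u v) :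
    TiltedEquiv (flattenAt a j) u v := by
  intro k
  rcases lt_trichotomy k j with hk | hk | hk
  · rw [flattenAt_of_le hk.le, nextEntry_flattenAt_of_lt hk, cyclicIco_self]
    simp
  · subst hk
    rw [flattenAt_of_le le_rfl, nextEntry_flattenAt_of_ge le_rfl, cyclicIco_self]
    simp
  · rw [flattenAt_of_gt hk, nextEntry_flattenAt_of_ge hk.le]
    exact h k

/-- Rearranging the entries within a block without jumps stays in the class of `∼_a`. -/
theorem tiltedEquiv_mul_leadingPerms {l : Fin n} (h : ∀ i, i < l → i ∉ jumps a)
    {x : Equiv.Perm (Fin n)} (hx : x ∈ leadingPerms n (l + 1)) (w : Equiv.Perm (Fin n)) :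
    TiltedEquiv a (w * x) w := by
  intro k
  rcases lt_or_ge k l with hk | hk
  · have := h k hk
    simp only [jumps, Set.mem_ofPred_eq, not_not] at this
    rw [← this, cyclicIco_self]
    simp
  · rw [firstEntries_mul_leadingPerms hx (Nat.succ_le_succ hk)]

/-- Split permutations are equivalent for the comparison of `a` with its flattening. -/
theorem IsSplit.card_flattenAt (hj : IsLeast (jumps a) j) {p : ℕ} {u v : Equiv.Perm (Fin n)}
    (hu : IsSplit (a j) (nextEntry a j) p (j + 1) u) (hv : IsSplit (a j) (nextEntry a j) p (j + 1) v)
    (k : Fin n) : (firstEntries u (k + 1) ∩ cyclicIco (a k) (flattenAt a j k)).card =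
      (firstEntries v (k + 1) ∩ cyclicIco (a k) (flattenAt a j k)).card := by
  rcases le_or_gt k j with hk | hk
  · have hk' : (k : ℕ) + 1 ≤ j + 1 := Nat.succ_le_succ hk
    rw [flattenAt_of_le hk, eq_of_le_least hj hk, hu.card_inter hj.1 j.isLt hk',
      hv.card_inter hj.1 j.isLt hk']
  · rw [flattenAt_of_gt hk, cyclicIco_self]
    simp

theorem isFlattenableAt_iff (hj : IsLeast (jumps a) j) {w : Equiv.Perm (Fin n)} :
    IsFlattenableAt a j w ↔ ∃ p ≤ (j : ℕ) + 1, IsSplit (a j) (nextEntry a j) p (j + 1) w := by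
  have h0 : a ⟨0, j.pos⟩ = a j := eq_of_le_least hj (Nat.zero_le _)
  simp only [IsFlattenableAt, h0, IsSplit, Nat.lt_succ_iff]
  rfl

/-- If `v` is split and `u x` mixes the two parts of the block, then `T°_{u x,v,a}` is empty. -/
theorem pointCount_eq_zero {F : Type*} [Field F] {r s : Fin n} {p N : ℕ}
    (ha : ∀ k : Fin n, (k : ℕ) < N → a k = r) (hrs : r ≠ s) (hp : p ≤ N)
    {u v x : Equiv.Perm (Fin n)} (hu : IsSplit r s p N u) (hv : IsSplit r s p N v)
    (hx : x ∈ leadingPerms n N) (hx' : x ∉ splitPerms n N p) : pointCount F a (u * x) v = 0 := by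
  have hpn : 0 < p ∧ p - 1 < n := by
    by_contra hc
    refine hx' (mem_splitPerms_of_forall_lt hx fun k hk => ?_)
    have hkn := k.isLt
    have hxn := (x k).isLt
    omega
  have hempty : openTiltedRichardsonAt F a (u * x) v = ∅ := by
    refine Set.eq_empty_of_forall_notMem fun y hy => hx' ?_
    refine hu.mem_splitPerms hrs hp hx fun k hk => ?_
    have hak : a ⟨p - 1, hpn.2⟩ = r := ha _ (by simp only; omega)
    have h1 := apply_mem_cyclicIco_of_mem hy (k := ⟨p - 1, hpn.2⟩) (s := s) (by rwa [hak])
      (fun i hi => by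
        rw [hak]
        have hi' : (i : ℕ) ≤ p - 1 := hi
        exact hv.1 i (by omega)) (i := k) (Nat.le_sub_one_of_lt hk)
    rwa [hak] at h1
  rw [pointCount, hempty]
  simp

end Flattening

/-! ### Tilted standard elements -/

section TiltedBasis

variable {n : ℕ}

/-- The number of simple transpositions in a tilted word. -/
def swapCount (ws : List (Factor n)) : ℕ :=
  (ws.map fun f => match f with
    | Factor.s _ => 1
    | Factor.bar => 0).sum

theorem swapCount_append (ws ws' : List (Factor n)) :
    swapCount (ws ++ ws') = swapCount ws + swapCount ws' := by
  simp [swapCount]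

theorem swapCount_map_s (l : List (Fin (n - 1))) : swapCount (l.map Factor.s) = l.length := by
  induction l with
  | nil => rfl
  | cons i l ih =>
    rw [List.map_cons, List.length_cons, ← ih, add_comm]
    simp [swapCount]

theorem swapCount_bar (l : List (Factor n)) : swapCount (Factor.bar :: l) = swapCount l := by
  simp [swapCount]

theorem heckeWord_append (b : ℤ[T;T⁻¹]) (ws ws' : List (Factor n)) :
    heckeWord b (ws ++ ws') = heckeWord b ws * heckeWord b ws' := by
  simp [heckeWord]

theorem heckeWord_map_s (b : ℤ[T;T⁻¹]) (l : List (Fin (n - 1))) :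
    heckeWord b (l.map Factor.s) = (l.map (heckeUnit b)).prod := by
  simp [heckeWord, Function.comp_def]

theorem heckeWord_bar (b : ℤ[T;T⁻¹]) (l : List (Factor n)) :
    heckeWord b (Factor.bar :: l) = heckeWord b l := by
  simp [heckeWord]

theorem IsTiltedWord.append_s {a : Fin n → Fin n} {ws : List (Factor n)} {w : Equiv.Perm (Fin n)}
    (h : IsTiltedWord a ws w) {i : Fin (n - 1)} (hi' : lo i ∉ jumps a) :
    IsTiltedWord a (ws ++ [Factor.s i]) (w * simpleSwap i) := by
  cases h with
  | base _ ha l =>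
    rw [← wordProd_append_singleton, ← List.map_singleton, ← List.map_append]
    exact IsTiltedWord.base a ha _
  | step _ j hj pre w' hpre hflat l hl =>
    have := IsTiltedWord.step a j hj pre w' hpre hflat (l ++ [i]) (by
      intro k hk
      rcases List.mem_append.1 hk with hk | hk
      · exact hl k hk
      · rwa [List.mem_singleton.1 hk])
    rw [wordProd_append_singleton, ← mul_assoc] at this
    simpa using this

/-- The number of bars of a tilted word is the number of jumps. -/
theorem IsTiltedWord.length_eq {a : Fin n → Fin n} {ws : List (Factor n)} {w : Equiv.Perm (Fin n)}
    (h : IsTiltedWord a ws w) : ws.length = swapCount ws + (jumps a).ncard := by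
  induction h with
  | base a ha l => rw [swapCount_map_s, ha]; simp
  | step a j hj pre w' hpre hflat l hl ih =>
    have h1 : (jumps (flattenAt a j)).ncard + 1 = (jumps a).ncard := by
      rw [jumps_flattenAt hj]
      exact Set.ncard_sdiff_singleton_add_one hj.1 (Set.toFinite _)
    rw [swapCount_append, swapCount_bar, swapCount_map_s, List.length_append, List.length_cons,
      List.length_map, ih, ← h1]
    omega

/-- The Laurent polynomial `q^{ℓ_a(v) - ℓ_a(u)} ε(T_v⁻¹ T_u)`, for a family of elements `T_w`. -/
noncomputable def tracePoly (a : Fin n → Fin n) (T : Equiv.Perm (Fin n) → (HeckeAlgebra n (1 - qq))ˣ)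
    (u v : Equiv.Perm (Fin n)) : ℤ[T;T⁻¹] :=
  LaurentPolynomial.T (tiltedLength a v - tiltedLength a u) *
    heckeTrace (1 - qq) (↑((T v)⁻¹ * T u) : HeckeAlgebra n (1 - qq))

/-- The trace polynomials satisfy the same recursion as the point counts. -/
theorem tracePoly_recursion {a : Fin n → Fin n} {T : Equiv.Perm (Fin n) → (HeckeAlgebra n (1 - qq))ˣ}
    {u v : Equiv.Perm (Fin n)} {i : Fin (n - 1)}
    (hu : cyc (a (lo i)) (u (lo i)) < cyc (a (lo i)) (u (hi i)))
    (hv : cyc (a (lo i)) (v (lo i)) < cyc (a (lo i)) (v (hi i)))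
    (hTu : T (u * simpleSwap i) = T u * heckeUnit (1 - qq) i)
    (hTv : T (v * simpleSwap i) = T v * heckeUnit (1 - qq) i) :
    tracePoly a T (u * simpleSwap i) (v * simpleSwap i) = tracePoly a T u v ∧
      tracePoly a T u (v * simpleSwap i) =
        (qq - 1) * tracePoly a T u v + qq * tracePoly a T (u * simpleSwap i) v := by
  unfold tracePoly
  rw [tiltedLength_mul_simpleSwap hu, tiltedLength_mul_simpleSwap hv, hTu, hTv,
    heckeTrace_mul_heckeUnit]
  have h := qq_mul_heckeTrace_inv (1 - qq) (T u) (T v) i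
  set D := tiltedLength a v - tiltedLength a u with hD
  have e1 : tiltedLength a v + 1 - (tiltedLength a u + 1) = D := by rw [hD]; ring
  have e2 : tiltedLength a v + 1 - tiltedLength a u = D + 1 := by rw [hD]; ring
  have e3 : tiltedLength a v - (tiltedLength a u + 1) = D + -1 := by rw [hD]; ring
  refine ⟨by rw [e1], ?_⟩
  rw [e2, e3, LaurentPolynomial.T_add, LaurentPolynomial.T_add]
  have h1 : (LaurentPolynomial.T 1 : ℤ[T;T⁻¹]) = qq := rfl
  rw [h1, mul_assoc, h]
  linear_combination (-LaurentPolynomial.T D * heckeTrace (1 - qq)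
    (↑((T v)⁻¹ * (T u * heckeUnit (1 - qq) i)) : HeckeAlgebra n (1 - qq))) * qq_inv_mul

/-- `T_{gy} = T_g T_y` for a block permutation `y` whose inversions are not inversions for `g`. -/
theorem mul_heckeTUnit_of_inversions {b : ℤ[T;T⁻¹]} {α : Type*} [Preorder α] {κ : Fin n → α} {N : ℕ}
    {T : Equiv.Perm (Fin n) → (HeckeAlgebra n b)ˣ}
    (hT : ∀ w i, (hi i : ℕ) < N → κ (w (lo i)) < κ (w (hi i)) →
      T (w * simpleSwap i) = T w * heckeUnit b i)
    {g y : Equiv.Perm (Fin n)} (hy : y ∈ leadingPerms n N)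
    (h : ∀ p q, p < q → y q < y p → κ (g (y q)) < κ (g (y p))) :
    T (g * y) = T g * heckeTUnit b y := by
  refine Units.ext ?_
  rw [Units.val_mul, val_heckeTUnit]
  refine mul_heckeT_of_inversions b (f := fun w => (T w : HeckeAlgebra n b)) (κ := κ)
    (J := {i | (hi i : ℕ) < N}) (fun w i hiN hw => ?_) ?_ h
  · rw [hT w i hiN hw]
    rfl
  · rintro i ⟨p, q, hp, hq, hpq⟩
    have h1 := hi_lt_of_inversion hy (lt_of_le_of_lt hp ((lo_lt_hi i).trans_le hq)) hpq
    exact lt_of_le_of_lt (show (hi i : ℕ) ≤ q from hq) h1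

/-- The point counts and the trace polynomials agree if they do so for all `v` whose first block is
sorted: both satisfy the same recursion. -/
theorem pointCount_eq_of_increasesBelow {a : Fin n → Fin n} {r : Fin n} {N : ℕ}
    (ha : ∀ k : Fin n, (k : ℕ) < N → a k = r)
    {T : Equiv.Perm (Fin n) → (HeckeAlgebra n (1 - qq))ˣ}
    (hT : ∀ w i, (hi i : ℕ) < N → cyc r (w (lo i)) < cyc r (w (hi i)) →
      T (w * simpleSwap i) = T w * heckeUnit (1 - qq) i)
    (F : Type) [Field F] [Finite F]
    (h0 : ∀ v, IncreasesBelow r N v → ∀ u, TiltedEquiv a u v →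
      (pointCount F a u v : ℚ) = evalCard F (tracePoly a T u v))
    (v u : Equiv.Perm (Fin n)) (huv : TiltedEquiv a u v) :
    (pointCount F a u v : ℚ) = evalCard F (tracePoly a T u v) := by
  induction v using block_induction r N generalizing u with
  | h0 v hv => exact h0 v hv u huv
  | hs v i hiN hv ih =>
    have hlo : (lo i : ℕ) < N := lt_trans (show (lo i : ℕ) < hi i from lo_lt_hi i) hiN
    have hr := ha _ hlo
    have hai : a (lo i) = a (hi i) := by rw [hr, ha _ hiN]
    have huv' := huv.trans (tiltedEquiv_mul_simpleSwap hai v)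
    by_cases hu : cyc r (u (lo i)) < cyc r (u (hi i))
    · rw [(pointCount_recursion hai huv' (by rwa [hr]) (by rwa [hr])).2,
        (tracePoly_recursion (by rwa [hr]) (by rwa [hr]) (hT _ _ hiN hu) (hT _ _ hiN hv)).2]
      push_cast
      rw [map_add, map_mul, map_mul, map_sub, map_one, evalCard_qq, ih u huv',
        ih _ ((tiltedEquiv_mul_simpleSwap hai u).trans huv')]
    · have hu' : cyc r ((u * simpleSwap i) (lo i)) < cyc r ((u * simpleSwap i) (hi i)) := by
        rw [mul_simpleSwap_lo, mul_simpleSwap_hi]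
        exact lt_of_le_of_ne (not_lt.1 hu)
          fun h => lo_ne_hi i (u.injective (cyc_inj.1 h)).symm
      have huv'' := (tiltedEquiv_mul_simpleSwap hai u).trans huv'
      have h1 := (pointCount_recursion (F := F) hai huv'' (by rwa [hr]) (by rwa [hr])).1
      have h2 := (tracePoly_recursion (a := a) (T := T) (by rwa [hr]) (by rwa [hr]) (hT _ _ hiN hu')
        (hT _ _ hiN hv)).1
      rw [simpleSwap_mul_self] at h1 h2
      rw [h1, h2, ih _ huv'']

/-- Tilted analogues of the lengths `ℓ(w)` and of the standard basis elements `T_w` of the Hecke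
algebra, with the properties that determine them: `len w` is the least number of simple transpositions
in an `a`-tilted word of `w`, every word attaining it has product `elt w`, and the traces
`ε(elt(v)⁻¹ elt(u))` count the points of the tilted Richardson varieties. -/
structure TiltedBasis (a : Fin n → Fin n) where
  /-- The number of simple transpositions in a tilted reduced word. -/
  len : Equiv.Perm (Fin n) → ℤ
  /-- The product of the generators along a tilted reduced word. -/
  elt : Equiv.Perm (Fin n) → (HeckeAlgebra n (1 - qq))ˣ
  len_sub : ∀ u v, TiltedEquiv a u v → len v - len u = tiltedLength a v - tiltedLength a u
  elt_mul : ∀ w i, a (lo i) = a (hi i) → cyc (a (lo i)) (w (lo i)) < cyc (a (lo i)) (w (hi i)) →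
    elt (w * simpleSwap i) = elt w * heckeUnit (1 - qq) i
  len_le : ∀ ws w, IsTiltedWord a ws w → len w ≤ swapCount ws ∧
    (len w = swapCount ws → heckeWord (1 - qq) ws = elt w)
  exists_word : ∀ w, ∃ ws, IsTiltedWord a ws w ∧ (swapCount ws : ℤ) = len w
  pointCount_eq : ∀ (F : Type) [Field F] [Finite F] (v u : Equiv.Perm (Fin n)), TiltedEquiv a u v →
    (pointCount F a u v : ℚ) = evalCard F (tracePoly a elt u v)

section Construction

variable {a : Fin n → Fin n} {len : Equiv.Perm (Fin n) → ℤ}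
  {elt : Equiv.Perm (Fin n) → (HeckeAlgebra n (1 - qq))ˣ}

theorem len_mul_simpleSwap
    (len_sub : ∀ u v, TiltedEquiv a u v → len v - len u = tiltedLength a v - tiltedLength a u)
    {w : Equiv.Perm (Fin n)} {i : Fin (n - 1)} (ha : a (lo i) = a (hi i))
    (hw : cyc (a (lo i)) (w (lo i)) < cyc (a (lo i)) (w (hi i))) :
    len (w * simpleSwap i) = len w + 1 := by
  have h1 := len_sub _ _ (tiltedEquiv_mul_simpleSwap ha w).symm
  rw [tiltedLength_mul_simpleSwap hw] at h1
  linarith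

/-- Appending letters to a word keeps the length bound, with equality only for products that keep
lengthening. -/
theorem len_le_of_append
    (len_sub : ∀ u v, TiltedEquiv a u v → len v - len u = tiltedLength a v - tiltedLength a u)
    (elt_mul : ∀ w i, a (lo i) = a (hi i) → cyc (a (lo i)) (w (lo i)) < cyc (a (lo i)) (w (hi i)) →
      elt (w * simpleSwap i) = elt w * heckeUnit (1 - qq) i)
    {w : Equiv.Perm (Fin n)} {c : ℤ} {h : (HeckeAlgebra n (1 - qq))ˣ} (hc : len w ≤ c)
    (hh : len w = c → h = elt w) (l : List (Fin (n - 1))) (hl : ∀ i ∈ l, lo i ∉ jumps a) :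
    len (w * wordProd l) ≤ c + l.length ∧
      (len (w * wordProd l) = c + l.length →
        h * (l.map (heckeUnit (1 - qq))).prod = elt (w * wordProd l)) := by
  induction l using List.reverseRecOn with
  | nil => simpa [wordProd] using ⟨hc, hh⟩
  | append_singleton l i ih =>
    obtain ⟨h1, h2⟩ := ih fun k hk => hl k (List.mem_append_left _ hk)
    have ha := lo_notMem_jumps.1 (hl i (by simp))
    rw [wordProd_append_singleton, ← mul_assoc, List.length_append, List.length_singleton,
      List.map_append, List.prod_append, List.map_singleton, List.prod_singleton, ← mul_assoc]
    push_cast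
    set g := w * wordProd l
    by_cases hg : cyc (a (lo i)) (g (lo i)) < cyc (a (lo i)) (g (hi i))
    · rw [len_mul_simpleSwap len_sub ha hg, elt_mul _ _ ha hg]
      exact ⟨by linarith, fun h => by rw [h2 (by linarith)]⟩
    · have hg' : cyc (a (lo i)) ((g * simpleSwap i) (lo i)) <
          cyc (a (lo i)) ((g * simpleSwap i) (hi i)) := by
        rw [mul_simpleSwap_lo, mul_simpleSwap_hi]
        exact lt_of_le_of_ne (not_lt.1 hg) fun h => lo_ne_hi i (g.injective (cyc_inj.1 h)).symm
      have h3 := len_mul_simpleSwap len_sub ha hg'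
      rw [simpleSwap_mul_self] at h3
      exact ⟨by linarith, fun h => by linarith⟩

theorem exists_word_of_increasesBelow
    (len_sub : ∀ u v, TiltedEquiv a u v → len v - len u = tiltedLength a v - tiltedLength a u)
    {r : Fin n} {N : ℕ} (ha : ∀ k : Fin n, (k : ℕ) < N → a k = r)
    (h0 : ∀ w, IncreasesBelow r N w → ∃ ws, IsTiltedWord a ws w ∧ (swapCount ws : ℤ) = len w)
    (w : Equiv.Perm (Fin n)) : ∃ ws, IsTiltedWord a ws w ∧ (swapCount ws : ℤ) = len w := by
  induction w using block_induction r N with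
  | h0 w hw => exact h0 w hw
  | hs w i hiN hw ih =>
    have hr := ha _ (lt_trans (show (lo i : ℕ) < hi i from lo_lt_hi i) hiN)
    have hai : a (lo i) = a (hi i) := by rw [hr, ha _ hiN]
    obtain ⟨ws, h1, h2⟩ := ih
    refine ⟨ws ++ [Factor.s i], h1.append_s (lo_notMem_jumps.2 hai), ?_⟩
    rw [len_mul_simpleSwap len_sub hai (by rwa [hr]), ← h2, swapCount_append]
    simp [swapCount]

end Construction

/-- Without jumps, the tilted basis is the standard basis. -/
noncomputable def TiltedBasis.ofJumpsEmpty {a : Fin n → Fin n} (ha : jumps a = ∅) :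
    TiltedBasis a :=
  have h0 := val_eq_zero_of_jumps_eq_empty ha
  have hcyc : ∀ k x : Fin n, cyc (a k) x = x := fun k x => by rw [cyc_eq, h0]; simp
  have hlen : ∀ w, tiltedLength a w = permLength w := fun w => by
    have : ∀ k, Finset.Iio (a k) = ∅ := fun k => by
      ext z
      simp [Fin.lt_def, h0]
    simp [tiltedLength, this]
  have len_sub : ∀ u v, TiltedEquiv a u v →
      (permLength v : ℤ) - permLength u = tiltedLength a v - tiltedLength a u := fun u v _ => by
    rw [hlen, hlen]
  have elt_mul : ∀ w i, a (lo i) = a (hi i) →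
      cyc (a (lo i)) (w (lo i)) < cyc (a (lo i)) (w (hi i)) →
      heckeTUnit (1 - qq) (w * simpleSwap i) =
        heckeTUnit (1 - qq) w * heckeUnit (1 - qq) i := fun w i _ hw => by
    rw [hcyc, hcyc] at hw
    exact heckeTUnit_mul_simpleSwap _ hw
  { len := fun w => permLength w
    elt := heckeTUnit (1 - qq)
    len_sub := len_sub
    elt_mul := elt_mul
    len_le := fun ws w h => by
      cases h with
      | base _ _ l =>
        have := len_le_of_append (len := fun w => (permLength w : ℤ)) (elt := heckeTUnit (1 - qq))
          len_sub elt_mul (w := 1) (c := 0) (h := 1) (by simp [permLength_one])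
          (fun _ => (heckeTUnit_one _).symm) l (fun i _ => by rw [ha]; exact Set.notMem_empty _)
        rw [swapCount_map_s, heckeWord_map_s]
        simpa using this
      | step _ j hj => exact absurd hj.1 (by rw [ha]; exact Set.notMem_empty _)
    exists_word := fun w => by
      obtain ⟨l, rfl, hl⟩ := exists_reduced w
      exact ⟨_, IsTiltedWord.base a ha l, by rw [swapCount_map_s, hl]⟩
    pointCount_eq := fun F _ _ v u huv => by
      -- for `n = 0` there is no base point for a cyclic order
      have hn : 0 = n ∨ 0 < n := (Nat.zero_le n).eq_or_lt
      rcases hn with rfl | hn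
      · have hv : v = 1 := Subsingleton.elim _ _
        have hu : u = 1 := Subsingleton.elim _ _
        rw [hv, hu, pointCount_one h0, if_pos rfl]
        simp [tracePoly, heckeTUnit_one, ← heckeT_one, heckeTrace_heckeT]
      refine pointCount_eq_of_increasesBelow (r := ⟨0, hn⟩) (N := n)
        (fun k _ => Fin.ext (h0 k)) (fun w i _ hw => ?_) F (fun v hv u _ => ?_) v u huv
      · refine heckeTUnit_mul_simpleSwap _ ?_
        rw [cyc_eq, cyc_eq] at hw
        simpa using hw
      · have hv1 : v = 1 := eq_one_of_increasing fun i => by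
          have := hv i (hi i).isLt
          rw [cyc_eq, cyc_eq] at this
          simpa using this
        rw [hv1, pointCount_one h0, tracePoly, heckeTUnit_one, inv_one, one_mul, val_heckeTUnit,
          heckeTrace_heckeT]
        split_ifs with hu
        · simp [hu]
        · simp }

end TiltedBasis

/-! ### Removing a jump -/

section RemoveJump

variable {n : ℕ} {a : Fin n → Fin n} {j : Fin n}

theorem hi_le_of_lt {i : Fin (n - 1)} (h : (hi i : ℕ) < (j : ℕ) + 1) : lo i ≤ j ∧ hi i ≤ j := by
  have h1 : (lo i : ℕ) < hi i := lo_lt_hi i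
  constructor <;> simp only [Fin.le_def] <;> omega

/-- In the flattened tilt, all positions of the first block allow multiplication. -/
theorem TiltedBasis.flatten_mul (B : TiltedBasis (flattenAt a j)) (w : Equiv.Perm (Fin n))
    (i : Fin (n - 1)) (hiN : (hi i : ℕ) < (j : ℕ) + 1)
    (hw : cyc (nextEntry a j) (w (lo i)) < cyc (nextEntry a j) (w (hi i))) :
    B.elt (w * simpleSwap i) = B.elt w * heckeUnit (1 - qq) i := by
  obtain ⟨h1, h2⟩ := hi_le_of_lt hiN
  refine B.elt_mul w i ?_ ?_
  · rw [flattenAt_of_le h1, flattenAt_of_le h2]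
  · rwa [flattenAt_of_le h1]

/-- The elements of the flattened basis multiply along split blocks. -/
theorem TiltedBasis.flatten_mul_splitPerms (B : TiltedBasis (flattenAt a j)) {p : ℕ}
    {w x : Equiv.Perm (Fin n)} (hw : IncreasesBelow (a j) (j + 1) w)
    (hs : IsSplit (a j) (nextEntry a j) p (j + 1) w) (hx : x ∈ splitPerms n (j + 1) p) :
    B.elt (w * x) = B.elt w * heckeTUnit (1 - qq) x := by
  refine mul_heckeTUnit_of_inversions B.flatten_mul hx.1 fun k l hkl h => ?_
  have hl := hi_lt_of_inversion hx.1 hkl h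
  have h1 := (leadingPerms_apply_lt_iff hx.1 le_rfl k).2 (lt_trans hkl hl)
  refine hs.cyc_lt_cyc hw h h1 ?_
  have h2 := hx.2 k
  have h3 := hx.2 l
  have h4 : (k : ℕ) < l := hkl
  have h5 : (x l : ℕ) < x k := h
  omega

theorem notMem_jumps_flattenAt {i : Fin n} (hi' : i < j) : i ∉ jumps (flattenAt a j) := by
  simp only [jumps, Set.mem_ofPred_eq, not_not]
  rw [flattenAt_of_le hi'.le, nextEntry_flattenAt_of_lt hi']

/-- The trace forms vanish on products that mix the two parts of a split block. Let `r` be the value of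
the tilt on the block and `s` the next one. In terms of the `<_s`-sorted permutations this is the vanishing of point counts, for the flattened tilt; the
`<_r`-sorted ones differ from these by the block shift `d`, and conjugation by `T_d` preserves the
elements that mix the parts. -/
theorem TiltedBasis.heckeTrace_eq_zero (B : TiltedBasis (flattenAt a j)) (hj : IsLeast (jumps a) j)
    {p : ℕ} (hp : p ≤ (j : ℕ) + 1) {u v x : Equiv.Perm (Fin n)}
    (hu : IncreasesBelow (a j) (j + 1) u) (hv : IncreasesBelow (a j) (j + 1) v)
    (hus : IsSplit (a j) (nextEntry a j) p (j + 1) u)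
    (hvs : IsSplit (a j) (nextEntry a j) p (j + 1) v) (huv : TiltedEquiv (flattenAt a j) u v)
    (hx : x ∈ leadingPerms n (j + 1)) (hx' : x ∉ splitPerms n (j + 1) p) :
    heckeTrace (1 - qq) (↑((B.elt v)⁻¹ * (B.elt u * heckeTUnit (1 - qq) x)) :
      HeckeAlgebra n (1 - qq)) = 0 := by
  obtain ⟨m, hm⟩ := Nat.exists_eq_add_of_le hp
  have hpm : p + m ≤ n := hm ▸ j.isLt
  set d := blockShift n p m hpm with hd
  have hdmem : d ∈ leadingPerms n (j + 1) := hm ▸ blockShift_mem hpm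
  -- the permutations sorted for `<_s`
  have hinc : ∀ w, IncreasesBelow (a j) (j + 1) w → IsSplit (a j) (nextEntry a j) p (j + 1) w →
      IncreasesBelow (nextEntry a j) (j + 1) (w * d⁻¹) ∧
        IsSplit (nextEntry a j) (a j) m (j + 1) (w * d⁻¹) := by
    intro w hw hws
    rw [hm] at hw hws ⊢
    exact ⟨hws.increasesBelow_mul_blockShift_inv hw hpm, hws.mul_blockShift_inv hpm⟩
  obtain ⟨hu1, hu2⟩ := hinc u hu hus
  obtain ⟨hv1, hv2⟩ := hinc v hv hvs
  have hmul : ∀ w, IncreasesBelow (nextEntry a j) (j + 1) w → ∀ y ∈ leadingPerms n (j + 1),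
      B.elt (w * y) = B.elt w * heckeTUnit (1 - qq) y := by
    intro w hw y hy
    refine mul_heckeTUnit_of_inversions B.flatten_mul hy fun k l hkl h => ?_
    have hl := hi_lt_of_inversion hy hkl h
    exact hw.lt h ((leadingPerms_apply_lt_iff hy le_rfl k).2 (lt_trans hkl hl))
  have hnj : ∀ i, i < j → i ∉ jumps (flattenAt a j) := fun i hi' => notMem_jumps_flattenAt hi'
  have hequiv : ∀ w y, y ∈ leadingPerms n (j + 1) → TiltedEquiv (flattenAt a j) (w * y) w :=
    fun w y hy => tiltedEquiv_mul_leadingPerms hnj hy w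
  have hvan : ∀ w ∈ ((leadingPerms n (p + m) : Set (Equiv.Perm (Fin n))) \ splitPerms n (p + m) m),
      heckeTrace (1 - qq) ((↑((B.elt (v * d⁻¹))⁻¹ * B.elt (u * d⁻¹)) : HeckeAlgebra n (1 - qq)) *
        heckeT (1 - qq) w) = 0 := by
    rintro w ⟨hw, hw'⟩
    rw [← hm] at hw hw'
    have heq : TiltedEquiv (flattenAt a j) (u * d⁻¹ * w) (v * d⁻¹) :=
      ((hequiv _ _ hw).trans (hequiv _ _ (inv_mem hdmem))).trans
        (huv.trans (hequiv _ _ (inv_mem hdmem)).symm)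
    have htp : tracePoly (flattenAt a j) B.elt (u * d⁻¹ * w) (v * d⁻¹) = 0 := by
      refine eq_zero_of_evalCard fun F _ _ => ?_
      rw [← B.pointCount_eq F _ _ heq, pointCount_eq_zero (r := nextEntry a j) (s := a j) (p := m)
        (fun k hk => flattenAt_of_le (Nat.lt_succ_iff.1 hk)) (Ne.symm hj.1) (by omega) hu2 hv2 hw hw',
        Int.cast_zero]
    rw [tracePoly, (LaurentPolynomial.isUnit_T _).mul_right_eq_zero, hmul _ hu1 w hw, ← mul_assoc,
      Units.val_mul, val_heckeTUnit] at htp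
    exact htp
  have hvan' : ∀ h ∈ Submodule.span ℤ[T;T⁻¹] (heckeT (1 - qq) ''
      ((leadingPerms n (p + m) : Set (Equiv.Perm (Fin n))) \ splitPerms n (p + m) m)),
      heckeTrace (1 - qq) ((↑((B.elt (v * d⁻¹))⁻¹ * B.elt (u * d⁻¹)) : HeckeAlgebra n (1 - qq)) *
        h) = 0 := by
    intro h hh
    induction hh using Submodule.span_induction with
    | mem y hy => obtain ⟨w, hw, rfl⟩ := hy; exact hvan w hw
    | zero => rw [mul_zero, map_zero]
    | add y z _ _ hy hz => rw [mul_add, map_add, hy, hz, add_zero]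
    | smul c y _ hy => rw [mul_smul_comm, map_smul, hy, smul_zero]
  have hconj := hvan' _ (conj_blockShift_mem_span (1 - qq) hpm (x := x) (hm ▸ hx) (hm ▸ hx'))
  have hu3 := hmul _ hu1 d hdmem
  have hv3 := hmul _ hv1 d hdmem
  rw [inv_mul_cancel_right] at hu3 hv3
  rw [← hd, ← val_heckeTUnit, ← val_heckeTUnit, ← Units.val_mul, ← Units.val_mul, ← Units.val_mul] at hconj
  have e : (B.elt v)⁻¹ * (B.elt u * heckeTUnit (1 - qq) x) = (heckeTUnit (1 - qq) d)⁻¹ *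
      ((B.elt (v * d⁻¹))⁻¹ * B.elt (u * d⁻¹) * (heckeTUnit (1 - qq) d * heckeTUnit (1 - qq) x)) := by
    rw [hu3, hv3, mul_inv_rev]
    simp only [mul_assoc]
  rw [e, Units.val_mul, heckeTrace_mul_comm, ← Units.val_mul, mul_assoc]
  exact hconj

end RemoveJump

section Step

variable {n : ℕ} {a : Fin n → Fin n} {j : Fin n}

/-- The tilted length of a word, built from that of the flattened tilt: sort the first block. -/
noncomputable def TiltedBasis.stepLen (B : TiltedBasis (flattenAt a j)) (w : Equiv.Perm (Fin n)) : ℤ :=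
  B.len (sortBlock (a j) (j + 1) w) + (tiltedLength a w - tiltedLength a (sortBlock (a j) (j + 1) w))

/-- The tilted standard element, built from that of the flattened tilt: sort the first block. -/
noncomputable def TiltedBasis.stepElt (B : TiltedBasis (flattenAt a j)) (w : Equiv.Perm (Fin n)) :
    (HeckeAlgebra n (1 - qq))ˣ :=
  B.elt (sortBlock (a j) (j + 1) w) * heckeTUnit (1 - qq) (blockPerm (a j) (j + 1) w)

theorem notMem_jumps_of_lt (hj : IsLeast (jumps a) j) {i : Fin n} (hi' : i < j) : i ∉ jumps a :=
  fun h => (hj.2 h).not_gt hi'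

theorem tiltedEquiv_sortBlock (hj : IsLeast (jumps a) j) (w : Equiv.Perm (Fin n)) :
    TiltedEquiv a (sortBlock (a j) (j + 1) w) w := by
  have h := tiltedEquiv_mul_leadingPerms (fun i hi' => notMem_jumps_of_lt hj hi')
    (blockPerm_mem (a j) (j + 1) w) (sortBlock (a j) (j + 1) w)
  rw [sortBlock_mul_blockPerm] at h
  exact h.symm

theorem TiltedEquiv.isSplit_unique (hj : IsLeast (jumps a) j) {p p' : ℕ} {u v : Equiv.Perm (Fin n)}
    (huv : TiltedEquiv a u v) (hp : p ≤ (j : ℕ) + 1) (hp' : p' ≤ (j : ℕ) + 1)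
    (hu : IsSplit (a j) (nextEntry a j) p (j + 1) u)
    (hv : IsSplit (a j) (nextEntry a j) p' (j + 1) v) : p = p' :=
  hu.unique hv hj.1 j.isLt hp hp' (huv j)

/-- Sorting the block of a split permutation only rearranges the two parts. -/
theorem IsSplit.sortBlock (hj : IsLeast (jumps a) j) {p : ℕ} (hp : p ≤ (j : ℕ) + 1)
    {w : Equiv.Perm (Fin n)} (hw : IsSplit (a j) (nextEntry a j) p (j + 1) w) :
    IsSplit (a j) (nextEntry a j) p (j + 1) (sortBlock (a j) (j + 1) w) ∧
      blockPerm (a j) (j + 1) w ∈ splitPerms n (j + 1) p := by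
  obtain ⟨p', hp', hs⟩ := (sortBlock_increases (a j) (j + 1) w).exists_isSplit j.isLt hj.1
  obtain rfl := (tiltedEquiv_sortBlock hj w).isSplit_unique hj hp' hp hs hw
  refine ⟨hs, hs.mem_splitPerms hj.1 hp (blockPerm_mem _ _ _) fun k hk => ?_⟩
  rw [sortBlock_mul_blockPerm]
  exact hw.1 k hk

/-- On flattenable permutations the tilted basis is that of the flattened tilt. -/
theorem TiltedBasis.stepElt_of_isSplit (B : TiltedBasis (flattenAt a j)) (hj : IsLeast (jumps a) j)
    {p : ℕ} (hp : p ≤ (j : ℕ) + 1) {w : Equiv.Perm (Fin n)}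
    (hw : IsSplit (a j) (nextEntry a j) p (j + 1) w) : B.stepElt w = B.elt w := by
  obtain ⟨h1, h2⟩ := hw.sortBlock hj hp
  rw [stepElt, ← B.flatten_mul_splitPerms (sortBlock_increases _ _ _) h1 h2, sortBlock_mul_blockPerm]

theorem TiltedBasis.stepLen_of_isSplit (B : TiltedBasis (flattenAt a j)) (hj : IsLeast (jumps a) j)
    {p : ℕ} (hp : p ≤ (j : ℕ) + 1) {w : Equiv.Perm (Fin n)}
    (hw : IsSplit (a j) (nextEntry a j) p (j + 1) w) : B.stepLen w = B.len w := by
  obtain ⟨h1, h2⟩ := hw.sortBlock hj hp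
  have h3 := B.len_sub _ _ (tiltedEquiv_sortBlock hj w).flattenAt
  have h4 := tiltedLength_sub_eq (IsSplit.card_flattenAt hj h1 hw)
  rw [stepLen]
  linarith

theorem TiltedBasis.stepLen_sub (B : TiltedBasis (flattenAt a j)) (hj : IsLeast (jumps a) j)
    (u v : Equiv.Perm (Fin n)) (huv : TiltedEquiv a u v) :
    B.stepLen v - B.stepLen u = tiltedLength a v - tiltedLength a u := by
  obtain ⟨p, hp, hu⟩ := (sortBlock_increases (a j) (j + 1) u).exists_isSplit j.isLt hj.1
  obtain ⟨p', hp', hv⟩ := (sortBlock_increases (a j) (j + 1) v).exists_isSplit j.isLt hj.1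
  have huv' := ((tiltedEquiv_sortBlock hj u).trans huv).trans (tiltedEquiv_sortBlock hj v).symm
  obtain rfl := huv'.isSplit_unique hj hp hp' hu hv
  have h1 := B.len_sub _ _ huv'.flattenAt
  have h2 := tiltedLength_sub_eq (IsSplit.card_flattenAt hj hu hv)
  rw [stepLen, stepLen]
  linarith

theorem TiltedBasis.stepElt_mul (B : TiltedBasis (flattenAt a j)) (hj : IsLeast (jumps a) j)
    (w : Equiv.Perm (Fin n)) (i : Fin (n - 1)) (ha : a (lo i) = a (hi i))
    (hw : cyc (a (lo i)) (w (lo i)) < cyc (a (lo i)) (w (hi i))) :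
    B.stepElt (w * simpleSwap i) = B.stepElt w * heckeUnit (1 - qq) i := by
  have hinc := sortBlock_increases (a j) (j + 1) w
  have hx := blockPerm_mem (a j) (j + 1) w
  have hwx := sortBlock_mul_blockPerm (a j) (j + 1) w
  unfold stepElt
  set w₀ := TiltedRichardson.sortBlock (a j) (j + 1) w
  set x := blockPerm (a j) (j + 1) w
  have hlt : (lo i : ℕ) < hi i := lo_lt_hi i
  have hne : lo i ≠ j := by
    intro h
    rw [← lo_notMem_jumps, h] at ha
    exact ha hj.1
  rcases lt_or_gt_of_ne hne with h | h
  · -- both positions lie in the first block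
    have hiN : (hi i : ℕ) < j + 1 := Nat.succ_lt_succ h
    have hup : x (lo i) < x (hi i) := by
      rw [eq_of_le_least hj h.le, ← hwx] at hw
      by_contra hc
      have hc' : x (hi i) < x (lo i) := lt_of_le_of_ne (not_lt.1 hc) (x.injective.ne (lo_ne_hi i)).symm
      exact hw.not_gt (hinc.lt hc' ((leadingPerms_apply_lt_iff hx le_rfl _).2 (by omega)))
    have e : w * simpleSwap i = w₀ * (x * simpleSwap i) := by rw [← mul_assoc, hwx]
    obtain ⟨e1, e2⟩ := sortBlock_mul hinc (mul_mem hx (simpleSwap_mem_leadingPerms hiN))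
    rw [e, e1, e2, heckeTUnit_mul_simpleSwap _ hup, mul_assoc]
  · -- both positions lie beyond the first block
    have h' : (j : ℕ) + 1 ≤ lo i := h
    have hhi : j < hi i := h.trans (lo_lt_hi i)
    have hcomm : x * simpleSwap i = simpleSwap i * x := by
      have := Equiv.mul_swap_eq_swap_mul x (lo i) (hi i)
      rwa [hx (lo i) h', hx (hi i) (by omega)] at this
    have hinc' : IncreasesBelow (a j) (j + 1) (w₀ * simpleSwap i) := by
      intro k hk
      have hk' : (lo k : ℕ) < hi k := lo_lt_hi k
      rw [mul_simpleSwap_of_ne, mul_simpleSwap_of_ne]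
      · exact hinc k hk
      all_goals
        rw [ne_eq, Fin.ext_iff]
        omega
    have e : w * simpleSwap i = w₀ * simpleSwap i * x := by
      rw [mul_assoc, ← hcomm, ← mul_assoc, hwx]
    obtain ⟨e1, e2⟩ := sortBlock_mul hinc' hx
    have h1 : w₀ (lo i) = w (lo i) := sortBlock_apply w h'
    have h2 : w₀ (hi i) = w (hi i) := sortBlock_apply w (by omega)
    rw [e, e1, e2, B.elt_mul w₀ i (by rw [flattenAt_of_gt h, flattenAt_of_gt hhi, ha])
      (by rwa [flattenAt_of_gt h, h1, h2]), mul_assoc, mul_assoc, heckeUnit_comm_heckeTUnit _ hx h']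

theorem TiltedBasis.step_len_le (B : TiltedBasis (flattenAt a j)) (hj : IsLeast (jumps a) j)
    (ws : List (Factor n)) (w : Equiv.Perm (Fin n)) (h : IsTiltedWord a ws w) :
    B.stepLen w ≤ swapCount ws ∧
      (B.stepLen w = swapCount ws → heckeWord (1 - qq) ws = B.stepElt w) := by
  cases h with
  | base _ ha => exact absurd hj.1 (by rw [ha]; exact Set.notMem_empty _)
  | step _ j' hj' pre w' hpre hflat l hl =>
    obtain rfl := hj'.unique hj
    obtain ⟨p, hp, hs⟩ := (isFlattenableAt_iff hj).1 hflat
    obtain ⟨h1, h2⟩ := B.len_le pre w' hpre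
    have h3 := len_le_of_append (B.stepLen_sub hj) (B.stepElt_mul hj)
      (w := w') (c := swapCount pre) (h := heckeWord (1 - qq) pre)
      (by rwa [B.stepLen_of_isSplit hj hp hs])
      (by rwa [B.stepLen_of_isSplit hj hp hs, B.stepElt_of_isSplit hj hp hs]) l hl
    rw [swapCount_append, swapCount_bar, swapCount_map_s, heckeWord_append, heckeWord_bar,
      heckeWord_map_s]
    push_cast
    exact h3

theorem TiltedBasis.step_exists_word (B : TiltedBasis (flattenAt a j)) (hj : IsLeast (jumps a) j)
    (w : Equiv.Perm (Fin n)) : ∃ ws, IsTiltedWord a ws w ∧ (swapCount ws : ℤ) = B.stepLen w := by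
  refine exists_word_of_increasesBelow (B.stepLen_sub hj) (r := a j) (N := j + 1)
    (fun k hk => eq_of_le_least hj (Nat.lt_succ_iff.1 hk)) (fun w hw => ?_) w
  obtain ⟨p, hp, hs⟩ := hw.exists_isSplit j.isLt hj.1
  obtain ⟨ws, h1, h2⟩ := B.exists_word w
  have h3 := IsTiltedWord.step a j hj ws w h1 ((isFlattenableAt_iff hj).2 ⟨p, hp, hs⟩) []
    (fun _ h => absurd h List.not_mem_nil)
  refine ⟨_, by simpa [wordProd] using h3, ?_⟩
  rw [B.stepLen_of_isSplit hj hp hs, ← h2, swapCount_append, swapCount_bar]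
  simp [swapCount]

theorem TiltedBasis.step_pointCount_eq (B : TiltedBasis (flattenAt a j)) (hj : IsLeast (jumps a) j)
    (F : Type) [Field F] [Finite F] (v u : Equiv.Perm (Fin n)) (huv : TiltedEquiv a u v) :
    (pointCount F a u v : ℚ) = evalCard F (tracePoly a B.stepElt u v) := by
  have ha : ∀ k : Fin n, (k : ℕ) < j + 1 → a k = a j :=
    fun k hk => eq_of_le_least hj (Nat.lt_succ_iff.1 hk)
  refine pointCount_eq_of_increasesBelow ha (fun w i hiN hw => ?_) F (fun v hv u huv => ?_) v u huv
  · obtain ⟨h1, h2⟩ := hi_le_of_lt hiN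
    exact B.stepElt_mul hj w i (by rw [eq_of_le_least hj h1, eq_of_le_least hj h2])
      (by rwa [eq_of_le_least hj h1])
  obtain ⟨p, hp, hvs⟩ := hv.exists_isSplit j.isLt hj.1
  obtain ⟨p', hp', hus⟩ := (sortBlock_increases (a j) (j + 1) u).exists_isSplit j.isLt hj.1
  have huv' := (tiltedEquiv_sortBlock hj u).trans huv
  obtain rfl := huv'.isSplit_unique hj hp' hp hus hvs
  by_cases hx : blockPerm (a j) (j + 1) u ∈ splitPerms n (j + 1) p'
  · -- `u` is flattenable as well, and nothing changes under flattening
    have hus' := hus.mul hx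
    rw [sortBlock_mul_blockPerm] at hus'
    have hcard := IsSplit.card_flattenAt hj hus' hvs
    rw [pointCount, openTiltedRichardsonAt_eq hcard, tracePoly, tiltedLength_sub_eq hcard,
      B.stepElt_of_isSplit hj hp' hus', B.stepElt_of_isSplit hj hp' hvs]
    exact B.pointCount_eq F v u huv.flattenAt
  · have h1 : pointCount F a u v = 0 := by
      have := pointCount_eq_zero (F := F) ha hj.1 hp' hus hvs (blockPerm_mem (a j) (j + 1) u) hx
      rwa [sortBlock_mul_blockPerm] at this
    rw [h1, tracePoly, B.stepElt_of_isSplit hj hp' hvs, stepElt,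
      B.heckeTrace_eq_zero hj hp' (sortBlock_increases _ _ _) hv hus hvs huv'.flattenAt
        (blockPerm_mem _ _ _) hx]
    simp

/-- The tilted basis for a tilt with a jump, from the one for its flattening. -/
noncomputable def TiltedBasis.step (B : TiltedBasis (flattenAt a j)) (hj : IsLeast (jumps a) j) :
    TiltedBasis a where
  len := B.stepLen
  elt := B.stepElt
  len_sub := B.stepLen_sub hj
  elt_mul := B.stepElt_mul hj
  len_le := B.step_len_le hj
  exists_word := B.step_exists_word hj
  pointCount_eq := fun F _ _ => B.step_pointCount_eq hj F

/-- Every tilt has a tilted basis, by flattening one jump at a time. -/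
theorem TiltedBasis.nonempty (a : Fin n → Fin n) : Nonempty (TiltedBasis a) := by
  induction hm : (jumps a).ncard generalizing a with
  | zero => exact ⟨TiltedBasis.ofJumpsEmpty ((Set.ncard_eq_zero (Set.toFinite _)).1 hm)⟩
  | succ m ih =>
    have hne : (jumps a).Nonempty := Set.nonempty_of_ncard_ne_zero (by omega)
    obtain ⟨j, hj⟩ : ∃ j, IsLeast (jumps a) j := by
      obtain ⟨j, hj, hmin⟩ := WellFounded.has_min (wellFounded_lt (α := Fin n)) (jumps a) hne
      exact ⟨j, hj, fun k hk => not_lt.1 (hmin k hk)⟩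
    obtain ⟨B⟩ := ih (flattenAt a j) (by
      have := Set.ncard_sdiff_singleton_add_one hj.1 (Set.toFinite _)
      rw [jumps_flattenAt hj]
      omega)
    exact ⟨B.step hj⟩

/-- A tilted reduced word has as many simple transpositions as the tilted length prescribes, and
its product is the tilted standard element. -/
theorem TiltedBasis.of_isTiltedReducedWord (B : TiltedBasis a) {ws : List (Factor n)}
    {w : Equiv.Perm (Fin n)} (h : IsTiltedReducedWord a ws w) :
    (swapCount ws : ℤ) = B.len w ∧ heckeWord (1 - qq) ws = B.elt w := by
  obtain ⟨ws', h1, h2⟩ := B.exists_word w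
  have h3 := h.2 ws' h1
  rw [h.1.length_eq, h1.length_eq] at h3
  obtain ⟨h4, h5⟩ := B.len_le ws w h.1
  have h6 : (swapCount ws : ℤ) ≤ swapCount ws' := by exact_mod_cast (by omega)
  have h7 : B.len w = swapCount ws := by linarith
  exact ⟨h7.symm, h5 h7⟩

end Step

/-! ### Change of normalization -/

section Normalization

variable {n : ℕ}

/-- The isomorphism `T_i ↦ -T_i` between the two normalizations of the Hecke algebra. -/
noncomputable def heckeSign (n : ℕ) : HeckeAlgebra n (1 - qq) →ₐ[ℤ[T;T⁻¹]] HeckeAlgebra n (qq - 1) :=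
  RingQuot.liftAlgHom ℤ[T;T⁻¹]
    ⟨FreeAlgebra.lift ℤ[T;T⁻¹] fun i => -heckeGen (qq - 1) i, by
      intro x y hxy
      induction hxy with
      | quad i =>
        simp only [map_mul, map_add, map_smul, FreeAlgebra.lift_ι_apply, AlgHom.commutes, neg_mul_neg]
        rw [heckeGen_sq, smul_neg, ← neg_smul, neg_sub]
      | comm i j h =>
        simp only [map_mul, FreeAlgebra.lift_ι_apply, neg_mul_neg]
        exact heckeGen_comm _ h
      | braid i j h =>
        simp only [map_mul, FreeAlgebra.lift_ι_apply, neg_mul, mul_neg]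
        rw [heckeGen_braid _ h]⟩

theorem heckeSign_gen (i : Fin (n - 1)) :
    heckeSign n (heckeGen (1 - qq) i) = -heckeGen (qq - 1) i := by
  unfold heckeSign heckeGen
  erw [RingQuot.liftAlgHom_mkAlgHom_apply]
  simp

theorem heckeSign_prod (l : List (Fin (n - 1))) :
    heckeSign n (l.map (heckeGen (1 - qq))).prod =
      (-1) ^ l.length * (l.map (heckeGen (qq - 1))).prod := by
  induction l with
  | nil => simp
  | cons i l ih =>
    rw [List.map_cons, List.prod_cons, map_mul, ih, heckeSign_gen, List.map_cons, List.prod_cons,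
      List.length_cons, pow_succ, mul_neg_one, neg_mul, neg_mul, ← mul_assoc, ← mul_assoc,
      ((Commute.neg_one_left (heckeGen (qq - 1) i)).pow_left l.length).eq]

theorem heckeTrace_heckeSign (h : HeckeAlgebra n (1 - qq)) :
    heckeTrace (qq - 1) (heckeSign n h) = heckeTrace (1 - qq) h := by
  have := mem_span_heckeT (1 - qq) h
  induction this using Submodule.span_induction with
  | zero => simp
  | add x y _ _ hx hy => rw [map_add, map_add, map_add, hx, hy]
  | smul c x _ hx => rw [map_smul, map_smul, map_smul, hx]
  | mem x hx =>
    obtain ⟨w, rfl⟩ := hx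
    obtain ⟨l, rfl, hl⟩ := exists_reduced w
    rw [heckeT_eq _ hl, heckeSign_prod, heckeTrace_reduced _ l hl]
    rcases neg_one_pow_eq_or (HeckeAlgebra n (qq - 1)) l.length with h | h
    · rw [h, one_mul, heckeTrace_reduced _ l hl]
    · rw [h, neg_one_mul, map_neg, heckeTrace_reduced _ l hl]
      split_ifs with h1
      · rw [h1, permLength_one] at hl
        rw [hl, pow_zero] at h
        -- `1 = -1` in the algebra, and hence in the base ring
        have h2 := congrArg (heckeTrace (qq - 1)) h
        have h3 : heckeTrace (qq - 1) (1 : HeckeAlgebra n (qq - 1)) = 1 := by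
          rw [← heckeT_one, heckeTrace_heckeT, if_pos rfl]
        rw [map_neg, h3] at h2
        exact h2.symm
      · exact neg_zero

theorem heckeSign_heckeWord (ws : List (Factor n)) :
    Units.map (heckeSign n : HeckeAlgebra n (1 - qq) →* HeckeAlgebra n (qq - 1))
        (heckeWord (1 - qq) ws) = (-1) ^ swapCount ws * heckeWord (qq - 1) ws := by
  induction ws with
  | nil => simp [heckeWord, swapCount]
  | cons f ws ih =>
    cases f with
    | bar => rw [heckeWord_bar, heckeWord_bar, swapCount_bar, ih]
    | s i =>
      have h1 : ∀ b : ℤ[T;T⁻¹], heckeWord b (Factor.s i :: ws) = heckeUnit b i * heckeWord b ws :=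
        fun b => by simp [heckeWord]
      have h2 : swapCount (Factor.s i :: ws) = swapCount ws + 1 := by
        simp [swapCount, add_comm]
      have h3 : Units.map (heckeSign n : HeckeAlgebra n (1 - qq) →* HeckeAlgebra n (qq - 1))
          (heckeUnit (1 - qq) i) = -1 * heckeUnit (qq - 1) i := by
        ext
        rw [neg_one_mul, Units.val_neg]
        exact heckeSign_gen i
      rw [h1, h1, h2, map_mul, ih, h3, pow_succ', mul_assoc, mul_assoc, ← mul_assoc (heckeUnit _ _),
        ← mul_assoc ((-1) ^ _), ((Commute.neg_one_left (heckeUnit (qq - 1) i)).pow_left _).eq]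

/-- The trace forms of the two normalizations agree up to sign. -/
theorem heckeTrace_heckeWord (uw vw : List (Factor n)) :
    heckeTrace (qq - 1)
        (((heckeWord (qq - 1) vw)⁻¹ * heckeWord (qq - 1) uw : (HeckeAlgebra n (qq - 1))ˣ) :
          HeckeAlgebra n (qq - 1)) =
      (-1) ^ (swapCount uw + swapCount vw) * heckeTrace (1 - qq)
        (((heckeWord (1 - qq) vw)⁻¹ * heckeWord (1 - qq) uw : (HeckeAlgebra n (1 - qq))ˣ) :
          HeckeAlgebra n (1 - qq)) := by
  have hinv : ∀ m : ℕ, ((-1 : (HeckeAlgebra n (qq - 1))ˣ) ^ m)⁻¹ = (-1) ^ m := fun m => by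
    rw [← inv_pow, inv_neg, inv_one]
  have h1 : Units.map (heckeSign n : HeckeAlgebra n (1 - qq) →* HeckeAlgebra n (qq - 1))
      ((heckeWord (1 - qq) vw)⁻¹ * heckeWord (1 - qq) uw) =
      (-1) ^ (swapCount uw + swapCount vw) *
        ((heckeWord (qq - 1) vw)⁻¹ * heckeWord (qq - 1) uw) := by
    rw [map_mul, map_inv, heckeSign_heckeWord, heckeSign_heckeWord, mul_inv_rev, hinv, pow_add,
      ((Commute.neg_one_left ((heckeWord (qq - 1) vw)⁻¹)).pow_left _).symm.eq]
    simp only [mul_assoc]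
    rw [← mul_assoc _ ((-1) ^ swapCount uw), ← ((Commute.neg_one_left
      ((heckeWord (qq - 1) vw)⁻¹)).pow_left (swapCount uw)).eq, mul_assoc, ← mul_assoc, ← pow_add,
      add_comm, pow_add, mul_assoc]
  have h2 := congrArg (fun x : (HeckeAlgebra n (qq - 1))ˣ => heckeTrace (qq - 1) (x : HeckeAlgebra n (qq - 1))) h1
  have h3 := heckeTrace_heckeSign (↑((heckeWord (1 - qq) vw)⁻¹ * heckeWord (1 - qq) uw) :
    HeckeAlgebra n (1 - qq))
  change heckeTrace (qq - 1) (heckeSign n _) = _ at h2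
  rw [h3] at h2
  rw [h2]
  rcases neg_one_pow_eq_or ℤ (swapCount uw + swapCount vw) with h | h
  · have e1 : ((-1 : (HeckeAlgebra n (qq - 1))ˣ)) ^ (swapCount uw + swapCount vw) = 1 :=
      Even.neg_one_pow (by rwa [neg_one_pow_eq_one_iff_even (by norm_num)] at h)
    have e2 : (-1 : ℤ[T;T⁻¹]) ^ (swapCount uw + swapCount vw) = 1 :=
      Even.neg_one_pow (by rwa [neg_one_pow_eq_one_iff_even (by norm_num)] at h)
    rw [e1, e2, one_mul, one_mul]
  · have hodd : Odd (swapCount uw + swapCount vw) := by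
      rwa [neg_one_pow_eq_neg_one_iff_odd (by norm_num)] at h
    rw [hodd.neg_one_pow, hodd.neg_one_pow, neg_one_mul, neg_one_mul, Units.val_neg, map_neg, neg_neg]

end Normalization

end TiltedRichardson

theorem mainTheorem9 (n : ℕ) (a : Fin n → Fin n) (u v : Equiv.Perm (Fin n))
    (huv : TiltedLESim a u v) (uw vw : List (Factor n))
    (hu : IsTiltedReducedWord a uw u) (hv : IsTiltedReducedWord a vw v) :
    (∃! R : ℤ[X], IsTiltedRPolynomial u v R) ∧
      ∀ R : ℤ[X], IsTiltedRPolynomial u v R →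
        Polynomial.toLaurent R = qq ^ quantumBruhatDist u v *
            heckeTrace (1 - qq)
              (((heckeWord (1 - qq) vw)⁻¹ * heckeWord (1 - qq) uw : (HeckeAlgebra n (1 - qq))ˣ) :
                HeckeAlgebra n (1 - qq)) ∧
        Polynomial.toLaurent R = (-qq) ^ quantumBruhatDist u v *
            heckeTrace (qq - 1)
              (((heckeWord (qq - 1) vw)⁻¹ * heckeWord (qq - 1) uw : (HeckeAlgebra n (qq - 1))ˣ) :
                HeckeAlgebra n (qq - 1)) := by
  obtain ⟨B⟩ := TiltedBasis.nonempty a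
  obtain ⟨hu1, hu2⟩ := B.of_isTiltedReducedWord hu
  obtain ⟨hv1, hv2⟩ := B.of_isTiltedReducedWord hv
  have hdist := huv.1.quantumBruhatDist_eq
  have hlen := B.len_sub u v huv.2
  have htrace : tracePoly a B.elt u v = qq ^ quantumBruhatDist u v * heckeTrace (1 - qq)
      (↑((heckeWord (1 - qq) vw)⁻¹ * heckeWord (1 - qq) uw) : HeckeAlgebra n (1 - qq)) := by
    have hpow : (qq : ℤ[T;T⁻¹]) ^ quantumBruhatDist u v =
        LaurentPolynomial.T (quantumBruhatDist u v : ℤ) := by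
      rw [qq, LaurentPolynomial.T_pow, mul_one]
    rw [tracePoly, hu2, hv2, ← hdist, hpow]
  have heval : ∀ (F : Type) [Field F] [Finite F],
      evalCard F (tracePoly a B.elt u v) = (Nat.card (openTiltedRichardson F u v) : ℤ) := by
    intro F _ _
    rw [← B.pointCount_eq F v u huv.2, openTiltedRichardson_eq huv.1, pointCount]
  have huniq : ∀ R : ℤ[X], IsTiltedRPolynomial u v R →
      Polynomial.toLaurent R = tracePoly a B.elt u v := by
    intro R hR
    rw [← sub_eq_zero]
    refine eq_zero_of_evalCard fun F _ _ => ?_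
    rw [map_sub, heval, evalCard_toLaurent, hR F, sub_self]
  obtain ⟨R, hR⟩ := exists_toLaurent_eq (f := tracePoly a B.elt u v) fun F _ _ => ⟨_, heval F⟩
  refine ⟨⟨R, fun F _ _ => ?_, fun R' hR' => ?_⟩, fun R' hR' => ?_⟩
  · have h1 := heval F
    rw [← hR, evalCard_toLaurent] at h1
    exact_mod_cast h1
  · exact Polynomial.toLaurent_injective (by rw [huniq R' hR', hR])
  · have h1 := huniq R' hR'
    rw [htrace] at h1
    refine ⟨h1, h1.trans ?_⟩
    -- the signs cancel, as the lengths of the words differ by the distance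
    have hsum : swapCount vw = swapCount uw + quantumBruhatDist u v := by omega
    rw [heckeTrace_heckeWord, neg_pow, hsum, mul_mul_mul_comm, ← pow_add]
    have heven : Even (quantumBruhatDist u v + (swapCount uw + (swapCount uw + quantumBruhatDist u v))) :=
      ⟨swapCount uw + quantumBruhatDist u v, by ring⟩
    rw [heven.neg_one_pow, one_mul]
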